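/- All forms are non-degenerate symmetric bilinear forms on finite-dimensional vector spaces, and $\langle a\rangle$ denotes the rank one form $(x,y)\mapsto axy$. For a field $F$ let $W(F)$ be the Witt group of $F$, i.e. the set of forms over $F$ modulo the relation $B_1\sim B_2$ iff $B_1\oplus M_1\cong B_2\oplus M_2$ for some metabolic forms $M_1,M_2$ (a form of rank $2k$ is metabolic if it has a totally isotropic subspace of dimension $k$), with addition induced by $\oplus$; write $[B]$ for the class of $B$ and $[a]$ for the class of $\langle a\rangle$. For a prime $p$ let $\partial_p:W(\mathbb Q)\to W(\mathbb F_p)$ be the composition of $W(\mathbb Q)\to W(\mathbb Q_p)$ with the second residue homomorphism $W(\mathbb Q_p)\to W(\mathbb F_p)$, the additive map with $[u]\mapsto 0$ and $[pu]\mapsto[\bar u]$ for all $u\in\mathbb Z_p^\ast$, and let $\partial=\oplus_p\partial_p:W(\mathbb Q)\to\bigoplus_p W(\mathbb F_p)$. The Witt span of $[B]\in W(\mathbb Q)$ is $ws([B])=\min\{\operatorname{rank}B' \mid \partial[B']=\partial[B]\}$. Let $B$ be a form over $\mathbb Q$. For $r=1,2,3$ let $\mathcal I_r$ be the set of signatures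 of the anisotropic forms of rank $r$ over $\mathbb Q$ whose Witt class lies in $\partial^{-1}(\partial[B])$, and for $i\in\mathcal I_r$ let $B_i$ denote such a form (of rank $r$) with signature $i$. Then: (i) $ws([B])=0$ if and only if $\partial[B]=0$. (ii) $ws([B])=1$ if and only if $\mathcal I_1\neq\emptyset$ and $\partial[B]\neq 0$. (iii) $ws([B])=2$ if and only if $\mathcal I_2\ne\emptyset$ and for each $i\in\mathcal I_2$ the forms $B_i\oplus\langle 1\rangle$ and $B_i\oplus\langle -1\rangle$ are anisotropic. The set $\mathcal I_2$ is always a subset of $\{0,\pm2\}$, and for every non-empty subset $S$ of $\{0,\pm 2\}$ there is a form $B$ over $\mathbb Q$ with $ws([B])=2$ and $\mathcal I_2=S$. (iv) $ws([B])=3$ if and only if $\mathcal I_3=\{\pm1,\pm3\}$ and for each $i\in\mathcal I_3$ the forms $B_i\oplus\langle 1\rangle$ and $B_i\oplus\langle -1\rangle$ are anisotropic. -/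

import Mathlib

open scoped TensorProduct DirectSum

noncomputable section

/-- A non-degenerate symmetric bilinear form `(V, B)` on a finite-dimensional vector space. -/
structure SymForm (F : Type) [Field F] where
  V : Type
  [grp : AddCommGroup V]
  [mod : Module F V]
  [fin : FiniteDimensional F V]
  form : LinearMap.BilinForm F V
  symm : form.IsSymm
  nondeg : form.Nondegenerate

attribute [instance] SymForm.grp SymForm.mod SymForm.fin

namespace SymForm

variable {F : Type} [Field F]

theorem nondeg_of_symm {V : Type} [AddCommGroup V] [Module F V] {B : LinearMap.BilinForm F V}
    (hs : B.IsSymm) (h : ∀ x, (∀ y, B x y = 0) → x = 0) : B.Nondegenerate := by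
  refine ⟨h, fun y hy => h y fun x => ?_⟩
  rw [hs.eq]; exact hy x

/-- The rank of a non-degenerate form is the dimension of the underlying space. -/
def rank (B : SymForm F) : ℕ := Module.finrank F B.V

/-- Isomorphism of forms. -/
def Iso (B₁ B₂ : SymForm F) : Prop := B₁.form.Equivalent B₂.form

/-- `B` is anisotropic: no nonzero vector `x` has `B(x, x) = 0`. -/
def Anisotropic (B : SymForm F) : Prop := ∀ x : B.V, B.form x x = 0 → x = 0

/-- `B` is metabolic: it has even rank `2k` and a totally isotropic subspace of dimension `k`. -/
def Metabolic (B : SymForm F) : Prop :=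
  ∃ (k : ℕ) (W : Submodule F B.V), B.rank = 2 * k ∧ Module.finrank F W = k ∧
    ∀ x ∈ W, ∀ y ∈ W, B.form x y = 0

/-- The bilinear form `(B₁ ⊕ B₂)((x₁, x₂), (y₁, y₂)) = B₁(x₁, y₁) + B₂(x₂, y₂)`. -/
def sumForm {V₁ V₂ : Type} [AddCommGroup V₁] [Module F V₁] [AddCommGroup V₂] [Module F V₂]
    (B₁ : LinearMap.BilinForm F V₁) (B₂ : LinearMap.BilinForm F V₂) :
    LinearMap.BilinForm F (V₁ × V₂) :=
  B₁.comp (LinearMap.fst F V₁ V₂) (LinearMap.fst F V₁ V₂) +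
    B₂.comp (LinearMap.snd F V₁ V₂) (LinearMap.snd F V₁ V₂)

@[simp]
theorem sumForm_apply {V₁ V₂ : Type} [AddCommGroup V₁] [Module F V₁] [AddCommGroup V₂]
    [Module F V₂] (B₁ : LinearMap.BilinForm F V₁) (B₂ : LinearMap.BilinForm F V₂)
    (x y : V₁ × V₂) : sumForm B₁ B₂ x y = B₁ x.1 y.1 + B₂ x.2 y.2 := rfl

theorem sumForm_symm (B₁ B₂ : SymForm F) : (sumForm B₁.form B₂.form).IsSymm :=
  ⟨fun x y => by simp [B₁.symm.eq x.1 y.1, B₂.symm.eq x.2 y.2]⟩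

/-- The orthogonal sum of two forms. -/
def sum (B₁ B₂ : SymForm F) : SymForm F where
  V := B₁.V × B₂.V
  form := sumForm B₁.form B₂.form
  symm := sumForm_symm B₁ B₂
  nondeg := nondeg_of_symm (sumForm_symm B₁ B₂) fun x h => Prod.ext
    (B₁.nondeg.1 _ fun y => by simpa using h (y, 0))
    (B₂.nondeg.1 _ fun y => by simpa using h (0, y))

/-- The form `-B`. -/
def neg (B : SymForm F) : SymForm F where
  V := B.V
  form := -B.form
  symm := ⟨fun x y => by simp [B.symm.eq x y]⟩
  nondeg := nondeg_of_symm ⟨fun x y => by simp [B.symm.eq x y]⟩ fun x h =>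
    B.nondeg.1 _ fun y => by simpa using h y

/-- The form on the zero space. -/
def zero : SymForm F where
  V := PUnit
  form := 0
  symm := ⟨fun _ _ => rfl⟩
  nondeg := nondeg_of_symm ⟨fun _ _ => rfl⟩ fun _ _ => rfl

/-- The rank one form `⟨a⟩(x, y) = a x y`. -/
def unary (a : Fˣ) : SymForm F where
  V := F
  form := (a : F) • LinearMap.mul F F
  symm := ⟨fun x y => by simp [mul_comm x y]⟩
  nondeg := nondeg_of_symm ⟨fun x y => by simp [mul_comm x y]⟩ fun x h => by
    simpa using h 1

theorem Iso.refl (B : SymForm F) : Iso B B := LinearMap.BilinForm.Equivalent.refl _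

theorem Iso.symm {B₁ B₂ : SymForm F} (h : Iso B₁ B₂) : Iso B₂ B₁ :=
  LinearMap.BilinForm.Equivalent.symm h

theorem Iso.trans {B₁ B₂ B₃ : SymForm F} (h : Iso B₁ B₂) (h' : Iso B₂ B₃) : Iso B₁ B₃ :=
  LinearMap.BilinForm.Equivalent.trans h h'

theorem Iso.of {B₁ B₂ : SymForm F} (e : B₁.V ≃ₗ[F] B₂.V)
    (h : ∀ x y, B₂.form (e x) (e y) = B₁.form x y) : Iso B₁ B₂ := ⟨{ e with map_app' := h }⟩

theorem Iso.exists {B₁ B₂ : SymForm F} (h : Iso B₁ B₂) :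
    ∃ e : B₁.V ≃ₗ[F] B₂.V, ∀ x y, B₂.form (e x) (e y) = B₁.form x y := by
  obtain ⟨f⟩ := h
  exact ⟨f.toLinearEquiv, f.map_app'⟩

theorem Iso.sum {A A' B B' : SymForm F} (h : Iso A A') (h' : Iso B B') :
    Iso (A.sum B) (A'.sum B') := by
  obtain ⟨e, he⟩ := h.exists
  obtain ⟨f, hf⟩ := h'.exists
  exact Iso.of (B₁ := A.sum B) (B₂ := A'.sum B') (e.prodCongr f)
    fun x y => congrArg₂ (· + ·) (he x.1 y.1) (hf x.2 y.2)

theorem sum_comm_iso (A B : SymForm F) : Iso (A.sum B) (B.sum A) :=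
  Iso.of (B₁ := A.sum B) (B₂ := B.sum A) (LinearEquiv.prodComm F A.V B.V)
    fun _ _ => add_comm _ _

theorem sum_assoc_iso (A B C : SymForm F) : Iso ((A.sum B).sum C) (A.sum (B.sum C)) :=
  Iso.of (B₁ := (A.sum B).sum C) (B₂ := A.sum (B.sum C)) (LinearEquiv.prodAssoc F A.V B.V C.V)
    fun _ _ => (add_assoc _ _ _).symm

theorem zero_sum_iso (A : SymForm F) : Iso ((zero : SymForm F).sum A) A :=
  Iso.of (B₁ := (zero : SymForm F).sum A) (B₂ := A) 
    (LinearEquiv.uniqueProd (R := F) (M := A.V) (M₂ := PUnit))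
    fun _ _ => (zero_add _).symm

theorem sum_sum_sum_comm_iso (A B C D : SymForm F) :
    Iso ((A.sum B).sum (C.sum D)) ((A.sum C).sum (B.sum D)) :=
  Iso.of (B₁ := (A.sum B).sum (C.sum D)) (B₂ := (A.sum C).sum (B.sum D))
    (LinearEquiv.prodProdProdComm F A.V B.V C.V D.V) fun _ _ => add_add_add_comm _ _ _ _

theorem metabolic_zero : (zero : SymForm F).Metabolic :=
  ⟨0, ⊥, Module.finrank_zero_of_subsingleton (M := PUnit), finrank_bot _ _, fun _ _ _ _ => rfl⟩

theorem Metabolic.sum {A B : SymForm F} (hA : A.Metabolic) (hB : B.Metabolic) :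
    (A.sum B).Metabolic := by
  obtain ⟨k, W, h1, h2, h3⟩ := hA
  obtain ⟨k', W', h1', h2', h3'⟩ := hB
  refine ⟨k + k', W.prod W', ?_, ?_, fun x hx y hy => ?_⟩
  · have : (A.sum B).rank = A.rank + B.rank := Module.finrank_prod (R := F) (M := A.V) (M' := B.V)
    omega
  · rw [← h2, ← h2', ← Module.finrank_prod, ← LinearMap.finrank_range_of_inj
      (f := W.subtype.prodMap W'.subtype)
      (Prod.map_injective.2 ⟨W.injective_subtype, W'.injective_subtype⟩)]
    rw [LinearMap.range_prodMap, Submodule.range_subtype, Submodule.range_subtype]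
    rfl
  · exact (congrArg₂ (· + ·) (h3 _ hx.1 _ hy.1) (h3' _ hx.2 _ hy.2)).trans (add_zero _)

theorem metabolic_sum_neg (A : SymForm F) : (A.sum A.neg).Metabolic := by
  refine ⟨A.rank, LinearMap.range (LinearMap.prod (LinearMap.id : A.V →ₗ[F] A.V) LinearMap.id),
    ?_, ?_, ?_⟩
  · have : (A.sum A.neg).rank = A.rank + A.rank :=
      Module.finrank_prod (R := F) (M := A.V) (M' := A.V)
    omega
  · refine LinearMap.finrank_range_of_inj fun x y h => ?_
    exact congrArg Prod.fst h
  · rintro _ ⟨x, rfl⟩ _ ⟨y, rfl⟩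
    exact add_neg_cancel (A.form x y)

/-- Witt equivalence: the forms become isomorphic after adding metabolic forms. -/
def WittEquiv (B₁ B₂ : SymForm F) : Prop :=
  ∃ M₁ M₂ : SymForm F, M₁.Metabolic ∧ M₂.Metabolic ∧ Iso (B₁.sum M₁) (B₂.sum M₂)

theorem Iso.wittEquiv {A B : SymForm F} (h : Iso A B) : WittEquiv A B :=
  ⟨zero, zero, metabolic_zero, metabolic_zero, h.sum (Iso.refl _)⟩

theorem WittEquiv.trans {A B C : SymForm F} (h : WittEquiv A B) (h' : WittEquiv B C) :
    WittEquiv A C := by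
  obtain ⟨M₁, M₂, m1, m2, e⟩ := h
  obtain ⟨N₁, N₂, n1, n2, f⟩ := h'
  refine ⟨M₁.sum N₁, N₂.sum M₂, m1.sum n1, n2.sum m2, ?_⟩
  refine (sum_assoc_iso _ _ _).symm.trans ((e.sum (Iso.refl N₁)).trans ?_)
  refine (sum_assoc_iso _ _ _).trans (((Iso.refl B).sum (sum_comm_iso _ _)).trans ?_)
  exact (sum_assoc_iso _ _ _).symm.trans ((f.sum (Iso.refl M₂)).trans (sum_assoc_iso _ _ _))

theorem WittEquiv.sum {A B C D : SymForm F} (h : WittEquiv A B) (h' : WittEquiv C D) :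
    WittEquiv (A.sum C) (B.sum D) := by
  obtain ⟨M₁, M₂, m1, m2, e⟩ := h
  obtain ⟨N₁, N₂, n1, n2, f⟩ := h'
  exact ⟨M₁.sum N₁, M₂.sum N₂, m1.sum n1, m2.sum n2,
    (sum_sum_sum_comm_iso _ _ _ _).trans ((e.sum f).trans (sum_sum_sum_comm_iso _ _ _ _))⟩

theorem Metabolic.neg {A : SymForm F} (hA : A.Metabolic) : A.neg.Metabolic := by
  obtain ⟨k, W, h1, h2, h3⟩ := hA
  exact ⟨k, W, h1, h2, fun x hx y hy => (congrArg Neg.neg (h3 x hx y hy)).trans neg_zero⟩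

theorem Iso.neg {A B : SymForm F} (h : Iso A B) : Iso A.neg B.neg := by
  obtain ⟨e, he⟩ := h.exists
  exact Iso.of (B₁ := A.neg) (B₂ := B.neg) e fun x y => congrArg Neg.neg (he x y)

theorem neg_sum_iso (A B : SymForm F) : Iso (A.sum B).neg (A.neg.sum B.neg) :=
  Iso.of (B₁ := (A.sum B).neg) (B₂ := A.neg.sum B.neg) (LinearEquiv.refl F (A.V × B.V))
    fun _ _ => (neg_add _ _).symm

theorem WittEquiv.neg {A B : SymForm F} (h : WittEquiv A B) : WittEquiv A.neg B.neg := by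
  obtain ⟨M₁, M₂, m1, m2, e⟩ := h
  exact ⟨M₁.neg, M₂.neg, m1.neg, m2.neg,
    (neg_sum_iso _ _).symm.trans (e.neg.trans (neg_sum_iso _ _))⟩

theorem Metabolic.wittEquiv_zero {A : SymForm F} (h : A.Metabolic) : WittEquiv A zero :=
  ⟨zero, A, metabolic_zero, h, sum_comm_iso _ _⟩

instance wittSetoid (F : Type) [Field F] : Setoid (SymForm F) where
  r := WittEquiv
  iseqv :=
    { refl := fun A => (Iso.refl A).wittEquiv
      symm := fun ⟨M₁, M₂, m1, m2, e⟩ => ⟨M₂, M₁, m2, m1, e.symm⟩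
      trans := WittEquiv.trans }

end SymForm

/-- The additive group of the Witt ring `W(F)`: Witt equivalence classes of forms. -/
def WittGroup (F : Type) [Field F] : Type 1 := Quotient (SymForm.wittSetoid F)

namespace WittGroup

open SymForm

variable {F : Type} [Field F]

/-- The Witt class `[B]`. -/
def mk (B : SymForm F) : WittGroup F := Quotient.mk _ B

theorem mk_eq {A B : SymForm F} (h : WittEquiv A B) : mk A = mk B := Quotient.sound h

instance : Add (WittGroup F) :=
  ⟨Quotient.map₂ SymForm.sum fun _ _ h _ _ h' => WittEquiv.sum h h'⟩

instance : Neg (WittGroup F) := ⟨Quotient.map SymForm.neg fun _ _ h => WittEquiv.neg h⟩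

instance : Zero (WittGroup F) := ⟨mk SymForm.zero⟩

theorem mk_sum (A B : SymForm F) : mk (A.sum B) = mk A + mk B := rfl

theorem mk_zero : mk (SymForm.zero : SymForm F) = 0 := rfl

theorem mk_neg (A : SymForm F) : mk A.neg = -mk A := rfl

theorem ind {p : WittGroup F → Prop} (h : ∀ B, p (mk B)) (x : WittGroup F) : p x :=
  Quotient.ind h x

instance : AddCommGroup (WittGroup F) where
  add_assoc x y z := by
    induction x using ind; induction y using ind; induction z using ind
    exact mk_eq (sum_assoc_iso _ _ _).wittEquiv
  zero_add x := by
    induction x using ind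
    exact mk_eq (zero_sum_iso _).wittEquiv
  add_zero x := by
    induction x using ind
    exact mk_eq ((sum_comm_iso _ _).trans (zero_sum_iso _)).wittEquiv
  neg_add_cancel x := by
    induction x using ind
    exact mk_eq ((sum_comm_iso _ _).wittEquiv.trans (metabolic_sum_neg _).wittEquiv_zero)
  add_comm x y := by
    induction x using ind; induction y using ind
    exact mk_eq (sum_comm_iso _ _).wittEquiv
  nsmul := nsmulRec
  zsmul := zsmulRec

theorem mk_metabolic {A : SymForm F} (h : A.Metabolic) : mk A = 0 := mk_eq h.wittEquiv_zero

/-- The class `[a]` of the rank one form `⟨a⟩`. -/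
def unary (a : Fˣ) : WittGroup F := mk (SymForm.unary a)

end WittGroup

section Lift

variable {K : Type} [Field K]

/-- Relations satisfied by `a ↦ [a]`, `a ∈ K^*`, in the Witt group of a field. -/
structure WittRelations {G : Type 1} [AddCommGroup G] (r : K → G) : Prop where
  sq : ∀ a c : K, a ≠ 0 → c ≠ 0 → r (a * c ^ 2) = r a
  neg : ∀ a : K, a ≠ 0 → r a + r (-a) = 0
  add : ∀ a b : K, a ≠ 0 → b ≠ 0 → a + b ≠ 0 → r a + r b = r (a + b) + r (a * b * (a + b))

/-- In an orthogonal family, a vector `x` with at least three nonzero coordinates has two whose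
contributions to `B(x, x)` do not cancel. -/
theorem exists_pair_ne_zero (h2 : (2 : K) ≠ 0) {ι : Type} (t : Finset ι) (f : ι → K)
    (hf : ∀ i ∈ t, f i ≠ 0) (ht : 2 < t.card) :
    ∃ i ∈ t, ∃ j ∈ t, i ≠ j ∧ f i + f j ≠ 0 := by
  obtain ⟨i, j, k, hi, hj, hk, hij, hik, hjk⟩ := Finset.two_lt_card_iff.1 ht
  by_contra! H
  have h1 := H i hi j hj hij
  have h3 := H i hi k hk hik
  have h4 := H j hj k hk hjk
  have : 2 * f i = 0 := by linear_combination h1 + h3 - h4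
  exact hf i hi ((mul_eq_zero.1 this).resolve_left h2)

theorem sum_eq_add_add_erase {M : Type*} [AddCommMonoid M] {ι : Type} [DecidableEq ι]
    {s : Finset ι} {i j : ι} (hi : i ∈ s) (hj : j ∈ s) (hij : i ≠ j) (g : ι → M) :
    ∑ k ∈ s, g k = g i + g j + ∑ k ∈ (s.erase i).erase j, g k := by
  rw [add_assoc, Finset.add_sum_erase _ _ (Finset.mem_erase.2 ⟨hij.symm, hj⟩),
    Finset.add_sum_erase _ _ hi]

open scoped Classical in
/-- The diagonal entries of a form with a totally isotropic subspace of at least half the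
dimension have trivial sum under any map obeying the Witt relations. -/
theorem WittRelations.sum_eq_zero {G : Type 1} [AddCommGroup G] {r : K → G}
    (hr : WittRelations r) (h2 : (2 : K) ≠ 0) {V : Type} [AddCommGroup V] [Module K V]
    [FiniteDimensional K V] (B : LinearMap.BilinForm K V) (hB : B.IsSymm) {ι : Type}
    (n m : ℕ) (s : Finset ι) (v : ι → V) (N : Submodule K V) (x : V)
    (hn : s.card = n) (hm : (s.filter fun k => B x (v k) ≠ 0).card = m)
    (hx : x ∈ N) (hx0 : x ≠ 0 ∨ n = 0)
    (hv : ∀ i ∈ s, ∀ j ∈ s, i ≠ j → B (v i) (v j) = 0) (hv0 : ∀ i ∈ s, B (v i) (v i) ≠ 0)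
    (hN : ∀ y ∈ N, ∀ z ∈ N, B y z = 0)
    (hexp : ∀ y ∈ N, y = ∑ k ∈ s, (B y (v k) / B (v k) (v k)) • v k)
    (hdim : n ≤ 2 * Module.finrank K N) :
    ∑ k ∈ s, r (B (v k) (v k)) = 0 := by
  induction n using Nat.strong_induction_on generalizing m s v N x with
  | _ n ihn =>
  induction m using Nat.strong_induction_on generalizing v with
  | _ m ihm =>
  rcases Nat.eq_zero_or_pos n with h0 | hpos
  · have : s = ∅ := Finset.card_eq_zero.1 (hn.trans h0)
    simp [this]
  have hx0 : x ≠ 0 := hx0.resolve_right hpos.ne'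
  set t := s.filter fun k => B x (v k) ≠ 0 with ht
  -- the value of `B x x` in coordinates
  have hxx : ∑ k ∈ t, B x (v k) ^ 2 / B (v k) (v k) = 0 := by
    have h1 : B x x = ∑ k ∈ s, B x (v k) ^ 2 / B (v k) (v k) := by
      conv_lhs => rw [hexp x hx]
      rw [← hexp x hx]
      conv_lhs => enter [2]; rw [hexp x hx]
      rw [map_sum]
      refine Finset.sum_congr rfl fun k _ => ?_
      simp; ring
    rw [hN x hx x hx] at h1
    rw [h1, ht, Finset.sum_filter]
    refine Finset.sum_congr rfl fun k _ => ?_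
    by_cases h : B x (v k) = 0 <;> simp [h]
  have hxexp : x = ∑ k ∈ t, (B x (v k) / B (v k) (v k)) • v k := by
    conv_lhs => rw [hexp x hx]
    rw [ht, Finset.sum_filter]
    refine Finset.sum_congr rfl fun k _ => ?_
    by_cases h : B x (v k) = 0 <;> simp [h]
  have hts : ∀ i ∈ t, i ∈ s ∧ B x (v i) ≠ 0 := fun i hi => Finset.mem_filter.1 hi
  by_cases hcard : 2 < t.card
  · -- reduce the number of nonzero coordinates of `x`
    obtain ⟨i, hi, j, hj, hij, hne⟩ := exists_pair_ne_zero h2 t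
      (fun k => B x (v k) ^ 2 / B (v k) (v k))
      (fun k hk => div_ne_zero (pow_ne_zero _ (hts k hk).2) (hv0 k (hts k hk).1)) hcard
    obtain ⟨his, hci⟩ := hts i hi
    obtain ⟨hjs, hcj⟩ := hts j hj
    have hai := hv0 i his
    have haj := hv0 j hjs
    have hBij := hv i his j hjs hij
    have hBji := hv j hjs i his hij.symm
    generalize hα : B x (v i) = α at *
    generalize hβ : B x (v j) = β at *
    generalize ha : B (v i) (v i) = a at *
    generalize hb : B (v j) (v j) = b at *
    set S := α ^ 2 / a + β ^ 2 / b with hS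
    set w₁ := (α / a) • v i + (β / b) • v j with hw₁
    set w₂ := (-β) • v i + α • v j with hw₂
    have e11 : B w₁ w₁ = S := by
      simp only [hw₁, map_add, map_smul, LinearMap.add_apply, LinearMap.smul_apply, ha, hb, hBij,
        hBji, smul_eq_mul, hS]
      field_simp; ring
    have e22 : B w₂ w₂ = a * b * S := by
      simp only [hw₂, map_add, map_smul, LinearMap.add_apply, LinearMap.smul_apply, ha, hb, hBij,
        hBji, smul_eq_mul, hS]
      field_simp; ring
    have e12 : B w₁ w₂ = 0 := by
      simp only [hw₁, hw₂, map_add, map_smul, LinearMap.add_apply, LinearMap.smul_apply, ha, hb,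
        hBij, hBji, smul_eq_mul]
      field_simp; ring
    have hS0 : S ≠ 0 := hne
    set v' := Function.update (Function.update v i w₁) j w₂ with hv'
    have hvi : v' i = w₁ := by simp [hv', hij]
    have hvj : v' j = w₂ := by simp [hv']
    have hvk : ∀ k, k ≠ i → k ≠ j → v' k = v k := fun k h h' => by simp [hv', h, h']
    have hort : ∀ k ∈ s, k ≠ i → k ≠ j → ∀ y ∈ ({w₁, w₂} : Set V), B (v k) y = 0 := by
      rintro k hk hki hkj y (rfl | rfl) <;>
        simp [hw₁, hw₂, hv k hk i his hki, hv k hk j hjs hkj]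
    have hvsum : ∑ k ∈ s, r (B (v k) (v k)) = ∑ k ∈ s, r (B (v' k) (v' k)) := by
      rw [sum_eq_add_add_erase his hjs hij, sum_eq_add_add_erase his hjs hij, hvi, hvj, e11, e22,
        ha, hb]
      congr 1
      · have h1 := hr.add (α ^ 2 / a) (β ^ 2 / b) (div_ne_zero (pow_ne_zero _ hci) hai)
          (div_ne_zero (pow_ne_zero _ hcj) haj) hS0
        rw [← hS] at h1
        rw [show α ^ 2 / a * (β ^ 2 / b) * S = a * b * S * (α * β / (a * b)) ^ 2 by field_simp,
          hr.sq _ _ (mul_ne_zero (mul_ne_zero hai haj) hS0)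
            (div_ne_zero (mul_ne_zero hci hcj) (mul_ne_zero hai haj)),
          show α ^ 2 / a = a * (α / a) ^ 2 by field_simp,
          show β ^ 2 / b = b * (β / b) ^ 2 by field_simp,
          hr.sq _ _ hai (div_ne_zero hci hai), hr.sq _ _ haj (div_ne_zero hcj haj)] at h1
        exact h1
      · refine Finset.sum_congr rfl fun k hk => ?_
        simp only [Finset.mem_erase] at hk
        rw [hvk k hk.2.1 hk.1]
    have hx1 : B x w₁ = S := by
      simp only [hw₁, map_add, map_smul, hα, hβ, smul_eq_mul, hS]
      field_simp
    have hx2 : B x w₂ = 0 := by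
      simp only [hw₂, map_add, map_smul, hα, hβ, smul_eq_mul]
      ring
    have hfil : (s.filter fun k => B x (v' k) ≠ 0) = t.erase j := by
      ext k
      simp only [ht, Finset.mem_filter, Finset.mem_erase]
      by_cases hkj : k = j
      · subst hkj; simp [hvj, hx2]
      by_cases hki : k = i
      · subst hki; simp [hvi, hx1, hS0, hij, his, hα, hci]
      · simp [hvk k hki hkj, hkj]
    rw [hvsum]
    refine ihm (m - 1) (by omega) v' ?_ ?_ ?_ ?_
    · rw [hfil, Finset.card_erase_of_mem hj, hm]
    · intro k hk l hl hkl
      by_cases hki : k = i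
      · subst hki
        by_cases hlj : l = j
        · subst hlj; rw [hvi, hvj, e12]
        · rw [hvi, hvk l (Ne.symm hkl) hlj, hB.eq, hort l hl (Ne.symm hkl) hlj _ (by simp)]
      by_cases hkj : k = j
      · subst hkj
        by_cases hli : l = i
        · subst hli; rw [hvi, hvj, hB.eq, e12]
        · rw [hvj, hvk l hli (Ne.symm hkl), hB.eq, hort l hl hli (Ne.symm hkl) _ (by simp)]
      rw [hvk k hki hkj]
      by_cases hli : l = i
      · subst hli; rw [hvi, hort k hk hki hkj _ (by simp)]
      by_cases hlj : l = j
      · subst hlj; rw [hvj, hort k hk hki hkj _ (by simp)]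
      rw [hvk l hli hlj, hv k hk l hl hkl]
    · intro k hk
      by_cases hki : k = i
      · subst hki; rw [hvi, e11]; exact hS0
      by_cases hkj : k = j
      · subst hkj; rw [hvj, e22]; exact mul_ne_zero (mul_ne_zero hai haj) hS0
      rw [hvk k hki hkj]; exact hv0 k hk
    · intro y hy
      conv_lhs => rw [hexp y hy]
      rw [sum_eq_add_add_erase his hjs hij, sum_eq_add_add_erase his hjs hij, hvi, hvj, e11, e22,
        ha, hb]
      congr 1
      · simp only [hw₁, hw₂, map_add, map_smul, smul_eq_mul]
        obtain ⟨D, hD⟩ : ∃ D, D = α ^ 2 * b + β ^ 2 * a := ⟨_, rfl⟩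
        have hS' : S = D / (a * b) := by rw [hS, hD]; field_simp
        have hT : D ≠ 0 := by
          intro h; rw [hS', h, zero_div] at hS0; exact hS0 rfl
        rw [hS']
        generalize B y (v i) = p
        generalize B y (v j) = q
        match_scalars
        · field_simp; rw [hD]; ring
        · field_simp; rw [hD]; ring
      · refine Finset.sum_congr rfl fun k hk => ?_
        simp only [Finset.mem_erase] at hk
        rw [hvk k hk.2.1 hk.1]
  · -- now `x` lies in a hyperbolic plane spanned by two of the vectors
    have ht2 : t.card = 2 := by
      rcases Nat.lt_or_ge t.card 2 with h | h
      · exfalso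
        rcases Nat.lt_or_ge t.card 1 with h' | h'
        · rw [Finset.card_eq_zero.1 (by omega : t.card = 0), Finset.sum_empty] at hxexp
          exact hx0 hxexp
        · obtain ⟨i, hi⟩ := Finset.card_eq_one.1 (by omega : t.card = 1)
          obtain ⟨h1, h2⟩ := hts i (by simp [hi])
          rw [hi, Finset.sum_singleton] at hxx
          exact div_ne_zero (pow_ne_zero _ h2) (hv0 i h1) hxx
      · omega
    obtain ⟨i, j, hij, htij⟩ := Finset.card_eq_two.1 ht2
    obtain ⟨his, hci⟩ := hts i (by simp [htij])
    obtain ⟨hjs, hcj⟩ := hts j (by simp [htij])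
    rw [htij, Finset.sum_pair hij] at hxx hxexp
    have hai := hv0 i his
    have haj := hv0 j hjs
    have hBij := hv i his j hjs hij
    have hBji := hv j hjs i his hij.symm
    generalize hα : B x (v i) = α at *
    generalize hβ : B x (v j) = β at *
    generalize ha : B (v i) (v i) = a at *
    generalize hb : B (v j) (v j) = b at *
    have hrel : α ^ 2 * b + β ^ 2 * a = 0 := by
      field_simp at hxx; linear_combination hxx
    have hbeq : b = -a * (β / α) ^ 2 := by
      field_simp; linear_combination hrel
    have hrab : r a + r b = 0 := by
      rw [hbeq, hr.sq _ _ (neg_ne_zero.2 hai) (div_ne_zero hcj hci), hr.neg a hai]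
    rw [sum_eq_add_add_erase his hjs hij, ha, hb, hrab, zero_add]
    set s' := (s.erase i).erase j with hs'
    have hs'c : s'.card = n - 2 := by
      rw [hs', Finset.card_erase_of_mem (Finset.mem_erase.2 ⟨hij.symm, hjs⟩),
        Finset.card_erase_of_mem his, hn]
      omega
    have hs's : ∀ k ∈ s', k ≠ j ∧ k ≠ i ∧ k ∈ s := fun k hk => by
      simpa only [hs', Finset.mem_erase] using hk
    have hn2 : 2 ≤ n := by
      rw [← hn, ← ht2]; exact Finset.card_le_card (Finset.filter_subset _ _)
    let π : V →ₗ[K] V := LinearMap.id - (B (v i)).smulRight (a⁻¹ • v i) -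
      (B (v j)).smulRight (b⁻¹ • v j)
    have hπ : ∀ y, π y = y - (B y (v i) / a) • v i - (B y (v j) / b) • v j := by
      intro y
      simp only [π, LinearMap.sub_apply, LinearMap.id_apply, LinearMap.smulRight_apply, smul_smul,
        hB.eq (v i) y, hB.eq (v j) y, div_eq_mul_inv]
    have hperp : ∀ y ∈ N, B y (v i) * α / a + B y (v j) * β / b = 0 := by
      intro y hy
      have := hN y hy x hx
      rw [hxexp, map_add, map_smul, map_smul, smul_eq_mul, smul_eq_mul] at this
      linear_combination this
    have hsolve : ∀ y ∈ N, B y (v j) = B y (v i) * β / α := by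
      intro y hy
      have h1 := hperp y hy
      field_simp at h1 ⊢
      have h3 : β * a * (B y (v j) * α - B y (v i) * β) = 0 := by
        linear_combination α * h1 - B y (v i) * hrel
      rcases mul_eq_zero.1 h3 with h | h
      · exact absurd h (mul_ne_zero hcj hai)
      · linear_combination h
    have hBπ : ∀ y, ∀ k ∈ s', B (π y) (v k) = B y (v k) := by
      intro y k hk
      obtain ⟨h1, h2, h3⟩ := hs's k hk
      rw [hπ]
      simp [hv i his k h3 (Ne.symm h2), hv j hjs k h3 (Ne.symm h1)]
    have hker : Module.finrank K (LinearMap.ker (π.domRestrict N)) ≤ 1 := by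
      have hle : (LinearMap.ker (π.domRestrict N)).map N.subtype ≤ Submodule.span K {x} := by
        rintro _ ⟨⟨y, hy⟩, hy', rfl⟩
        have h1 : π y = 0 := hy'
        rw [hπ, hsolve y hy, sub_sub, sub_eq_zero] at h1
        refine Submodule.mem_span_singleton.2 ⟨B y (v i) / α, ?_⟩
        refine Eq.trans ?_ h1.symm
        rw [hxexp]
        match_scalars <;> field_simp
      calc Module.finrank K (LinearMap.ker (π.domRestrict N))
          = Module.finrank K ((LinearMap.ker (π.domRestrict N)).map N.subtype) :=
            (LinearEquiv.finrank_eq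
              (Submodule.equivMapOfInjective _ N.injective_subtype _))
        _ ≤ Module.finrank K (Submodule.span K {x}) := Submodule.finrank_mono hle
        _ ≤ 1 := (finrank_span_singleton hx0).le
    have hrk := LinearMap.finrank_range_add_finrank_ker (π.domRestrict N)
    set N' := LinearMap.range (π.domRestrict N) with hN'
    have hdim' : n - 2 ≤ 2 * Module.finrank K N' := by omega
    obtain ⟨x', hx', hx'0⟩ : ∃ x' ∈ N', x' ≠ 0 ∨ n - 2 = 0 := by
      by_cases h : n - 2 = 0
      · exact ⟨0, zero_mem _, Or.inr h⟩
      · have : 0 < Module.finrank K N' := by omega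
        have := Module.nontrivial_of_finrank_pos this
        obtain ⟨z, hz⟩ := exists_ne (0 : N')
        exact ⟨z, z.2, Or.inl fun h => hz (Subtype.ext h)⟩
    refine ihn (n - 2) (by omega) _ s' v N' x' hs'c rfl hx' hx'0
      (fun k hk l hl => hv k (hs's k hk).2.2 l (hs's l hl).2.2)
      (fun k hk => hv0 k (hs's k hk).2.2) ?_ ?_ hdim'
    · rintro _ ⟨⟨y, hy⟩, rfl⟩ _ ⟨⟨z, hz⟩, rfl⟩
      change B (π y) (π z) = 0
      rw [hπ, hπ]
      simp only [map_sub, map_smul, LinearMap.sub_apply, LinearMap.smul_apply, smul_eq_mul, ha, hb,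
        hBij, hBji, hN y hy z hz, hB.eq (v i) z, hB.eq (v j) z, hsolve y hy, hsolve z hz]
      field_simp
      linear_combination (-(B y (v i) * B z (v i))) * hrel
    · rintro _ ⟨⟨y, hy⟩, rfl⟩
      change π y = _
      have h1 : ∑ k ∈ s', (B (π y) (v k) / B (v k) (v k)) • v k =
          ∑ k ∈ s', (B y (v k) / B (v k) (v k)) • v k :=
        Finset.sum_congr rfl fun k hk => by rw [hBπ y k hk]
      refine Eq.trans ?_ h1.symm
      have h2 := hexp y hy
      rw [sum_eq_add_add_erase his hjs hij, ha, hb] at h2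
      rw [hπ, sub_sub, sub_eq_iff_eq_add']
      exact h2

end Lift

section Lift

open SymForm

variable {K : Type} [Field K] {G : Type 1} [AddCommGroup G] {r : K → G}

/-- An orthogonal basis. -/
def SymForm.IsOrtho (B : SymForm K) {ι : Type} (v : Module.Basis ι K B.V) : Prop :=
  ∀ i j, i ≠ j → B.form (v i) (v j) = 0

theorem SymForm.IsOrtho.ne_zero {B : SymForm K} {ι : Type} {v : Module.Basis ι K B.V}
    (hv : B.IsOrtho v) (i : ι) : B.form (v i) (v i) ≠ 0 := fun h => by
  refine v.ne_zero i (B.nondeg.1 _ fun y => ?_)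
  have : B.form (v i) = 0 := v.ext fun j => by
    by_cases hij : i = j
    · subst hij; exact h
    · exact hv i j hij
  rw [this]; rfl

theorem SymForm.exists_isOrtho (h2 : (2 : K) ≠ 0) (B : SymForm K) :
    ∃ v : Module.Basis (Fin (Module.finrank K B.V)) K B.V, B.IsOrtho v := by
  have : Invertible (2 : K) := invertibleOfNonzero h2
  obtain ⟨v, hv⟩ := LinearMap.BilinForm.exists_orthogonal_basis
    (B := B.form) ⟨fun x y => B.symm.eq x y⟩
  exact ⟨v, fun i j hij => hv hij⟩

theorem WittRelations.metabolic (hr : WittRelations r) (h2 : (2 : K) ≠ 0) {B : SymForm K}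
    (hB : B.Metabolic) {ι : Type} [Fintype ι] (v : Module.Basis ι K B.V) (hv : B.IsOrtho v) :
    ∑ k, r (B.form (v k) (v k)) = 0 := by
  classical
  obtain ⟨k, N, h1, h3, hN⟩ := hB
  have hcard : (Finset.univ : Finset ι).card = B.rank := (Module.finrank_eq_card_basis v).symm
  obtain ⟨x, hx, hx0⟩ : ∃ x ∈ N, x ≠ 0 ∨ B.rank = 0 := by
    by_cases h : B.rank = 0
    · exact ⟨0, zero_mem _, Or.inr h⟩
    · have : 0 < Module.finrank K N := by omega
      have := Module.nontrivial_of_finrank_pos this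
      obtain ⟨z, hz⟩ := exists_ne (0 : N)
      exact ⟨z, z.2, Or.inl fun h => hz (Subtype.ext h)⟩
  refine hr.sum_eq_zero h2 B.form B.symm B.rank _ Finset.univ v N x hcard rfl hx hx0
    (fun i _ j _ => hv i j) (fun i _ => hv.ne_zero i) hN (fun y _ => ?_) (by omega)
  conv_lhs => rw [← v.sum_repr y]
  refine Finset.sum_congr rfl fun k _ => ?_
  congr 1
  rw [eq_div_iff (hv.ne_zero k)]
  conv_rhs => rw [← v.sum_repr y]
  rw [map_sum, LinearMap.sum_apply, Finset.sum_eq_single k]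
  · simp
  · intro j _ hj; simp [hv j k hj]
  · simp

/-- The sum of `r` over the entries of a diagonalization. -/
def SymForm.diagSum (r : K → G) (h2 : (2 : K) ≠ 0) (B : SymForm K) : G :=
  ∑ k, r (B.form ((B.exists_isOrtho h2).choose k) ((B.exists_isOrtho h2).choose k))

/-- The basis of an orthogonal sum formed by bases of the summands. -/
def SymForm.sumBasis {A B : SymForm K} {ι κ : Type} (v : Module.Basis ι K A.V)
    (w : Module.Basis κ K B.V) : Module.Basis (ι ⊕ κ) K (A.sum B).V :=
  (v.prod w : Module.Basis (ι ⊕ κ) K (A.V × B.V))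

theorem sum_form_sumBasis {A B : SymForm K} {ι κ : Type} (v : Module.Basis ι K A.V)
    (w : Module.Basis κ K B.V) (i j : ι ⊕ κ) :
    (A.sum B).form (sumBasis v w i) (sumBasis v w j) =
      A.form ((v.prod w) i).1 ((v.prod w) j).1 + B.form ((v.prod w) i).2 ((v.prod w) j).2 := rfl

theorem sum_isOrtho_sum {A B : SymForm K} {ι κ : Type} {v : Module.Basis ι K A.V}
    {w : Module.Basis κ K B.V} (hv : A.IsOrtho v) (hw : B.IsOrtho w) :
    (A.sum B).IsOrtho (sumBasis v w) := by
  rintro (i | i) (j | j) hij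
  · simpa [sum_form_sumBasis] using hv i j (fun h => hij (h ▸ rfl))
  · simp [sum_form_sumBasis]
  · simp [sum_form_sumBasis]
  · simpa [sum_form_sumBasis] using hw i j (fun h => hij (h ▸ rfl))

theorem sum_diag_sum {A B : SymForm K} {ι κ : Type} [Fintype ι] [Fintype κ]
    (v : Module.Basis ι K A.V) (w : Module.Basis κ K B.V) (r : K → G) :
    ∑ k, r ((A.sum B).form (sumBasis v w k) (sumBasis v w k)) =
    ∑ k, r (A.form (v k) (v k)) + ∑ k, r (B.form (w k) (w k)) := by
  rw [Fintype.sum_sum_type]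
  simp [sum_form_sumBasis]

theorem WittRelations.diagSum_eq (hr : WittRelations r) (h2 : (2 : K) ≠ 0) (B : SymForm K)
    {ι : Type} [Fintype ι] (v : Module.Basis ι K B.V) (hv : B.IsOrtho v) :
    ∑ k, r (B.form (v k) (v k)) = B.diagSum r h2 := by
  obtain ⟨w, hw⟩ : ∃ w, w = (B.exists_isOrtho h2).choose := ⟨_, rfl⟩
  have hw' : B.IsOrtho w := hw ▸ (B.exists_isOrtho h2).choose_spec
  have hwn : B.neg.IsOrtho (w : Module.Basis _ K B.neg.V) := fun i j hij =>
    (congrArg Neg.neg (hw' i j hij)).trans neg_zero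
  have h := hr.metabolic h2 (metabolic_sum_neg B) _ (sum_isOrtho_sum hv hwn)
  rw [sum_diag_sum (A := B) (B := B.neg) v w r] at h
  have h3 : ∑ k, r (B.form (w k) (w k)) + ∑ k, r (B.neg.form (w k) (w k)) = 0 := by
    rw [← Finset.sum_add_distrib]
    exact Finset.sum_eq_zero fun k _ => hr.neg _ (hw'.ne_zero k)
  rw [SymForm.diagSum, ← hw]
  exact add_right_cancel (h.trans h3.symm)

theorem WittRelations.diagSum_sum (hr : WittRelations r) (h2 : (2 : K) ≠ 0) (A B : SymForm K) :
    (A.sum B).diagSum r h2 = A.diagSum r h2 + B.diagSum r h2 := by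
  rw [← hr.diagSum_eq h2 (A.sum B) _ (sum_isOrtho_sum (A.exists_isOrtho h2).choose_spec
    (B.exists_isOrtho h2).choose_spec), sum_diag_sum]
  rfl

theorem WittRelations.diagSum_iso (hr : WittRelations r) (h2 : (2 : K) ≠ 0) {A B : SymForm K}
    (h : Iso A B) : A.diagSum r h2 = B.diagSum r h2 := by
  obtain ⟨e, he⟩ := h.exists
  rw [← hr.diagSum_eq h2 B ((A.exists_isOrtho h2).choose.map e) fun i j hij => by
    simpa [he] using (A.exists_isOrtho h2).choose_spec i j hij]
  exact Finset.sum_congr rfl fun k _ => by simp [he]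

theorem WittRelations.diagSum_metabolic (hr : WittRelations r) (h2 : (2 : K) ≠ 0)
    {A : SymForm K} (h : A.Metabolic) : A.diagSum r h2 = 0 :=
  hr.metabolic h2 h _ (A.exists_isOrtho h2).choose_spec

/-- A map obeying the Witt relations extends additively to the Witt group. -/
def WittRelations.lift (hr : WittRelations r) (h2 : (2 : K) ≠ 0) : WittGroup K →+ G :=
  AddMonoidHom.mk'
    (Quotient.lift (fun B => B.diagSum r h2) fun A B ⟨M₁, M₂, m1, m2, e⟩ => by
      have h := hr.diagSum_iso h2 e
      rwa [hr.diagSum_sum, hr.diagSum_sum, hr.diagSum_metabolic h2 m1,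
        hr.diagSum_metabolic h2 m2, add_zero, add_zero] at h)
    (WittGroup.ind fun A => WittGroup.ind fun B => hr.diagSum_sum h2 A B)

theorem WittRelations.lift_unary (hr : WittRelations r) (h2 : (2 : K) ≠ 0) (a : Kˣ) :
    hr.lift h2 (WittGroup.unary a) = r a := by
  change (SymForm.unary a).diagSum r h2 = r a
  rw [← hr.diagSum_eq h2 (SymForm.unary a)
    (Module.Basis.singleton Unit K : Module.Basis Unit K K) fun i j hij => (hij rfl).elim]
  rw [Fintype.sum_unique]
  change r ((a : K) * (Module.Basis.singleton Unit K default *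
    Module.Basis.singleton Unit K default)) = r a
  simp

end Lift

section Generation

open SymForm

variable {K : Type} [Field K]

/-- A vector with `B(x, x) ≠ 0` splits off. -/
theorem SymForm.exists_split (h2 : (2 : K) ≠ 0) (B : SymForm K) (hB : 0 < B.rank) :
    ∃ (a : Kˣ) (B' : SymForm K), Iso B ((SymForm.unary a).sum B') ∧ B'.rank < B.rank := by
  have : Invertible (2 : K) := invertibleOfNonzero h2
  have hnt : Nontrivial B.V := Module.nontrivial_of_finrank_pos hB
  obtain ⟨x, hx⟩ := LinearMap.BilinForm.exists_bilinForm_self_ne_zero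
    (LinearMap.BilinForm.Nondegenerate.ne_zero B.nondeg) ⟨fun x y => B.symm.eq x y⟩
  have hx0 : x ≠ 0 := fun h => hx (by simp [h])
  have hc := LinearMap.BilinForm.isCompl_span_singleton_orthogonal hx
  let U := B.form.orthogonal (K ∙ x)
  have hU : ∀ u ∈ U, B.form x u = 0 := fun u hu => hu x (Submodule.mem_span_singleton_self x)
  have hU' : ∀ u ∈ U, B.form u x = 0 := fun u hu => by rw [B.symm.eq]; exact hU u hu
  let e : (K × U) ≃ₗ[K] B.V :=
    ((LinearEquiv.toSpanNonzeroSingleton K B.V x hx0).prodCongr (LinearEquiv.refl K U)).trans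
      (Submodule.prodEquivOfIsCompl _ _ hc)
  have he : ∀ z, e z = z.1 • x + (z.2 : B.V) := fun z => rfl
  have hs : (B.form.restrict U).IsSymm := ⟨fun u w => B.symm.eq _ _⟩
  let B' : SymForm K :=
    { V := U
      form := B.form.restrict U
      symm := hs
      nondeg := nondeg_of_symm hs fun u hu => by
        refine Subtype.ext (B.nondeg.1 _ fun y => ?_)
        obtain ⟨z, rfl⟩ := e.surjective y
        rw [he, map_add, map_smul, hU' _ u.2, smul_zero, zero_add]
        exact hu z.2 }
  have key : ∀ z w : K × U,
      B.form (e z) (e w) = B.form x x * (z.1 * w.1) + B.form z.2 w.2 := by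
    intro z w
    rw [he, he]
    simp only [map_add, map_smul, LinearMap.add_apply, LinearMap.smul_apply, hU _ w.2.2,
      hU' _ z.2.2, smul_eq_mul, mul_zero, add_zero, zero_add]
    ring
  refine ⟨Units.mk0 _ hx, B', Iso.symm (Iso.of (B₁ := (SymForm.unary _).sum B') (B₂ := B) e ?_), ?_⟩
  · exact key
  · have h1 := e.finrank_eq
    rw [Module.finrank_prod, Module.finrank_self] at h1
    change Module.finrank K U < Module.finrank K B.V
    omega

/-- The Witt group is generated by the classes of rank one forms. -/
theorem WittGroup.unary_induction (h2 : (2 : K) ≠ 0) {p : WittGroup K → Prop} (h0 : p 0)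
    (hadd : ∀ a x, p x → p (WittGroup.unary a + x)) (x : WittGroup K) : p x := by
  induction x using WittGroup.ind with | _ B
  induction hn : B.rank using Nat.strong_induction_on generalizing B with
  | _ n ih =>
  rcases Nat.eq_zero_or_pos B.rank with h | h
  · have : (WittGroup.mk B) = 0 := WittGroup.mk_metabolic
      ⟨0, ⊥, h, finrank_bot _ _, by simp⟩
    rwa [this]
  · obtain ⟨a, B', e, hlt⟩ := B.exists_split h2 h
    rw [WittGroup.mk_eq e.wittEquiv]
    exact hadd a _ (ih _ (hn ▸ hlt) B' rfl)

theorem WittGroup.hom_ext (h2 : (2 : K) ≠ 0) {G : Type 1} [AddCommGroup G]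
    {f g : WittGroup K →+ G} (h : ∀ a, f (WittGroup.unary a) = g (WittGroup.unary a)) : f = g := by
  ext x
  refine WittGroup.unary_induction h2 (p := fun x => f x = g x) (by simp) (fun a x hx => ?_) x
  rw [map_add, map_add, h a, hx]

end Generation

section UnaryRelations

open SymForm

variable {F : Type} [Field F]

open scoped Classical in
/-- The class `[a]`, extended by `[0] = 0`. -/
def WittGroup.unary₀ (a : F) : WittGroup F :=
  if h : a = 0 then 0 else WittGroup.unary (Units.mk0 a h)

theorem WittGroup.unary₀_of_ne {a : F} (h : a ≠ 0) :
    WittGroup.unary₀ a = WittGroup.unary (Units.mk0 a h) := dif_neg h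

theorem WittGroup.unary₀_units (a : Fˣ) : WittGroup.unary₀ (a : F) = WittGroup.unary a := by
  rw [WittGroup.unary₀_of_ne a.ne_zero, Units.mk0_val]

theorem SymForm.unary_form (a : Fˣ) (x y : F) :
    (SymForm.unary a).form x y = (a : F) * (x * y) := rfl

theorem WittGroup.unary₀_relations : WittRelations (WittGroup.unary₀ : F → WittGroup F) where
  sq a c ha hc := by
    have hac : a * c ^ 2 ≠ 0 := mul_ne_zero ha (pow_ne_zero _ hc)
    rw [unary₀_of_ne ha, unary₀_of_ne hac]
    refine WittGroup.mk_eq (Iso.of (B₁ := SymForm.unary (Units.mk0 _ hac))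
      (B₂ := SymForm.unary (Units.mk0 _ ha))
      (LinearEquiv.smulOfNeZero F F c hc) fun (x : F) (y : F) => ?_).wittEquiv
    change a * (c * x * (c * y)) = a * c ^ 2 * (x * y)
    ring
  neg a ha := by
    rw [unary₀_of_ne ha, unary₀_of_ne (neg_ne_zero.2 ha)]
    have : WittGroup.unary (Units.mk0 (-a) (neg_ne_zero.2 ha)) =
        -WittGroup.unary (Units.mk0 a ha) := by
      refine WittGroup.mk_eq (Iso.of (B₁ := SymForm.unary (Units.mk0 (-a) (neg_ne_zero.2 ha)))
        (B₂ := (SymForm.unary (Units.mk0 a ha)).neg) (LinearEquiv.refl F F)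
        fun (x : F) (y : F) => ?_).wittEquiv
      change -(a * (x * y)) = -a * (x * y)
      ring
    rw [this, add_neg_cancel]
  add a b ha hb hab := by
    have hc : a * b * (a + b) ≠ 0 := mul_ne_zero (mul_ne_zero ha hb) hab
    rw [unary₀_of_ne ha, unary₀_of_ne hb, unary₀_of_ne hab, unary₀_of_ne hc]
    let e : (F × F) ≃ₗ[F] (F × F) :=
      LinearEquiv.ofLinearMap
        ((LinearMap.fst F F F - b • LinearMap.snd F F F).prod
          (LinearMap.fst F F F + a • LinearMap.snd F F F))
        (((a + b)⁻¹ • (a • LinearMap.fst F F F + b • LinearMap.snd F F F)).prod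
          ((a + b)⁻¹ • (LinearMap.snd F F F - LinearMap.fst F F F)))
        (by ext <;> simp <;> field_simp <;> ring) (by ext <;> simp <;> field_simp; ring)
    refine WittGroup.mk_eq (Iso.symm (Iso.of
      (B₁ := (SymForm.unary (Units.mk0 _ hab)).sum (SymForm.unary (Units.mk0 _ hc)))
      (B₂ := (SymForm.unary (Units.mk0 _ ha)).sum (SymForm.unary (Units.mk0 _ hb)))
      e fun (x : F × F) (y : F × F) => ?_)).wittEquiv
    change a * ((x.1 - b * x.2) * (y.1 - b * y.2)) + b * ((x.1 + a * x.2) * (y.1 + a * y.2)) =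
      (a + b) * (x.1 * y.1) + a * b * (a + b) * (x.2 * y.2)
    ring

end UnaryRelations

section Residue

variable {p : ℕ} [hp : Fact p.Prime]

open scoped Classical in
/-- Reduction of a `p`-adic integer modulo `p`, extended by `0` to all of `ℚ_p`. -/
def padicRed (x : ℚ_[p]) : ZMod p := if h : ‖x‖ ≤ 1 then PadicInt.toZMod ⟨x, h⟩ else 0

theorem padicRed_coe (u : ℤ_[p]) : padicRed (u : ℚ_[p]) = PadicInt.toZMod u := dif_pos u.2

theorem exists_padicInt {x : ℚ_[p]} (hx : ‖x‖ ≤ 1) : ∃ u : ℤ_[p], (u : ℚ_[p]) = x :=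
  ⟨⟨x, hx⟩, rfl⟩

theorem padicRed_add {x y : ℚ_[p]} (hx : ‖x‖ ≤ 1) (hy : ‖y‖ ≤ 1) :
    padicRed (x + y) = padicRed x + padicRed y := by
  obtain ⟨u, rfl⟩ := exists_padicInt hx
  obtain ⟨w, rfl⟩ := exists_padicInt hy
  rw [← PadicInt.coe_add, padicRed_coe, padicRed_coe, padicRed_coe, map_add]

theorem padicRed_mul {x y : ℚ_[p]} (hx : ‖x‖ ≤ 1) (hy : ‖y‖ ≤ 1) :
    padicRed (x * y) = padicRed x * padicRed y := by
  obtain ⟨u, rfl⟩ := exists_padicInt hx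
  obtain ⟨w, rfl⟩ := exists_padicInt hy
  rw [← PadicInt.coe_mul, padicRed_coe, padicRed_coe, padicRed_coe, map_mul]

theorem padicRed_eq_zero {x : ℚ_[p]} (hx : ‖x‖ ≤ 1) : padicRed x = 0 ↔ ‖x‖ < 1 := by
  obtain ⟨u, rfl⟩ := exists_padicInt hx
  rw [padicRed_coe, ← RingHom.mem_ker, PadicInt.ker_toZMod, IsLocalRing.mem_maximalIdeal,
    PadicInt.mem_nonunits]
  rfl

/-- The residue of the unit part `a p^{-v(a)}` of `a`. -/
def padicAc (a : ℚ_[p]) : ZMod p := padicRed (a * (p : ℚ_[p]) ^ (-a.valuation))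

theorem p_ne_zero' : (p : ℚ_[p]) ≠ 0 := by exact_mod_cast hp.1.ne_zero

theorem norm_unitPart {a : ℚ_[p]} (ha : a ≠ 0) : ‖a * (p : ℚ_[p]) ^ (-a.valuation)‖ = 1 := by
  have : (p : ℝ) ≠ 0 := by exact_mod_cast hp.1.ne_zero
  rw [norm_mul, Padic.norm_eq_zpow_neg_valuation ha, norm_zpow, Padic.norm_p, inv_zpow,
    ← zpow_neg, neg_neg, ← zpow_add₀ this]
  simp

theorem padicAc_ne_zero {a : ℚ_[p]} (ha : a ≠ 0) : padicAc a ≠ 0 := by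
  rw [padicAc, Ne, padicRed_eq_zero (norm_unitPart ha).le, norm_unitPart ha]
  exact lt_irrefl _

theorem padicAc_mul {a b : ℚ_[p]} (ha : a ≠ 0) (hb : b ≠ 0) :
    padicAc (a * b) = padicAc a * padicAc b := by
  rw [padicAc, padicAc, padicAc, ← padicRed_mul (norm_unitPart ha).le (norm_unitPart hb).le,
    Padic.valuation_mul ha hb, neg_add, zpow_add₀ p_ne_zero']
  congr 1; ring

theorem valuation_neg' (a : ℚ_[p]) : (-a).valuation = a.valuation := by
  rcases eq_or_ne a 0 with rfl | ha
  · simp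
  have h1 : (-1 : ℚ_[p]).valuation = 0 := by
    have := Padic.valuation_intCast (p := p) (-1)
    simpa [padicValInt] using this
  rw [neg_eq_neg_one_mul, Padic.valuation_mul (by simp) ha, h1, zero_add]

theorem padicAc_neg {a : ℚ_[p]} (ha : a ≠ 0) : padicAc (-a) = -padicAc a := by
  have h := padicRed_add (norm_unitPart ha).le (norm_unitPart (neg_ne_zero.2 ha)).le
  rw [valuation_neg', neg_mul, add_neg_cancel, (padicRed_eq_zero (by simp)).2 (by simp)] at h
  rw [padicAc, padicAc, valuation_neg', neg_mul]
  exact (neg_eq_of_add_eq_zero_right h.symm).symm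

theorem norm_mul_zpow_lt {a : ℚ_[p]} (ha : a ≠ 0) {m : ℤ} (h : m < a.valuation) :
    ‖a * (p : ℚ_[p]) ^ (-m)‖ < 1 := by
  have h1 : (1 : ℝ) < p := by exact_mod_cast hp.1.one_lt
  rw [norm_mul, Padic.norm_eq_zpow_neg_valuation ha, norm_zpow, Padic.norm_p, inv_zpow,
    ← zpow_neg, neg_neg, ← zpow_add₀ (by positivity)]
  exact zpow_lt_one_of_neg₀ h1 (by omega)

theorem valuation_eq_of_norm {a : ℚ_[p]} {m : ℤ} (h : ‖a * (p : ℚ_[p]) ^ (-m)‖ = 1) :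
    a.valuation = m := by
  have ha : a ≠ 0 := by rintro rfl; simp at h
  have h1 : (1 : ℝ) < p := by exact_mod_cast hp.1.one_lt
  rw [norm_mul, Padic.norm_eq_zpow_neg_valuation ha, norm_zpow, Padic.norm_p, inv_zpow,
    ← zpow_neg, neg_neg, ← zpow_add₀ (by positivity)] at h
  have := (zpow_eq_one_iff_right₀ (by positivity) h1.ne').1 h
  omega

/-- If the leading terms do not cancel, they add. -/
theorem padicAc_add {a b : ℚ_[p]} (ha : a ≠ 0) (hb : ‖b * (p : ℚ_[p]) ^ (-a.valuation)‖ ≤ 1)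
    (h : padicAc a + padicRed (b * (p : ℚ_[p]) ^ (-a.valuation)) ≠ 0) :
    (a + b).valuation = a.valuation ∧
      padicAc (a + b) = padicAc a + padicRed (b * (p : ℚ_[p]) ^ (-a.valuation)) := by
  have h1 := padicRed_add (norm_unitPart ha).le hb
  rw [← add_mul] at h1
  have hle : ‖(a + b) * (p : ℚ_[p]) ^ (-a.valuation)‖ ≤ 1 := by
    rw [add_mul]
    exact (Padic.nonarchimedean _ _).trans (max_le (norm_unitPart ha).le hb)
  have h2 : ‖(a + b) * (p : ℚ_[p]) ^ (-a.valuation)‖ = 1 := by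
    refine le_antisymm hle (not_lt.1 fun hlt => h ?_)
    rw [← (padicRed_eq_zero hle).2 hlt, h1]; rfl
  have h3 := valuation_eq_of_norm h2
  refine ⟨h3, ?_⟩
  rw [padicAc, h3, h1]; rfl

open scoped Classical in
/-- The map `a ↦ ∂²_p [a]` on `ℚ_p^*`. -/
def residueFun (a : ℚ_[p]) : WittGroup (ZMod p) :=
  if Odd a.valuation then WittGroup.unary₀ (padicAc a) else 0

theorem residueFun_mul {a b c : ℚ_[p]} (ha : a ≠ 0) (hb : b ≠ 0) (hc : c ≠ 0)
    (h : Even (a.valuation + b.valuation)) :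
    residueFun (a * b * c) = if Odd c.valuation then
      WittGroup.unary₀ (padicAc a * padicAc b * padicAc c) else 0 := by
  rw [residueFun, Padic.valuation_mul (mul_ne_zero ha hb) hc, Padic.valuation_mul ha hb,
    padicAc_mul (mul_ne_zero ha hb) hc, padicAc_mul ha hb]
  congr 1
  rw [Int.odd_add, ← Int.not_even_iff_odd]
  simp [h]

theorem residueFun_relations : WittRelations (residueFun (p := p)) where
  sq a c ha hc := by
    have h1 := WittGroup.unary₀_relations.sq _ _ (padicAc_ne_zero ha) (padicAc_ne_zero hc)
    rw [show a * c ^ 2 = c * c * a by ring, residueFun_mul hc hc ha ⟨_, rfl⟩, residueFun]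
    congr 1
    rw [← h1]; congr 1; ring
  neg a ha := by
    have h1 := WittGroup.unary₀_relations.neg _ (padicAc_ne_zero ha)
    rw [residueFun, residueFun, valuation_neg', padicAc_neg ha]
    split_ifs
    · exact h1
    · simp
  add a b ha hb hab := by
    have key : ∀ a b : ℚ_[p], a ≠ 0 → b ≠ 0 → a + b ≠ 0 → a.valuation ≤ b.valuation →
        residueFun a + residueFun b = residueFun (a + b) + residueFun (a * b * (a + b)) := by
      intro a b ha hb hab hle
      rcases hle.lt_or_eq with hlt | heq
      · have hn := norm_mul_zpow_lt hb hlt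
        have h0 := (padicRed_eq_zero hn.le).2 hn
        obtain ⟨h1, h2⟩ := padicAc_add ha hn.le (by rw [h0, add_zero]; exact padicAc_ne_zero ha)
        rw [h0, add_zero] at h2
        have h3 := residueFun_mul ha hab hb (by rw [h1]; exact ⟨_, rfl⟩)
        rw [show a * (a + b) * b = a * b * (a + b) by ring, h2] at h3
        have h4 := WittGroup.unary₀_relations.sq _ _ (padicAc_ne_zero hb) (padicAc_ne_zero ha)
        rw [show padicAc b * padicAc a ^ 2 = padicAc a * padicAc a * padicAc b by ring] at h4
        rw [h3, h4]
        congr 1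
        rw [residueFun, residueFun, h1, h2]
      · have hb' : padicRed (b * (p : ℚ_[p]) ^ (-a.valuation)) = padicAc b := by
          rw [padicAc, heq]
        have hbn : ‖b * (p : ℚ_[p]) ^ (-a.valuation)‖ ≤ 1 := by
          rw [heq]; exact (norm_unitPart hb).le
        rw [residueFun_mul ha hb hab (by rw [heq]; exact ⟨_, rfl⟩)]
        by_cases hs : padicAc a + padicAc b = 0
        · have hba : padicAc b = -padicAc a := (neg_eq_of_add_eq_zero_right hs).symm
          have hL : residueFun a + residueFun b = 0 := by
            rw [residueFun, residueFun, ← heq, hba]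
            have := WittGroup.unary₀_relations.neg _ (padicAc_ne_zero ha)
            split_ifs
            · exact this
            · simp
          have h5 := WittGroup.unary₀_relations.sq _ _ (neg_ne_zero.2 (padicAc_ne_zero hab))
            (padicAc_ne_zero ha)
          have h6 := WittGroup.unary₀_relations.neg _ (padicAc_ne_zero hab)
          rw [hL, residueFun, hba, show padicAc a * -padicAc a * padicAc (a + b) =
            -padicAc (a + b) * padicAc a ^ 2 by ring, h5]
          split_ifs
          · exact h6.symm
          · simp
        · obtain ⟨h1, h2⟩ := padicAc_add ha hbn (by rwa [hb'])
          rw [hb'] at h2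
          have h7 := WittGroup.unary₀_relations.add _ _ (padicAc_ne_zero ha) (padicAc_ne_zero hb) hs
          rw [residueFun, residueFun, residueFun, h1, ← heq, h2]
          split_ifs
          · exact h7
          · simp
    rcases le_total a.valuation b.valuation with h | h
    · exact key a b ha hb hab h
    · have := key b a hb ha (by rwa [add_comm]) h
      rw [add_comm b a, mul_comm b a, add_comm (residueFun b)] at this
      exact this

theorem residueFun_unit (u : ℤ_[p]ˣ) : residueFun ((u : ℤ_[p]) : ℚ_[p]) = 0 := by
  have : ((u : ℤ_[p]) : ℚ_[p]).valuation = 0 := by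
    refine valuation_eq_of_norm ?_
    simp
  rw [residueFun, this, if_neg (by simp)]

theorem residueFun_p_mul_unit (u : ℤ_[p]ˣ) : residueFun ((p : ℚ_[p]) * ((u : ℤ_[p]) : ℚ_[p])) =
    WittGroup.unary (Units.map PadicInt.toZMod.toMonoidHom u) := by
  have hu : ‖((u : ℤ_[p]) : ℚ_[p])‖ = 1 := PadicInt.norm_units u
  have h1 : (p : ℚ_[p]) * ((u : ℤ_[p]) : ℚ_[p]) * (p : ℚ_[p]) ^ (-1 : ℤ) =
      ((u : ℤ_[p]) : ℚ_[p]) := by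
    rw [zpow_neg_one]; field_simp [p_ne_zero' (p := p)]
  have hv : ((p : ℚ_[p]) * ((u : ℤ_[p]) : ℚ_[p])).valuation = 1 := by
    refine valuation_eq_of_norm ?_
    rw [h1, hu]
  rw [residueFun, if_pos (by rw [hv]; exact odd_one), padicAc, hv, h1, padicRed_coe,
    ← WittGroup.unary₀_units]
  rfl

/-- A unit of `ℤ_p` as an element of `ℚ_p^*`. -/
def padicUnit (u : ℤ_[p]ˣ) : ℚ_[p]ˣ := Units.map (PadicInt.Coe.ringHom (p := p)).toMonoidHom u

/-- The uniformizer `p` as an element of `ℚ_p^*`. -/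
def padicUniformizer (p : ℕ) [Fact p.Prime] : ℚ_[p]ˣ := Units.mk0 (p : ℚ_[p]) p_ne_zero'

/-- Up to squares, every element of `ℚ_p^*` is `u` or `p u` with `u` a unit. -/
theorem exists_unary_eq (a : ℚ_[p]ˣ) : ∃ u : ℤ_[p]ˣ,
    WittGroup.unary a = WittGroup.unary (padicUnit u) ∨
    WittGroup.unary a = WittGroup.unary (padicUniformizer p * padicUnit u) := by
  have hu := norm_unitPart a.ne_zero
  refine ⟨PadicInt.mkUnits hu, ?_⟩
  have hpu : ((padicUnit (PadicInt.mkUnits hu) : ℚ_[p]ˣ) : ℚ_[p]) =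
    (a : ℚ_[p]) * (p : ℚ_[p]) ^ (-(a : ℚ_[p]).valuation) := rfl
  rw [← WittGroup.unary₀_units, ← WittGroup.unary₀_units, ← WittGroup.unary₀_units]
  have hsq := fun (b : ℚ_[p]ˣ) (k : ℤ) => WittGroup.unary₀_relations.sq (b : ℚ_[p])
    ((p : ℚ_[p]) ^ k) b.ne_zero (zpow_ne_zero _ p_ne_zero')
  rcases Int.even_or_odd' (a : ℚ_[p]).valuation with ⟨k, hk | hk⟩
  · left
    rw [← hsq (padicUnit _) k, hpu, hk, mul_assoc, ← zpow_natCast, ← zpow_mul, ← zpow_add₀ p_ne_zero']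
    simp [mul_comm]
  · right
    rw [← hsq (_ * padicUnit _) k, Units.val_mul, hpu, hk]
    congr 1
    change (a : ℚ_[p]) = (p : ℚ_[p]) * _ * _
    rw [← zpow_natCast, ← zpow_mul, mul_comm (p : ℚ_[p]), mul_assoc, mul_assoc, ← zpow_one_add₀
      p_ne_zero', ← zpow_add₀ p_ne_zero']
    have : -(2 * k + 1) + (1 + k * ((2 : ℕ) : ℤ)) = 0 := by push_cast; ring
    rw [this, zpow_zero, mul_one]

/-- Existence and uniqueness of the second residue homomorphism: the additive map
`∂²_p : W(ℚ_p) → W(𝔽_p)` with `[u] ↦ 0` and `[p u] ↦ [ū]` for every unit `u` of `ℤ_p`. -/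
theorem existsUnique_secondResidue (p : ℕ) [Fact p.Prime] :
    ∃! f : WittGroup ℚ_[p] →+ WittGroup (ZMod p), ∀ u : ℤ_[p]ˣ,
      f (WittGroup.unary (padicUnit u)) = 0 ∧
      f (WittGroup.unary (padicUniformizer p * padicUnit u)) =
        WittGroup.unary (Units.map PadicInt.toZMod.toMonoidHom u) := by
  have h2 : (2 : ℚ_[p]) ≠ 0 := two_ne_zero
  refine ⟨residueFun_relations.lift h2, fun u => ⟨?_, ?_⟩, fun g hg => ?_⟩
  · rw [WittRelations.lift_unary]; exact residueFun_unit u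
  · rw [WittRelations.lift_unary]; exact residueFun_p_mul_unit u
  · refine WittGroup.hom_ext h2 fun a => ?_
    have hf := fun u : ℤ_[p]ˣ => show
        residueFun_relations.lift h2 (WittGroup.unary (padicUnit u)) = 0 ∧
        residueFun_relations.lift h2 (WittGroup.unary (padicUniformizer p * padicUnit u)) =
          WittGroup.unary (Units.map PadicInt.toZMod.toMonoidHom u) from
      ⟨by rw [WittRelations.lift_unary]; exact residueFun_unit u,
        by rw [WittRelations.lift_unary]; exact residueFun_p_mul_unit u⟩
    obtain ⟨u, h | h⟩ := exists_unary_eq a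
    · rw [h, (hg u).1, (hf u).1]
    · rw [h, (hg u).2, (hf u).2]

/-- The second residue homomorphism `∂²_p : W(ℚ_p) → W(𝔽_p)`, the unique additive map with
`[u] ↦ 0` and `[p u] ↦ [ū]` for every unit `u` of `ℤ_p`. -/
def secondResidue (p : ℕ) [Fact p.Prime] : WittGroup ℚ_[p] →+ WittGroup (ZMod p) :=
  (existsUnique_secondResidue p).exists.choose

theorem secondResidue_spec (p : ℕ) [Fact p.Prime] (u : ℤ_[p]ˣ) :
    secondResidue p (WittGroup.unary (padicUnit u)) = 0 ∧
    secondResidue p (WittGroup.unary (padicUniformizer p * padicUnit u)) =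
      WittGroup.unary (Units.map PadicInt.toZMod.toMonoidHom u) :=
  (existsUnique_secondResidue p).exists.choose_spec u

end Residue

section BaseChange

open SymForm

variable {F : Type} [Field F] (K : Type) [Field K] [Algebra F K]

theorem baseChange_nondeg (B : SymForm F) : (B.form.baseChange K).Nondegenerate := by
  let b := Module.finBasis F B.V
  have h := (LinearMap.BilinForm.nondegenerate_iff_det_ne_zero b).1 B.nondeg
  refine (LinearMap.BilinForm.nondegenerate_iff_det_ne_zero (b.baseChange K)).2 ?_
  have : LinearMap.BilinForm.toMatrix (b.baseChange K) (B.form.baseChange K) =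
      (LinearMap.BilinForm.toMatrix b B.form).map (algebraMap F K) := by
    ext i j
    simp [LinearMap.BilinForm.toMatrix_apply, Algebra.smul_def]
  rw [this, ← RingHom.mapMatrix_apply, ← RingHom.map_det]
  exact (map_ne_zero _).2 h

/-- The form over `K` obtained from a form over `F` by extension of scalars. -/
def SymForm.baseChange (B : SymForm F) : SymForm K where
  V := K ⊗[F] B.V
  form := B.form.baseChange K
  symm := ⟨fun x y => (LinearMap.BilinForm.IsSymm.baseChange K ⟨B.symm.eq⟩).eq x y⟩
  nondeg := baseChange_nondeg K B

theorem bilin_ext_tmul {V : Type} [AddCommGroup V] [Module F V]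
    {B₁ B₂ : LinearMap.BilinForm K (K ⊗[F] V)}
    (h : ∀ x y : V, B₁ (1 ⊗ₜ x) (1 ⊗ₜ y) = B₂ (1 ⊗ₜ x) (1 ⊗ₜ y)) (z w : K ⊗[F] V) :
    B₁ z w = B₂ z w := by
  have : B₁ = B₂ := by
    ext x y
    simpa using h x y
  rw [this]

theorem SymForm.Iso.baseChange {A B : SymForm F} (h : Iso A B) :
    Iso (A.baseChange K) (B.baseChange K) := by
  obtain ⟨e, he⟩ := h.exists
  let e' : (K ⊗[F] A.V) ≃ₗ[K] (K ⊗[F] B.V) := e.baseChange F K A.V B.V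
  refine Iso.of (B₁ := A.baseChange K) (B₂ := B.baseChange K) e' ?_
  refine bilin_ext_tmul K (B₁ := (B.form.baseChange K).comp e'.toLinearMap e'.toLinearMap)
    (B₂ := A.form.baseChange K) fun x y => ?_
  change B.form.baseChange K (1 ⊗ₜ e x) (1 ⊗ₜ e y) = _
  simp [he]

theorem SymForm.baseChange_sum (A B : SymForm F) :
    Iso ((A.sum B).baseChange K) ((A.baseChange K).sum (B.baseChange K)) := by
  let e' : (K ⊗[F] (A.V × B.V)) ≃ₗ[K] (K ⊗[F] A.V) × (K ⊗[F] B.V) :=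
    TensorProduct.prodRight F K K A.V B.V
  refine Iso.of (B₁ := (A.sum B).baseChange K) (B₂ := (A.baseChange K).sum (B.baseChange K)) e' ?_
  refine bilin_ext_tmul (V := A.V × B.V) K
    (B₁ := (sumForm (A.form.baseChange K) (B.form.baseChange K)).comp
      e'.toLinearMap e'.toLinearMap)
    (B₂ := (sumForm A.form B.form).baseChange K) fun x y => ?_
  simp [e', add_smul]

theorem SymForm.Metabolic.baseChange {A : SymForm F} (h : A.Metabolic) :
    (A.baseChange K).Metabolic := by
  obtain ⟨k, W, h1, h2, h3⟩ := h
  refine ⟨k, LinearMap.range (W.subtype.baseChange K), ?_, ?_, ?_⟩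
  · exact (Module.finrank_baseChange (R := K) (S := F) (M' := A.V)).trans h1
  · refine (LinearMap.finrank_range_of_inj (f := W.subtype.baseChange K) ?_).trans
      (Module.finrank_baseChange.trans h2)
    exact Module.Flat.lTensor_preserves_injective_linearMap (M := K) W.subtype W.injective_subtype
  · rintro _ ⟨x, rfl⟩ _ ⟨y, rfl⟩
    refine bilin_ext_tmul K (B₁ := (A.form.baseChange K).comp (W.subtype.baseChange K)
      (W.subtype.baseChange K)) (B₂ := 0) (fun x y => ?_) x y
    simp [h3 x.1 x.2 y.1 y.2]

/-- The map `W(F) → W(K)` induced by extension of scalars. -/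
def WittGroup.baseChange : WittGroup F →+ WittGroup K :=
  AddMonoidHom.mk'
    (Quotient.lift (fun B => WittGroup.mk (B.baseChange K)) fun A B ⟨M₁, M₂, m1, m2, e⟩ =>
      WittGroup.mk_eq ⟨M₁.baseChange K, M₂.baseChange K, m1.baseChange K, m2.baseChange K,
        (A.baseChange_sum K M₁).symm.trans ((e.baseChange K).trans (B.baseChange_sum K M₂))⟩)
    (WittGroup.ind fun A => WittGroup.ind fun B =>
      (WittGroup.mk_eq (A.baseChange_sum K B).wittEquiv))

theorem WittGroup.baseChange_unary (a : Fˣ) : WittGroup.baseChange K (WittGroup.unary a) =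
    WittGroup.unary (Units.map (algebraMap F K).toMonoidHom a) := by
  let e' : (K ⊗[F] F) ≃ₗ[K] K := TensorProduct.AlgebraTensorModule.rid F K K
  refine WittGroup.mk_eq (Iso.wittEquiv (Iso.of (B₁ := (SymForm.unary a).baseChange K)
    (B₂ := SymForm.unary (Units.map (algebraMap F K).toMonoidHom a)) e' ?_))
  refine bilin_ext_tmul (V := F) K
    (B₁ := LinearMap.BilinForm.comp (((algebraMap F K) a) • LinearMap.mul K K)
      e'.toLinearMap e'.toLinearMap)
    (B₂ := LinearMap.BilinForm.baseChange K ((a : F) • LinearMap.mul F F)) fun x y => ?_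
  simp [e', Algebra.smul_def]

end BaseChange

section Boundary

instance factPrimesPrime (p : Nat.Primes) : Fact (p : ℕ).Prime := ⟨p.2⟩

/-- `∂_p = ∂²_p ∘ ι_p : W(ℚ) → W(𝔽_p)`, with `ι_p : W(ℚ) → W(ℚ_p)` the extension of scalars. -/
def delPrime (p : ℕ) [Fact p.Prime] : WittGroup ℚ →+ WittGroup (ZMod p) :=
  (secondResidue p).comp (WittGroup.baseChange ℚ_[p])

theorem delPrime_unary_eq_zero {p : ℕ} [Fact p.Prime] (a : ℚˣ) (h : padicValRat p a = 0) :
    delPrime p (WittGroup.unary a) = 0 := by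
  have ha : ‖((a : ℚ) : ℚ_[p])‖ = 1 := by
    rw [Padic.norm_eq_zpow_neg_valuation (by simp), Padic.valuation_ratCast, h]; simp
  have : Units.map (algebraMap ℚ ℚ_[p]).toMonoidHom a = padicUnit (PadicInt.mkUnits ha) := by
    ext; exact eq_ratCast (algebraMap ℚ ℚ_[p]) _
  rw [delPrime, AddMonoidHom.comp_apply, WittGroup.baseChange_unary, this,
    (secondResidue_spec p _).1]

theorem finite_delPrime_ne_zero (x : WittGroup ℚ) :
    {p : Nat.Primes | delPrime p x ≠ 0}.Finite := by
  refine WittGroup.unary_induction two_ne_zero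
    (p := fun x => {p : Nat.Primes | delPrime p x ≠ 0}.Finite) (by simp) (fun a x hx => ?_) x
  have h1 : {p : Nat.Primes | padicValRat p a ≠ 0}.Finite := by
    have h2 : ((a : ℚ).num.natAbs * (a : ℚ).den) ≠ 0 :=
      mul_ne_zero (by simp) (a : ℚ).den_nz
    refine Set.Finite.subset (((Nat.divisors ((a : ℚ).num.natAbs * (a : ℚ).den)).finite_toSet).preimage
      (Subtype.val_injective.injOn : Set.InjOn (fun p : Nat.Primes => (p : ℕ)) _)) fun p hp => ?_
    simp only [Set.mem_preimage, Finset.mem_coe, Nat.mem_divisors]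
    refine ⟨?_, h2⟩
    by_contra hd
    refine hp ?_
    rw [padicValRat, padicValInt,
      padicValNat.eq_zero_of_not_dvd fun h => hd (h.mul_right _),
      padicValNat.eq_zero_of_not_dvd fun h => hd (h.mul_left _)]
    simp
  refine (h1.union hx).subset fun p hp => ?_
  by_contra hn
  rw [Set.mem_union, not_or] at hn
  exact hp (by rw [map_add, delPrime_unary_eq_zero a (not_not.1 hn.1), not_not.1 hn.2, add_zero])

theorem mk_delPrime_apply (x : WittGroup ℚ) (p : Nat.Primes) :
    DirectSum.mk (fun p : Nat.Primes => WittGroup (ZMod p))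
      (finite_delPrime_ne_zero x).toFinset (fun p => delPrime p.1 x) p = delPrime p x := by
  by_cases h : p ∈ (finite_delPrime_ne_zero x).toFinset
  · exact DirectSum.mk_apply_of_mem h
  · rw [DirectSum.mk_apply_of_notMem h]
    rw [Set.Finite.mem_toFinset] at h
    exact (not_not.1 h).symm

/-- `∂ = ⊕_p ∂_p : W(ℚ) → ⨁_p W(𝔽_p)`. -/
def del : WittGroup ℚ →+ ⨁ p : Nat.Primes, WittGroup (ZMod p) :=
  AddMonoidHom.mk'
    (fun x => DirectSum.mk (fun p : Nat.Primes => WittGroup (ZMod p))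
      (finite_delPrime_ne_zero x).toFinset fun p => delPrime p.1 x)
    (fun x y => by
      refine DFinsupp.ext fun p => ?_
      refine (mk_delPrime_apply (x + y) p).trans ?_
      rw [map_add, ← mk_delPrime_apply x p, ← mk_delPrime_apply y p]
      rfl)

theorem del_apply (x : WittGroup ℚ) (p : Nat.Primes) : del x p = delPrime p x :=
  mk_delPrime_apply x p

end Boundary

/-- The signature of a form over `ℚ`: the maximal dimension of a positive definite subspace minus
the maximal dimension of a negative definite one. -/
def SymForm.signature (B : SymForm ℚ) : ℤ :=
  (sigPos B.form.toQuadraticMap : ℤ) - (sigNeg B.form.toQuadraticMap : ℤ)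

/-- The Witt span of a class `x ∈ W(ℚ)`: the minimal rank of a form `B'` with `∂[B'] = ∂ x`. -/
def wittSpan (x : WittGroup ℚ) : ℕ :=
  sInf {n : ℕ | ∃ B' : SymForm ℚ, del (WittGroup.mk B') = del x ∧ B'.rank = n}

/-- `A` is a form `B_i` of rank `r`: it is anisotropic of rank `r` and signature `i`, and its Witt
class lies in `∂⁻¹(∂[B])`. -/
def IsPreimageForm (B : SymForm ℚ) (r : ℕ) (i : ℤ) (A : SymForm ℚ) : Prop :=
  A.rank = r ∧ A.Anisotropic ∧ del (WittGroup.mk A) = del (WittGroup.mk B) ∧ A.signature = i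

/-- The set `I_r` of signatures of the anisotropic forms of rank `r` whose Witt class lies in
`∂⁻¹(∂[B])`. -/
def signatureSet (B : SymForm ℚ) (r : ℕ) : Set ℤ := {i | ∃ A : SymForm ℚ, IsPreimageForm B r i A}

end

/-!
An isotropic form has the Witt class of a form of rank two less, so every form with the residues of
`B` and of rank at most `ws([B]) + 1` is anisotropic. The forms `⟨1⟩` and `⟨-1⟩` have no residues,
so they may be added to a form of rank `ws([B])` without making it isotropic. If `ws([B]) ≤ 1`, then
a form of minimal rank is definite and stays so when units of its own sign are added; this gives
anisotropic forms of ranks two and three which become isotropic on adding the opposite unit.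

For `ws([B]) ≤ 3`, and for `I₃ = {±1, ±3}` when `ws([B]) ≥ 2`, let `E` and `P` be the sets of primes
at which the residue is to have even and odd rank. For arbitrary signs, `⟨e₁D, e₂ℓD, e₃ℓD'⟩` with
`D = ∏ E` and `D' = ∏ P` has the given residues for a suitable prime `ℓ ≡ 1 mod 4`: by Dirichlet's
theorem the class of `ℓ` modulo each prime in `E ∪ P` can be prescribed, and by quadratic
reciprocity the remaining choice of `ℓ` modulo `8` makes the residue at `ℓ` vanish.

The sets `S ⊆ {0, ±2}` are realized by `B = q₀⟨1, ±N⟩` with `N = 2` or `7` and by `-B`. The other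
binary forms with these residues are of the form `n⟨1, ±N⟩`, and which signs of `n` and of `N` occur
depends on the quadratic characters of `±N` modulo `q₀` and of `-1` modulo `N`.
-/

noncomputable section

namespace SymForm

section Field

variable {F : Type} [Field F]

theorem rank_sum (A B : SymForm F) : (A.sum B).rank = A.rank + B.rank :=
  Module.finrank_prod (R := F) (M := A.V) (M' := B.V)

theorem rank_unary (a : Fˣ) : (unary a).rank = 1 := Module.finrank_self F

theorem rank_zero : (zero : SymForm F).rank = 0 :=
  Module.finrank_zero_of_subsingleton (M := PUnit)

theorem Iso.rank_eq {A B : SymForm F} (h : Iso A B) : A.rank = B.rank :=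
  h.exists.choose.finrank_eq

theorem eq_zero_of_rank_eq_zero {A : SymForm F} (h : A.rank = 0) (x : A.V) : x = 0 :=
  have : Subsingleton A.V := Module.finrank_zero_iff.1 h
  Subsingleton.elim _ _

theorem anisotropic_of_rank_eq_zero {A : SymForm F} (h : A.rank = 0) : A.Anisotropic :=
  fun x _ => eq_zero_of_rank_eq_zero h x

theorem mk_eq_zero_of_rank_eq_zero {A : SymForm F} (h : A.rank = 0) : WittGroup.mk A = 0 :=
  WittGroup.mk_metabolic ⟨0, ⊥, h, finrank_bot F A.V,
    fun x _ y _ => by simp [eq_zero_of_rank_eq_zero h x]⟩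

theorem Anisotropic.of_iso {A B : SymForm F} (hA : A.Anisotropic) (h : Iso A B) :
    B.Anisotropic := by
  obtain ⟨e, he⟩ := h.symm.exists
  exact fun x hx => by simpa using hA (e x) (by rw [he, hx])

theorem anisotropic_neg_iff {A : SymForm F} : A.neg.Anisotropic ↔ A.Anisotropic :=
  forall_congr' fun _ => imp_congr neg_eq_zero Iff.rfl

theorem Metabolic.of_iso {A B : SymForm F} (hA : A.Metabolic) (h : Iso A B) : B.Metabolic := by
  obtain ⟨e, he⟩ := h.exists
  obtain ⟨k, W, hrank, hW, hiso⟩ := hA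
  refine ⟨k, W.map e.toLinearMap, h.rank_eq ▸ hrank, hW ▸ LinearEquiv.finrank_map_eq e W, ?_⟩
  rintro _ ⟨x, hx, rfl⟩ _ ⟨y, hy, rfl⟩
  exact (he x y).trans (hiso x hx y hy)

theorem exists_split_of_form_self (B : SymForm F) (x : B.V) (a : Fˣ) (hx : B.form x x = a) :
    ∃ B' : SymForm F, Iso B ((unary a).sum B') := by
  have hxx : B.form x x ≠ 0 := hx ▸ a.ne_zero
  have hx0 : x ≠ 0 := fun h => hxx (by simp [h])
  let U := B.form.orthogonal (F ∙ x)
  have hxU (u : U) : B.form x u = 0 := u.2 x (Submodule.mem_span_singleton_self x)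
  have hUx (u : U) : B.form u x = 0 := by rw [B.symm.eq, hxU]
  let B' : SymForm F :=
    { V := U
      form := B.form.restrict U
      symm := ⟨fun u w => B.symm.eq u w⟩
      nondeg := B.form.restrict_nondegenerate_orthogonal_spanSingleton B.nondeg B.symm.isRefl hxx }
  let e : (F × U) ≃ₗ[F] B.V :=
    ((LinearEquiv.toSpanNonzeroSingleton F B.V x hx0).prodCongr (LinearEquiv.refl F U)).trans
      (Submodule.prodEquivOfIsCompl _ _
        (LinearMap.BilinForm.isCompl_span_singleton_orthogonal hxx))
  have he (z : F × U) : e z = z.1 • x + (z.2 : B.V) := rfl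
  refine ⟨B', (Iso.of (B₁ := (unary a).sum B') e fun (z w : F × U) => ?_).symm⟩
  change B.form (e z) (e w) = a * (z.1 * w.1) + B.form z.2 w.2
  rw [he, he]
  simp only [map_add, map_smul, LinearMap.add_apply, LinearMap.smul_apply, hxU, hUx, hx,
    smul_eq_mul, mul_zero, add_zero, zero_add]
  ring

theorem exists_iso_unary_sum (h2 : (2 : F) ≠ 0) {B : SymForm F} {n : ℕ} (hB : B.rank = n + 1) :
    ∃ (a : Fˣ) (B' : SymForm F), Iso B ((unary a).sum B') ∧ B'.rank = n := by
  obtain ⟨a, B', e, -⟩ := B.exists_split h2 (by omega)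
  have := e.rank_eq
  rw [rank_sum, rank_unary] at this
  exact ⟨a, B', e, by omega⟩

theorem mk_unary_add_mk_unary_neg (a : Fˣ) :
    WittGroup.mk (unary a) + WittGroup.mk (unary (-a)) = 0 := by
  have := WittGroup.unary₀_relations.neg (a : F) a.ne_zero
  rwa [← Units.val_neg, WittGroup.unary₀_units, WittGroup.unary₀_units] at this

theorem exists_mk_eq_of_form_add_eq_zero {A : SymForm F} {a : Fˣ} {s : F} {y : A.V} (hs : s ≠ 0)
    (h : a * (s * s) + A.form y y = 0) :
    ∃ C : SymForm F, C.rank + 1 = A.rank ∧ WittGroup.mk C = WittGroup.mk ((unary a).sum A) := by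
  have hy : A.form (s⁻¹ • y) (s⁻¹ • y) = (-a : Fˣ) := by
    simp only [map_smul, LinearMap.smul_apply, smul_eq_mul, Units.val_neg]
    field_simp
    linear_combination h
  obtain ⟨C, e⟩ := A.exists_split_of_form_self (s⁻¹ • y) (-a) hy
  refine ⟨C, by rw [e.rank_eq, rank_sum, rank_unary, add_comm], ?_⟩
  rw [WittGroup.mk_sum, WittGroup.mk_eq e.wittEquiv, WittGroup.mk_sum, ← add_assoc,
    mk_unary_add_mk_unary_neg, zero_add]

theorem exists_mk_eq_of_not_anisotropic (h2 : (2 : F) ≠ 0) (B : SymForm F)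
    (hB : ¬ B.Anisotropic) :
    ∃ C : SymForm F, C.rank + 2 = B.rank ∧ WittGroup.mk C = WittGroup.mk B := by
  induction hn : B.rank generalizing B with
  | zero => exact absurd (anisotropic_of_rank_eq_zero hn) hB
  | succ n ih =>
    obtain ⟨a, A, e, hA⟩ := exists_iso_unary_sum h2 hn
    have hi : ¬ ((unary a).sum A).Anisotropic := fun h => hB (h.of_iso e.symm)
    simp only [Anisotropic, not_forall] at hi
    obtain ⟨⟨(s : F), y⟩, hz, hne⟩ := hi
    replace hz : (a : F) * (s * s) + A.form y y = 0 := hz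
    rw [WittGroup.mk_eq e.wittEquiv]
    by_cases hs : s = 0
    · have hAi : ¬ A.Anisotropic := fun h => hne (Prod.ext hs (h y (by simpa [hs] using hz)))
      obtain ⟨C, hC, hCA⟩ := ih A hAi hA
      exact ⟨(unary a).sum C, by rw [rank_sum, rank_unary]; omega,
        by rw [WittGroup.mk_sum, WittGroup.mk_sum, hCA]⟩
    · obtain ⟨C, hC, hCA⟩ := exists_mk_eq_of_form_add_eq_zero hs hz
      exact ⟨C, by omega, hCA⟩

theorem exists_metabolic_sum_of_mk_eq_zero {A : SymForm F} (h : WittGroup.mk A = 0) :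
    ∃ M : SymForm F, M.Metabolic ∧ (A.sum M).Metabolic := by
  obtain ⟨M, N, hM, hN, e⟩ : WittEquiv A zero := Quotient.exact h
  exact ⟨M, hM, (metabolic_zero.sum hN).of_iso e.symm⟩

theorem even_rank_of_mk_eq_zero {A : SymForm F} (h : WittGroup.mk A = 0) : Even A.rank := by
  obtain ⟨M, ⟨k, -, hM, -⟩, ⟨l, -, hAM, -⟩⟩ := exists_metabolic_sum_of_mk_eq_zero h
  rw [rank_sum] at hAM
  exact ⟨l - k, by omega⟩

theorem finrank_add_finrank_le (B : SymForm F) {U W : Submodule F B.V}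
    (h : ∀ u ∈ U, ∀ w ∈ W, B.form u w = 0) :
    Module.finrank F U + Module.finrank F W ≤ B.rank := by
  have hW : W ≤ B.form.orthogonal U := fun w hw u hu => h u hu w hw
  have hle := Submodule.finrank_mono hW
  rw [LinearMap.BilinForm.finrank_orthogonal B.nondeg] at hle
  have := Submodule.finrank_le U
  rw [rank]
  omega

theorem finrank_top_prod {V W : Type} [AddCommGroup V] [Module F V] [AddCommGroup W] [Module F W]
    [FiniteDimensional F V] [FiniteDimensional F W] (L : Submodule F W) :
    Module.finrank F ((⊤ : Submodule F V).prod L) = Module.finrank F V + Module.finrank F L := by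
  rw [← Module.finrank_prod, ← LinearMap.finrank_range_of_inj
    (f := LinearMap.id.prodMap L.subtype)
    (Prod.map_injective.2 ⟨Function.injective_id, L.injective_subtype⟩),
    LinearMap.range_prodMap, LinearMap.range_id, Submodule.range_subtype]

/- If `L ⊆ M` and `N ⊆ A ⊕ M` are Lagrangian and `A` is anisotropic, then `J = N ∩ (A ⊕ L)` lies
in `0 ⊕ L`, so it is orthogonal to both `N` and `A ⊕ L`; now count dimensions. -/
theorem Anisotropic.rank_eq_zero {A : SymForm F} (hA : A.Anisotropic)
    (h : WittGroup.mk A = 0) : A.rank = 0 := by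
  obtain ⟨M, ⟨k, L, hM, hL, hLiso⟩, ⟨l, N, hAM, hN, hNiso⟩⟩ := exists_metabolic_sum_of_mk_eq_zero h
  let P : Submodule F (A.sum M).V := (⊤ : Submodule F A.V).prod L
  have hP : Module.finrank F P = A.rank + k := hL ▸ finrank_top_prod L
  have hfst (z : A.V × M.V) (hzN : z ∈ N) (hzP : z.2 ∈ L) : z.1 = 0 := by
    have hz : A.form z.1 z.1 + M.form z.2 z.2 = 0 := hNiso z hzN z hzN
    exact hA _ (by rwa [hLiso _ hzP _ hzP, add_zero] at hz)
  have horth : ∀ u ∈ N ⊓ P, ∀ w ∈ N ⊔ P, (A.sum M).form u w = 0 := by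
    rintro u ⟨huN, huP⟩ w hw
    obtain ⟨w₁, hw₁, w₂, hw₂, rfl⟩ := Submodule.mem_sup.1 hw
    have hu₂ : A.form u.1 w₂.1 + M.form u.2 w₂.2 = 0 := by
      rw [hfst u huN huP.2, hLiso _ huP.2 _ hw₂.2]
      simp
    rw [map_add, hNiso u huN w₁ hw₁, zero_add]
    exact hu₂
  have hle := (A.sum M).finrank_add_finrank_le horth
  have hsup := Submodule.finrank_sup_add_finrank_inf_eq N P
  rw [rank_sum] at hAM hle
  omega

end Field

section Signature

theorem toQuadraticMap_equivalent_weightedSumSquares (B : SymForm ℚ) {ι : Type} [Fintype ι]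
    (v : Module.Basis ι ℚ B.V) (hv : B.IsOrtho v) :
    QuadraticMap.Equivalent B.form.toQuadraticMap
      (QuadraticMap.weightedSumSquares ℚ fun k => B.form (v k) (v k)) := by
  classical
  have hassoc : QuadraticMap.associated (R := ℚ) B.form.toQuadraticMap = B.form :=
    QuadraticMap.associated_left_inverse ℚ fun x y => B.symm.eq x y
  have hrepr := QuadraticMap.basisRepr_eq_of_iIsOrtho B.form.toQuadraticMap v
    (by rw [hassoc]; exact fun i j hij => hv i j hij)
  exact ⟨(QuadraticMap.isometryEquivBasisRepr B.form.toQuadraticMap v).trans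
    ⟨LinearEquiv.refl ℚ _, fun x => (congrArg (fun q => q x) hrepr).symm⟩⟩

theorem signature_eq_sum_sign (B : SymForm ℚ) {ι : Type} [Fintype ι]
    (v : Module.Basis ι ℚ B.V) (hv : B.IsOrtho v) :
    B.signature = ∑ k, (SignType.sign (B.form (v k) (v k)) : ℤ) := by
  classical
  have hB := B.toQuadraticMap_equivalent_weightedSumSquares v hv
  rw [signature, QuadraticForm.sigPos_of_equiv_weightedSumSquares hB,
    QuadraticForm.sigNeg_of_equiv_weightedSumSquares hB, Set.ncard_eq_toFinset_card',
    Set.ncard_eq_toFinset_card', Finset.card_eq_sum_ones, Finset.card_eq_sum_ones]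
  simp only [Set.toFinset_ofPred, Finset.sum_filter]
  push_cast
  rw [← Finset.sum_sub_distrib]
  refine Finset.sum_congr rfl fun k _ => ?_
  rcases lt_trichotomy (B.form (v k) (v k)) 0 with h | h | h <;> simp [h, h.not_gt]

theorem signature_sum (A B : SymForm ℚ) : (A.sum B).signature = A.signature + B.signature := by
  obtain ⟨v, hv⟩ := A.exists_isOrtho two_ne_zero
  obtain ⟨w, hw⟩ := B.exists_isOrtho two_ne_zero
  rw [signature_eq_sum_sign _ _ (sum_isOrtho_sum hv hw), signature_eq_sum_sign A v hv,
    signature_eq_sum_sign B w hw, Fintype.sum_sum_type]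
  simp [sum_form_sumBasis]

theorem signature_unary (a : ℚˣ) : (unary a).signature = (SignType.sign (a : ℚ) : ℤ) := by
  rw [signature_eq_sum_sign (unary a)
    (Module.Basis.singleton Unit ℚ : Module.Basis Unit ℚ ℚ) fun i j hij => (hij rfl).elim,
    Fintype.sum_unique]
  change (SignType.sign ((a : ℚ) * (Module.Basis.singleton Unit ℚ default *
    Module.Basis.singleton Unit ℚ default)) : ℤ) = _
  simp

theorem Iso.signature_eq {A B : SymForm ℚ} (h : Iso A B) : A.signature = B.signature := by
  obtain ⟨e, he⟩ := h.exists
  have hQ : QuadraticMap.Equivalent A.form.toQuadraticMap B.form.toQuadraticMap :=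
    ⟨⟨e, fun x => he x x⟩⟩
  rw [signature, signature, hQ.sigPos_eq, hQ.sigNeg_eq]

theorem signature_neg (A : SymForm ℚ) : A.neg.signature = -A.signature := by
  obtain ⟨v, hv⟩ := A.exists_isOrtho two_ne_zero
  have hvn : A.neg.IsOrtho (v : Module.Basis _ ℚ A.neg.V) := fun i j hij =>
    (congrArg Neg.neg (hv i j hij)).trans neg_zero
  rw [signature_eq_sum_sign A v hv, signature_eq_sum_sign A.neg v hvn, ← Finset.sum_neg_distrib]
  refine Finset.sum_congr rfl fun k _ => ?_
  change ((SignType.sign (-(A.form (v k) (v k))) : SignType) : ℤ) = _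
  rw [Left.sign_neg, SignType.coe_neg]

theorem sigPos_add_sigNeg (A : SymForm ℚ) :
    sigPos A.form.toQuadraticMap + sigNeg A.form.toQuadraticMap = A.rank := by
  have hrad : A.form.toQuadraticMap.radical = ⊥ := by
    refine (Submodule.eq_bot_iff _).2 fun x hx => A.nondeg.1 x fun y => ?_
    have h := LinearMap.congr_fun (LinearMap.mem_ker.1
      (QuadraticMap.radical_le_ker_polarBilin hx)) y
    simp only [QuadraticMap.polarBilin_apply_apply, QuadraticMap.polar,
      LinearMap.BilinMap.toQuadraticMap_apply, map_add, LinearMap.add_apply,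
      LinearMap.zero_apply, A.symm.eq y x] at h
    linarith
  have h := QuadraticForm.sigPos_add_sigNeg_add_radical (Q := A.form.toQuadraticMap)
  rwa [hrad, finrank_bot, add_zero] at h

theorem abs_signature_le_rank (A : SymForm ℚ) : |A.signature| ≤ A.rank := by
  rw [← A.sigPos_add_sigNeg, signature, abs_le]
  push_cast
  constructor <;> omega

theorem even_rank_add_signature (A : SymForm ℚ) : Even ((A.rank : ℤ) + A.signature) := by
  rw [← A.sigPos_add_sigNeg, signature]
  exact ⟨sigPos A.form.toQuadraticMap, by push_cast; ring⟩

end Signature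

end SymForm

section FiniteField

variable {F : Type*} [Field F] [Finite F]

theorem exists_mul_sq_add_mul_sq_eq (hF : ringChar F ≠ 2) {a b : F} (ha : a ≠ 0) (hb : b ≠ 0)
    (c : F) : ∃ x y : F, a * x ^ 2 + b * y ^ 2 = c := by
  have := Fintype.ofFinite F
  have hdeg : (Polynomial.C b * Polynomial.X ^ 2).degree = ((2 : ℕ) : WithBot ℕ) :=
    Polynomial.degree_C_mul_X_pow 2 hb
  obtain ⟨x, y, h⟩ := FiniteField.exists_root_sum_quadratic
    (f := Polynomial.C a * Polynomial.X ^ 2)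
    (g := Polynomial.C b * Polynomial.X ^ 2 - Polynomial.C c)
    (Polynomial.degree_C_mul_X_pow 2 ha)
    ((Polynomial.degree_sub_C (hdeg ▸ by decide)).trans hdeg)
    (FiniteField.odd_card_of_char_ne_two hF)
  simp only [Polynomial.eval_mul, Polynomial.eval_C, Polynomial.eval_pow, Polynomial.eval_X,
    Polynomial.eval_sub] at h
  exact ⟨x, y, by linear_combination h⟩

theorem isSquare_mul_of_not_isSquare {a b : F} (ha : ¬ IsSquare a) (hb : ¬ IsSquare b) :
    IsSquare (a * b) := by
  classical
  have := Fintype.ofFinite F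
  have ha0 : a ≠ 0 := by rintro rfl; exact ha IsSquare.zero
  have hb0 : b ≠ 0 := by rintro rfl; exact hb IsSquare.zero
  rw [← quadraticChar_one_iff_isSquare (mul_ne_zero ha0 hb0), map_mul,
    quadraticChar_neg_one_iff_not_isSquare.2 ha, quadraticChar_neg_one_iff_not_isSquare.2 hb]
  norm_num

end FiniteField

namespace WittGroup

open SymForm

section Field

variable {F : Type} [Field F]

theorem unary₀_zero : unary₀ (0 : F) = 0 := by simp [unary₀]

theorem unary₀_add_neg (a : F) : unary₀ a + unary₀ (-a) = 0 := by
  by_cases ha : a = 0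
  · simp [ha, unary₀_zero]
  · exact unary₀_relations.neg a ha

theorem unary₀_neg (a : F) : unary₀ (-a) = -unary₀ a :=
  eq_neg_of_add_eq_zero_right (unary₀_add_neg a)

theorem unary₀_eq_of_isSquare {a b : F} (ha : a ≠ 0) (hb : b ≠ 0) (h : IsSquare (a * b)) :
    unary₀ a = unary₀ b := by
  obtain ⟨c, hc⟩ := h
  have hc0 : c ≠ 0 := by rintro rfl; exact mul_ne_zero ha hb (by simpa using hc)
  have hb' : a * (c / a) ^ 2 = b := by
    field_simp
    linear_combination -hc
  rw [← hb', unary₀_relations.sq a (c / a) ha (div_ne_zero hc0 ha)]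

theorem anisotropic_unary_sum_unary {a b : Fˣ} (h : ¬ IsSquare (-((a : F) * b))) :
    ((SymForm.unary a).sum (SymForm.unary b)).Anisotropic := by
  rintro ⟨(x : F), (y : F)⟩ hxy
  replace hxy : (a : F) * (x * x) + b * (y * y) = 0 := hxy
  have hy : y = 0 := by
    by_contra hy
    refine h ⟨a * x / y, ?_⟩
    field_simp
    linear_combination -hxy
  subst hy
  have hx : x = 0 := by simpa using hxy
  subst hx
  rfl

theorem unary₀_add_eq_zero_iff {a b : F} (ha : a ≠ 0) (hb : b ≠ 0) :
    unary₀ a + unary₀ b = 0 ↔ IsSquare (-(a * b)) := by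
  constructor
  · intro h
    by_contra hn
    rw [unary₀_of_ne ha, unary₀_of_ne hb] at h
    have hrank := (anisotropic_unary_sum_unary (a := Units.mk0 a ha) (b := Units.mk0 b hb)
      hn).rank_eq_zero h
    rw [rank_sum, rank_unary, rank_unary] at hrank
    omega
  · intro h
    rw [← unary₀_add_neg a, unary₀_eq_of_isSquare hb (neg_ne_zero.2 ha)]
    convert h using 1; ring

theorem unary₀_eq_iff {a b : F} (ha : a ≠ 0) (hb : b ≠ 0) :
    unary₀ a = unary₀ b ↔ IsSquare (a * b) := by
  rw [← sub_eq_zero, sub_eq_add_neg, ← unary₀_neg, unary₀_add_eq_zero_iff ha (neg_ne_zero.2 hb),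
    mul_neg, neg_neg]

theorem unary₀_add_unary₀_of_represents {a b c x y : F} (ha : a ≠ 0) (hb : b ≠ 0) (hc : c ≠ 0)
    (h : a * x ^ 2 + b * y ^ 2 = c) : unary₀ a + unary₀ b = unary₀ c + unary₀ (a * b * c) := by
  have habc := mul_ne_zero (mul_ne_zero ha hb) hc
  by_cases hx : x = 0
  · subst hx
    rw [add_comm, unary₀_eq_of_isSquare hb hc ⟨b * y, by rw [← h]; ring⟩,
      unary₀_eq_of_isSquare ha habc ⟨a * b * y, by rw [← h]; ring⟩]
  by_cases hy : y = 0
  · subst hy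
    rw [unary₀_eq_of_isSquare ha hc ⟨a * x, by rw [← h]; ring⟩,
      unary₀_eq_of_isSquare hb habc ⟨a * b * x, by rw [← h]; ring⟩]
  · have hadd := unary₀_relations.add (a * x ^ 2) (b * y ^ 2) (by positivity) (by positivity)
      (h ▸ hc)
    rw [h, unary₀_relations.sq _ _ ha hx, unary₀_relations.sq _ _ hb hy] at hadd
    rw [hadd, show a * x ^ 2 * (b * y ^ 2) * c = a * b * c * (x * y) ^ 2 by ring,
      unary₀_relations.sq _ _ habc (mul_ne_zero hx hy)]

/-- The rank modulo two as a homomorphism on the Witt group; the kernel is the fundamental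
ideal. -/
def rankParity : WittGroup F →+ ZMod 2 :=
  AddMonoidHom.mk' (Quotient.lift (fun B => (B.rank : ZMod 2)) fun A B h => by
      have hAB : mk (A.sum B.neg) = 0 := by rw [mk_sum, mk_neg, mk_eq h, add_neg_cancel]
      have heven : Even (A.rank + B.neg.rank) := rank_sum A B.neg ▸ even_rank_of_mk_eq_zero hAB
      replace heven : Even (A.rank + B.rank) := heven
      exact (ZMod.natCast_eq_natCast_iff' _ _ _).2 (by rw [Nat.even_iff] at heven; omega))
    (ind fun A => ind fun B => by
      change ((A.sum B).rank : ZMod 2) = A.rank + B.rank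
      rw [rank_sum, Nat.cast_add])

theorem rankParity_unary₀ {a : F} (ha : a ≠ 0) : rankParity (unary₀ a) = 1 := by
  rw [unary₀_of_ne ha]
  change ((SymForm.unary _).rank : ZMod 2) = 1
  rw [rank_unary, Nat.cast_one]

end Field

section FiniteField

variable {F : Type} [Field F] [Finite F]

theorem unary₀_add_unary₀_eq (hF : ringChar F ≠ 2) {a b c d : F} (ha : a ≠ 0) (hb : b ≠ 0)
    (hc : c ≠ 0) (hd : d ≠ 0) (h : IsSquare (a * b * c * d)) :
    unary₀ a + unary₀ b = unary₀ c + unary₀ d := by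
  obtain ⟨x, y, hxy⟩ := exists_mul_sq_add_mul_sq_eq hF ha hb c
  rw [unary₀_add_unary₀_of_represents ha hb hc hxy,
    unary₀_eq_of_isSquare (mul_ne_zero (mul_ne_zero ha hb) hc) hd h]

theorem unary₀_add_unary₀_eq_of_not_isSquare (hF : ringChar F ≠ 2) {a b c d : F}
    (hab : ¬ IsSquare (-(a * b))) (hcd : ¬ IsSquare (-(c * d))) :
    unary₀ a + unary₀ b = unary₀ c + unary₀ d := by
  have ha : a ≠ 0 := by rintro rfl; simp at hab
  have hb : b ≠ 0 := by rintro rfl; simp at hab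
  have hc : c ≠ 0 := by rintro rfl; simp at hcd
  have hd : d ≠ 0 := by rintro rfl; simp at hcd
  refine unary₀_add_unary₀_eq hF ha hb hc hd ?_
  convert isSquare_mul_of_not_isSquare hab hcd using 1
  ring

theorem eq_zero_or_unary₀_or_anisotropic (hF : ringChar F ≠ 2) (x : WittGroup F) :
    x = 0 ∨ (∃ u, u ≠ 0 ∧ x = unary₀ u) ∨
      ∃ a b, ¬ IsSquare (-(a * b)) ∧ x = unary₀ a + unary₀ b := by
  refine unary_induction (Ring.two_ne_zero hF) (p := fun x => x = 0 ∨
    (∃ u, u ≠ 0 ∧ x = unary₀ u) ∨ ∃ a b, ¬ IsSquare (-(a * b)) ∧ x = unary₀ a + unary₀ b)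
    (Or.inl rfl) (fun a x hx => ?_) x
  rw [← unary₀_units]
  rcases hx with rfl | ⟨u, hu, rfl⟩ | ⟨b, c, hbc, rfl⟩
  · exact Or.inr (Or.inl ⟨a, a.ne_zero, add_zero _⟩)
  · by_cases h : IsSquare (-((a : F) * u))
    · exact Or.inl ((unary₀_add_eq_zero_iff a.ne_zero hu).2 h)
    · exact Or.inr (Or.inr ⟨a, u, h, rfl⟩)
  · have ha := a.ne_zero
    obtain ⟨n, hn⟩ := FiniteField.exists_nonsquare hF
    have hn0 : n ≠ 0 := by rintro rfl; exact hn IsSquare.zero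
    have hdisc : ¬ IsSquare (-(-(a : F) * (n / a))) := by
      convert hn using 1
      field_simp
    refine Or.inr (Or.inl ⟨n / a, div_ne_zero hn0 ha, ?_⟩)
    rw [unary₀_add_unary₀_eq_of_not_isSquare hF hbc hdisc, ← add_assoc, unary₀_add_neg, zero_add]

theorem exists_eq_unary₀_of_rankParity_eq_one (hF : ringChar F ≠ 2) {x : WittGroup F}
    (hx : rankParity x = 1) : ∃ u, u ≠ 0 ∧ x = unary₀ u := by
  rcases eq_zero_or_unary₀_or_anisotropic hF x with rfl | h | ⟨a, b, hab, rfl⟩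
  · simp at hx
  · exact h
  · have ha : a ≠ 0 := by rintro rfl; simp at hab
    have hb : b ≠ 0 := by rintro rfl; simp at hab
    rw [map_add, rankParity_unary₀ ha, rankParity_unary₀ hb] at hx
    exact absurd hx (by decide)

theorem eq_unary₀_add_unary₀_of_rankParity_eq_zero (hF : ringChar F ≠ 2) {x : WittGroup F}
    (hx : rankParity x = 0) (hx0 : x ≠ 0) {a b : F} (hab : ¬ IsSquare (-(a * b))) :
    x = unary₀ a + unary₀ b := by
  rcases eq_zero_or_unary₀_or_anisotropic hF x with rfl | ⟨u, hu, rfl⟩ | ⟨c, d, hcd, rfl⟩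
  · exact absurd rfl hx0
  · exact absurd (rankParity_unary₀ hu ▸ hx) one_ne_zero
  · exact unary₀_add_unary₀_eq_of_not_isSquare hF hcd hab

end FiniteField

end WittGroup

section Residue

open WittGroup

theorem del_eq_iff {x y : WittGroup ℚ} :
    del x = del y ↔ ∀ p : Nat.Primes, delPrime p x = delPrime p y := by
  simp only [← del_apply]
  exact DFunLike.ext_iff

theorem del_eq_zero_iff {x : WittGroup ℚ} : del x = 0 ↔ ∀ p : Nat.Primes, delPrime p x = 0 := by
  rw [← map_zero del, del_eq_iff]
  simp only [map_zero]

variable {p : ℕ} [hp : Fact p.Prime]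

theorem delPrime_unary₀_of_not_dvd {n : ℤ} (h : ¬ (p : ℤ) ∣ n) :
    delPrime p (unary₀ (n : ℚ)) = 0 := by
  have hn : (n : ℚ) ≠ 0 := by
    rintro h0
    simp [Int.cast_eq_zero.1 h0] at h
  rw [unary₀_of_ne hn]
  refine delPrime_unary_eq_zero _ ?_
  rw [Units.val_mk0, padicValRat.of_int, padicValInt.eq_zero_of_not_dvd h, Nat.cast_zero]

theorem delPrime_unary₀_mul {n : ℤ} (h : ¬ (p : ℤ) ∣ n) :
    delPrime p (unary₀ ((p * n : ℤ) : ℚ)) = unary₀ (n : ZMod p) := by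
  have hn : n ≠ 0 := by rintro rfl; simp at h
  have hnorm : ‖((n : ℤ_[p]) : ℚ_[p])‖ = 1 := by
    rw [PadicInt.coe_intCast]
    exact (Padic.norm_int_le_one n).antisymm (not_lt.1 (h ∘ Padic.norm_intCast_lt_one_iff.1))
  let u : ℤ_[p]ˣ := PadicInt.mkUnits hnorm
  have hpn : ((p * n : ℤ) : ℚ) ≠ 0 := by
    exact_mod_cast mul_ne_zero (by exact_mod_cast hp.1.ne_zero) hn
  have hu : Units.map (algebraMap ℚ ℚ_[p]).toMonoidHom (Units.mk0 _ hpn) =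
      padicUniformizer p * padicUnit u := by
    ext
    have : (padicUnit u : ℚ_[p]) = n := PadicInt.coe_intCast n
    rw [Units.val_mul, this]
    simp [padicUniformizer]
  rw [unary₀_of_ne hpn, delPrime, AddMonoidHom.comp_apply, WittGroup.baseChange_unary, hu,
    (secondResidue_spec p u).2, ← unary₀_units]
  exact congrArg unary₀ (map_intCast PadicInt.toZMod n)

theorem not_dvd_of_squarefree_mul {n : ℤ} (h : Squarefree ((p : ℤ) * n)) : ¬ (p : ℤ) ∣ n := by
  rintro ⟨k, rfl⟩
  exact (Nat.prime_iff_prime_int.1 hp.1).not_isUnit (h p ⟨k, by ring⟩)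

theorem rankParity_delPrime_unary₀ {n : ℤ} (h : Squarefree n) :
    rankParity (delPrime p (unary₀ (n : ℚ))) = if (p : ℤ) ∣ n then 1 else 0 := by
  split_ifs with hd
  · obtain ⟨m, rfl⟩ := hd
    have hm := not_dvd_of_squarefree_mul h
    rw [delPrime_unary₀_mul hm, rankParity_unary₀]
    rwa [Ne, ZMod.intCast_zmod_eq_zero_iff_dvd]
  · rw [delPrime_unary₀_of_not_dvd hd, map_zero]

theorem exists_squarefree_mul_sq_int {n : ℤ} (hn : n ≠ 0) :
    ∃ m b : ℤ, Squarefree m ∧ b ≠ 0 ∧ n = m * b ^ 2 := by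
  obtain ⟨m, b, h, hm⟩ := Nat.sq_mul_squarefree n.natAbs
  refine ⟨n.sign * m, b, ?_, ?_, ?_⟩
  · rw [← Int.squarefree_natAbs, Int.natAbs_mul, Int.natAbs_sign_of_ne_zero hn, one_mul]
    exact hm
  · rintro h0
    rw [Nat.cast_eq_zero.1 h0, zero_pow two_ne_zero, zero_mul] at h
    exact hn (Int.natAbs_eq_zero.1 h.symm)
  · rw [mul_assoc, mul_comm (m : ℤ), ← Nat.cast_pow, ← Nat.cast_mul, h, Int.sign_mul_natAbs]

theorem exists_squarefree_mul_sq {a : ℚ} (ha : a ≠ 0) :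
    ∃ (n : ℤ) (c : ℚ), Squarefree n ∧ c ≠ 0 ∧ a = n * c ^ 2 := by
  have hd : (a.den : ℚ) ≠ 0 := by exact_mod_cast a.den_nz
  obtain ⟨n, b, hn, hb, h⟩ := exists_squarefree_mul_sq_int
    (mul_ne_zero (Rat.num_ne_zero.2 ha) (Int.natCast_ne_zero.2 a.den_nz))
  refine ⟨n, b / a.den, hn, div_ne_zero (by exact_mod_cast hb) hd, ?_⟩
  have hq : (a.num : ℚ) * a.den = n * b ^ 2 := by exact_mod_cast h
  rw [div_pow, ← mul_div_assoc, ← hq]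
  nth_rw 1 [← a.num_div_den]
  field_simp

theorem exists_squarefree_unary_eq (a : ℚˣ) : ∃ n : ℤ, Squarefree n ∧
    unary a = unary₀ (n : ℚ) ∧ SignType.sign (a : ℚ) = SignType.sign n := by
  obtain ⟨n, c, hn, hc, ha⟩ := exists_squarefree_mul_sq a.ne_zero
  refine ⟨n, hn, ?_, ?_⟩
  · rw [← unary₀_units, ha, unary₀_relations.sq _ _ (by exact_mod_cast hn.ne_zero) hc]
  · rw [ha, sign_mul, sign_pos (sq_pos_of_ne_zero hc), mul_one, sign_intCast]

theorem delPrime_two_eq_zero_or_eq_unary₀_one (x : WittGroup ℚ) :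
    delPrime 2 x = 0 ∨ delPrime 2 x = unary₀ 1 := by
  refine unary_induction two_ne_zero
    (p := fun x => delPrime 2 x = 0 ∨ delPrime 2 x = unary₀ 1)
    (Or.inl (map_zero _)) (fun a x hx => ?_) x
  obtain ⟨n, hn, ha, -⟩ := exists_squarefree_unary_eq a
  rw [map_add, ha]
  by_cases hd : ((2 : ℕ) : ℤ) ∣ n
  · obtain ⟨m, rfl⟩ := hd
    have hm := not_dvd_of_squarefree_mul hn
    have hm1 : (m : ZMod 2) = 1 :=
      Fin.eq_one_of_ne_zero _ fun h => hm ((ZMod.intCast_zmod_eq_zero_iff_dvd m 2).1 h)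
    rw [delPrime_unary₀_mul hm, hm1]
    rcases hx with hx | hx <;> rw [hx]
    · exact Or.inr (add_zero _)
    · exact Or.inl (unary₀_add_neg 1)
  · rwa [delPrime_unary₀_of_not_dvd hd, zero_add]

theorem delPrime_two_eq_of_rankParity_eq {x y : WittGroup ℚ}
    (h : rankParity (delPrime 2 x) = rankParity (delPrime 2 y)) :
    delPrime 2 x = delPrime 2 y := by
  rcases delPrime_two_eq_zero_or_eq_unary₀_one x with hx | hx <;>
    rcases delPrime_two_eq_zero_or_eq_unary₀_one y with hy | hy <;>
    simp [hx, hy, rankParity_unary₀] at h ⊢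

end Residue

section PrimeProd

/-- The prime `2`. -/
def primeTwo : Nat.Primes := ⟨2, Nat.prime_two⟩

/-- The product of a finite set of primes, as an integer. -/
def primeProd (S : Finset Nat.Primes) : ℤ := ∏ p ∈ S, ((p : ℕ) : ℤ)

theorem primeProd_pos (S : Finset Nat.Primes) : 0 < primeProd S :=
  Finset.prod_pos fun p _ => by exact_mod_cast p.2.pos

theorem mul_primeProd_erase {S : Finset Nat.Primes} {p : Nat.Primes} (hp : p ∈ S) :
    (p : ℕ) * primeProd (S.erase p) = primeProd S :=
  Finset.mul_prod_erase S (fun p : Nat.Primes => ((p : ℕ) : ℤ)) hp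

theorem prime_intCast_dvd_iff {p q : Nat.Primes} : ((p : ℕ) : ℤ) ∣ (q : ℕ) ↔ p = q := by
  rw [Int.natCast_dvd_natCast, Nat.prime_dvd_prime_iff_eq p.2 q.2, Nat.Primes.coe_nat_inj]

theorem dvd_primeProd_iff {S : Finset Nat.Primes} {q : Nat.Primes} :
    ((q : ℕ) : ℤ) ∣ primeProd S ↔ q ∈ S := by
  simp [primeProd, (Nat.prime_iff_prime_int.1 q.2).dvd_finsetProd_iff, prime_intCast_dvd_iff]

theorem exists_prime_modEq_pow (S : Finset Nat.Primes) (k a : Nat.Primes → ℕ)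
    (ha : ∀ p ∈ S, ¬ (p : ℕ) ∣ a p) :
    ∃ l : Nat.Primes, ∀ p ∈ S, l ≡ a p [MOD p ^ k p] := by
  have hne (p : Nat.Primes) : (p : ℕ) ^ k p ≠ 0 := pow_ne_zero _ p.2.ne_zero
  have hcop : Set.Pairwise S (Function.onFun Nat.Coprime fun p : Nat.Primes => (p : ℕ) ^ k p) :=
    fun p _ q _ hpq => Nat.Coprime.pow _ _
      ((Nat.coprime_primes p.2 q.2).2 fun h => hpq (Subtype.ext h))
  obtain ⟨r, hr⟩ := Nat.chineseRemainderOfFinset a _ S (fun p _ => hne p) hcop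
  have : NeZero (∏ p ∈ S, (p : ℕ) ^ k p) := ⟨Finset.prod_ne_zero_iff.2 fun p _ => hne p⟩
  have hunit : IsUnit (r : ZMod (∏ p ∈ S, (p : ℕ) ^ k p)) := by
    rw [ZMod.isUnit_iff_coprime]
    refine Nat.Coprime.prod_right fun p hp => ?_
    rw [Nat.Coprime, (hr p hp).gcd_eq]
    exact (((Nat.Prime.coprime_iff_not_dvd p.2).2 (ha p hp)).pow_left _).symm
  obtain ⟨l, -, hl, hlr⟩ := Nat.forall_exists_prime_gt_and_eq_mod hunit 0
  refine ⟨⟨l, hl⟩, fun p hp => Nat.ModEq.trans ?_ (hr p hp)⟩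
  exact ((ZMod.natCast_eq_natCast_iff _ _ _).1 hlr).of_dvd
    (Finset.dvd_prod_of_mem (fun p : Nat.Primes => (p : ℕ) ^ k p) hp)

theorem jacobiSym_primeProd {T : Finset Nat.Primes} (hT : ∀ p ∈ T, (p : ℕ) ≠ 2) {l : ℕ}
    (hl : l % 4 = 1) : jacobiSym (primeProd T) l = ∏ p ∈ T, jacobiSym l p := by
  classical
  induction T using Finset.induction_on with
  | empty => exact jacobiSym.one_left l
  | insert p T hp ih =>
    have hodd := p.2.odd_of_ne_two (hT p (Finset.mem_insert_self p T))
    rw [primeProd, Finset.prod_insert hp, Finset.prod_insert hp, jacobiSym.mul_left,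
      jacobiSym.quadratic_reciprocity_one_mod_four' hodd hl, ← primeProd,
      ih fun q hq => hT q (Finset.mem_insert_of_mem hq)]

theorem exists_χ₈_mul_prod_jacobiSym_eq_one {T : Finset Nat.Primes}
    (c : ∀ p : Nat.Primes, ZMod p) (hc : ∀ p ∈ T, c p ≠ 0) :
    ∃ e : ℕ, (e = 1 ∨ e = 5) ∧ ZMod.χ₈ e * ∏ p ∈ T, jacobiSym (c p).val p = 1 := by
  have hsq : (∏ p ∈ T, jacobiSym (c p).val p) ^ 2 = 1 := by
    rw [← Finset.prod_pow]
    refine Finset.prod_eq_one fun p hp => jacobiSym.sq_one ?_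
    rw [Int.gcd_natCast_natCast, Nat.gcd_comm]
    refine (Nat.Prime.coprime_iff_not_dvd p.2).2 ?_
    rw [← ZMod.natCast_eq_zero_iff, ZMod.natCast_zmod_val]
    exact hc p hp
  rcases mul_self_eq_one_iff.1 ((sq _).symm.trans hsq) with h | h
  · exact ⟨1, Or.inl rfl, by rw [h]; decide⟩
  · exact ⟨5, Or.inr rfl, by rw [h]; decide⟩

theorem exists_prime_modEq_eight (S : Finset Nat.Primes) (c : ∀ p : Nat.Primes, ZMod p)
    (hc : ∀ p ∈ S, c p ≠ 0) {e : ℕ} (he : Odd e) :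
    ∃ l : Nat.Primes, l ≡ e [MOD 8] ∧ ∀ p ∈ S, ((l : ℕ) : ZMod p) = c p := by
  obtain ⟨l, hl⟩ := exists_prime_modEq_pow (insert primeTwo S)
    (fun p => if p = primeTwo then 3 else 1) (fun p => if p = primeTwo then e else (c p).val)
    fun p hp => by
      split_ifs with h
      · subst h
        exact he.not_two_dvd_nat
      · rw [← ZMod.natCast_eq_zero_iff, ZMod.natCast_zmod_val]
        exact hc p (Finset.mem_of_mem_insert_of_ne hp h)
  have hl8 : l ≡ e [MOD 8] := by
    have := hl primeTwo (Finset.mem_insert_self _ _)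
    rw [if_pos rfl, if_pos rfl] at this
    exact this
  refine ⟨l, hl8, fun p hp => ?_⟩
  by_cases h : p = primeTwo
  · subst h
    have hodd : Odd (l : ℕ) := by
      rw [Nat.odd_iff] at he ⊢
      rw [← he]
      exact hl8.of_dvd (by norm_num)
    exact (ZMod.natCast_eq_one_iff_odd.2 hodd).trans
      (Fin.eq_one_of_ne_zero (c primeTwo) (hc primeTwo hp)).symm
  · have hlp := hl p (Finset.mem_insert_of_mem hp)
    rw [if_neg h, if_neg h, pow_one] at hlp
    rw [(ZMod.natCast_eq_natCast_iff _ _ _).2 hlp, ZMod.natCast_zmod_val]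

/- The residue of `l` modulo `8` is free up to `l ≡ 1 mod 4`, so it can be chosen to correct the
quadratic character of the product. -/
theorem exists_prime_isSquare_primeProd {S : Finset Nat.Primes} (h2 : primeTwo ∈ S)
    (c : ∀ p : Nat.Primes, ZMod p) (hc : ∀ p ∈ S, c p ≠ 0) :
    ∃ l : Nat.Primes, (l : ℕ) % 4 = 1 ∧ (∀ p ∈ S, ((l : ℕ) : ZMod p) = c p) ∧
      IsSquare (primeProd S : ZMod l) := by
  obtain ⟨e, he, hχ⟩ := exists_χ₈_mul_prod_jacobiSym_eq_one c
    (T := S.erase primeTwo) fun p hp => hc p (Finset.mem_of_mem_erase hp)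
  obtain ⟨l, hl8, hlc⟩ := exists_prime_modEq_eight S c hc (e := e)
    (by rcases he with rfl | rfl <;> decide)
  have hl4 : (l : ℕ) % 4 = 1 := by
    have := hl8.of_dvd (show 4 ∣ 8 by norm_num)
    rcases he with rfl | rfl <;> exact this
  refine ⟨l, hl4, hlc, ZMod.isSquare_of_jacobiSym_eq_one ?_⟩
  have htwo : ((primeTwo : ℕ) : ℤ) = 2 := rfl
  have hT (p : Nat.Primes) (hp : p ∈ S.erase primeTwo) : (p : ℕ) ≠ 2 := fun h =>
    Finset.ne_of_mem_erase hp (Nat.Primes.coe_nat_injective h)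
  rw [← mul_primeProd_erase h2, htwo, jacobiSym.mul_left,
    jacobiSym.at_two (Nat.odd_iff.2 (by omega)), jacobiSym_primeProd hT hl4, ← hχ,
    (ZMod.natCast_eq_natCast_iff _ _ _).2 hl8]
  refine congrArg _ (Finset.prod_congr rfl fun p hp => jacobiSym.mod_left' ?_)
  refine (ZMod.intCast_eq_intCast_iff' _ _ _).1 ?_
  rw [Int.cast_natCast, Int.cast_natCast, hlc p (Finset.mem_of_mem_erase hp),
    ZMod.natCast_zmod_val]

end PrimeProd

section Ternary

open WittGroup

theorem prime_not_dvd_unit (q : Nat.Primes) (e : ℤˣ) : ¬ ((q : ℕ) : ℤ) ∣ e :=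
  (Nat.prime_iff_prime_int.1 q.2).irreducible.not_dvd_isUnit e.isUnit

theorem prime_not_dvd_unit_mul_prime {q l : Nat.Primes} (hql : q ≠ l) (e : ℤˣ) :
    ¬ ((q : ℕ) : ℤ) ∣ e * (l : ℕ) := fun h =>
  ((Nat.prime_iff_prime_int.1 q.2).dvd_or_dvd h).elim (prime_not_dvd_unit q e)
    fun h => hql (prime_intCast_dvd_iff.1 h)

theorem prime_not_dvd_mul_primeProd {S : Finset Nat.Primes} {q : Nat.Primes} (hq : q ∉ S) {m : ℤ}
    (hm : ¬ ((q : ℕ) : ℤ) ∣ m) : ¬ ((q : ℕ) : ℤ) ∣ m * primeProd S := fun h =>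
  ((Nat.prime_iff_prime_int.1 q.2).dvd_or_dvd h).elim hm fun h => hq (dvd_primeProd_iff.1 h)

theorem delPrime_mul_primeProd_of_mem {S : Finset Nat.Primes} {q : Nat.Primes} (hq : q ∈ S)
    {m : ℤ} (hm : ¬ ((q : ℕ) : ℤ) ∣ m) :
    delPrime q (unary₀ ((m * primeProd S : ℤ) : ℚ)) =
      unary₀ ((m * primeProd (S.erase q) : ℤ) : ZMod q) := by
  rw [← delPrime_unary₀_mul (prime_not_dvd_mul_primeProd (S.notMem_erase q) hm),
    mul_left_comm, mul_primeProd_erase hq]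

theorem delPrime_mul_primeProd_of_notMem {S : Finset Nat.Primes} {q : Nat.Primes} (hq : q ∉ S)
    {m : ℤ} (hm : ¬ ((q : ℕ) : ℤ) ∣ m) :
    delPrime q (unary₀ ((m * primeProd S : ℤ) : ℚ)) = 0 :=
  delPrime_unary₀_of_not_dvd (prime_not_dvd_mul_primeProd hq hm)

theorem exists_delPrime_eq_unary₀ {p : Nat.Primes} {x : WittGroup ℚ}
    (hx : rankParity (delPrime p x) = 1) : ∃ u, u ≠ 0 ∧ delPrime p x = unary₀ u := by
  by_cases hp : p = primeTwo
  · subst hp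
    refine ⟨1, one_ne_zero, (delPrime_two_eq_zero_or_eq_unary₀_one x).resolve_left fun h => ?_⟩
    exact zero_ne_one ((map_zero _).symm.trans ((congrArg rankParity h).symm.trans hx))
  · refine exists_eq_unary₀_of_rankParity_eq_one ?_ hx
    rw [ZMod.ringChar_zmod_n]
    exact fun h => hp (Nat.Primes.coe_nat_injective h)

theorem exists_unary₀_mul_eq_delPrime {p : Nat.Primes} {x : WittGroup ℚ}
    (hx : rankParity (delPrime p x) = 1) {m : ZMod p} (hm : m ≠ 0) :
    ∃ z, z ≠ 0 ∧ unary₀ (m * z) = delPrime p x := by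
  obtain ⟨u, hu, h⟩ := exists_delPrime_eq_unary₀ hx
  exact ⟨u / m, div_ne_zero hu hm, by rw [mul_div_cancel₀ _ hm, h]⟩

theorem exists_unary₀_add_unary₀_mul_eq_delPrime {p : Nat.Primes} {x : WittGroup ℚ}
    (hx : rankParity (delPrime p x) = 0) (hp : p = primeTwo ∨ delPrime p x ≠ 0)
    {a b : ZMod p} (ha : a ≠ 0) (hb : b ≠ 0) :
    ∃ z, z ≠ 0 ∧ unary₀ a + unary₀ (b * z) = delPrime p x := by
  by_cases h2 : p = primeTwo
  · subst h2
    have h0 : delPrime 2 x = delPrime 2 0 := delPrime_two_eq_of_rankParity_eq (by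
      rw [map_zero, map_zero]
      exact hx)
    refine ⟨-a / b, div_ne_zero (neg_ne_zero.2 ha) hb, ?_⟩
    rw [mul_div_cancel₀ _ hb, unary₀_add_neg]
    exact (h0.trans (map_zero _)).symm
  · have hchar : ringChar (ZMod p) ≠ 2 := by
      rw [ZMod.ringChar_zmod_n]
      exact fun h => h2 (Nat.Primes.coe_nat_injective h)
    obtain ⟨n, hn⟩ := FiniteField.exists_nonsquare hchar
    have hn0 : n ≠ 0 := by rintro rfl; exact hn IsSquare.zero
    refine ⟨-n / (a * b), div_ne_zero (neg_ne_zero.2 hn0) (mul_ne_zero ha hb),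
      (eq_unary₀_add_unary₀_of_rankParity_eq_zero hchar hx (hp.resolve_left h2) ?_).symm⟩
    convert hn using 1
    field_simp

theorem exists_residue_multiplier (x : WittGroup ℚ) (e₁ e₂ e₃ : ℤˣ) (E P : Finset Nat.Primes)
    {p : Nat.Primes} (hp : p = primeTwo ∨ delPrime p x ≠ 0) :
    ∃ z : ZMod p, z ≠ 0 ∧
      (rankParity (delPrime p x) = 1 →
        unary₀ (((e₃ * primeProd (P.erase p) : ℤ) : ZMod p) * z) = delPrime p x) ∧
      (rankParity (delPrime p x) ≠ 1 → unary₀ ((e₁ * primeProd (E.erase p) : ℤ) : ZMod p) +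
        unary₀ (((e₂ * primeProd (E.erase p) : ℤ) : ZMod p) * z) = delPrime p x) := by
  have hne (T : Finset Nat.Primes) (e : ℤˣ) :
      ((e * primeProd (T.erase p) : ℤ) : ZMod p) ≠ 0 := by
    rw [Ne, ZMod.intCast_zmod_eq_zero_iff_dvd]
    exact prime_not_dvd_mul_primeProd (T.notMem_erase p) (prime_not_dvd_unit p e)
  by_cases hx : rankParity (delPrime p x) = 1
  · obtain ⟨z, hz, h⟩ := exists_unary₀_mul_eq_delPrime hx (hne P e₃)
    exact ⟨z, hz, fun _ => h, absurd hx⟩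
  · obtain ⟨z, hz, h⟩ := exists_unary₀_add_unary₀_mul_eq_delPrime
      (not_not.1 fun h => hx (Fin.eq_one_of_ne_zero _ h)) hp (hne E e₁) (hne E e₂)
    exact ⟨z, hz, fun h => absurd h hx, fun _ => h⟩

/-- The class of `⟨e₁D, e₂ℓD, e₃ℓD'⟩`, where `D` and `D'` are the products of the primes in `E` and
in `P`: its residues at `E`, at `P` and at `ℓ` have rank two, one and two. -/
def ternaryClass (e₁ e₂ e₃ : ℤˣ) (l : Nat.Primes) (E P : Finset Nat.Primes) : WittGroup ℚ :=
  unary₀ ((e₁ * primeProd E : ℤ) : ℚ) + unary₀ ((e₂ * (l : ℕ) * primeProd E : ℤ) : ℚ) +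
    unary₀ ((e₃ * (l : ℕ) * primeProd P : ℤ) : ℚ)

variable {e₁ e₂ e₃ : ℤˣ} {l q : Nat.Primes} {E P : Finset Nat.Primes}

theorem delPrime_ternaryClass_of_mem_left (hql : q ≠ l) (hE : q ∈ E) (hP : q ∉ P) :
    delPrime q (ternaryClass e₁ e₂ e₃ l E P) =
      unary₀ ((e₁ * primeProd (E.erase q) : ℤ) : ZMod q) +
        unary₀ ((e₂ * (l : ℕ) * primeProd (E.erase q) : ℤ) : ZMod q) := by
  rw [ternaryClass, map_add, map_add, delPrime_mul_primeProd_of_mem hE (prime_not_dvd_unit q e₁),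
    delPrime_mul_primeProd_of_mem hE (prime_not_dvd_unit_mul_prime hql e₂),
    delPrime_mul_primeProd_of_notMem hP (prime_not_dvd_unit_mul_prime hql e₃), add_zero]

theorem delPrime_ternaryClass_of_mem_right (hql : q ≠ l) (hE : q ∉ E) (hP : q ∈ P) :
    delPrime q (ternaryClass e₁ e₂ e₃ l E P) =
      unary₀ ((e₃ * (l : ℕ) * primeProd (P.erase q) : ℤ) : ZMod q) := by
  rw [ternaryClass, map_add, map_add,
    delPrime_mul_primeProd_of_notMem hE (prime_not_dvd_unit q e₁),
    delPrime_mul_primeProd_of_notMem hE (prime_not_dvd_unit_mul_prime hql e₂),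
    delPrime_mul_primeProd_of_mem hP (prime_not_dvd_unit_mul_prime hql e₃), zero_add, zero_add]

theorem delPrime_ternaryClass_of_notMem (hql : q ≠ l) (hE : q ∉ E) (hP : q ∉ P) :
    delPrime q (ternaryClass e₁ e₂ e₃ l E P) = 0 := by
  rw [ternaryClass, map_add, map_add,
    delPrime_mul_primeProd_of_notMem hE (prime_not_dvd_unit q e₁),
    delPrime_mul_primeProd_of_notMem hE (prime_not_dvd_unit_mul_prime hql e₂),
    delPrime_mul_primeProd_of_notMem hP (prime_not_dvd_unit_mul_prime hql e₃), add_zero, add_zero]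

theorem isSquare_unit_of_mod_four_eq_one (hl : (l : ℕ) % 4 = 1) (e : ℤˣ) :
    IsSquare ((e : ℤ) : ZMod l) := by
  rcases Int.units_eq_one_or e with rfl | rfl
  · simp
  · simpa using ZMod.exists_sq_eq_neg_one_iff.2 (show (l : ℕ) % 4 ≠ 3 by omega)

theorem delPrime_ternaryClass_self (hl : (l : ℕ) % 4 = 1) (hE : l ∉ E) (hP : l ∉ P)
    (h : IsSquare ((primeProd E * primeProd P : ℤ) : ZMod l)) :
    delPrime l (ternaryClass e₁ e₂ e₃ l E P) = 0 := by
  have hne {S : Finset Nat.Primes} (hS : l ∉ S) (e : ℤˣ) :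
      ¬ ((l : ℕ) : ℤ) ∣ e * primeProd S := prime_not_dvd_mul_primeProd hS (prime_not_dvd_unit l e)
  have hcast {n : ℤ} (hn : ¬ ((l : ℕ) : ℤ) ∣ n) : (n : ZMod l) ≠ 0 := by
    rwa [Ne, ZMod.intCast_zmod_eq_zero_iff_dvd]
  rw [ternaryClass, map_add, map_add, delPrime_unary₀_of_not_dvd (hne hE e₁), zero_add,
    mul_comm (e₂ : ℤ), mul_comm (e₃ : ℤ), mul_assoc, mul_assoc, delPrime_unary₀_mul (hne hE e₂),
    delPrime_unary₀_mul (hne hP e₃),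
    unary₀_add_eq_zero_iff (hcast (hne hE e₂)) (hcast (hne hP e₃))]
  have hsq := (isSquare_unit_of_mod_four_eq_one hl (-(e₂ * e₃))).mul h
  rw [← Int.cast_mul] at hsq
  have heq : -((e₂ * primeProd E) * (e₃ * primeProd P)) =
      (-(e₂ * e₃) : ℤˣ) * (primeProd E * primeProd P) := by
    rw [Units.val_neg, Units.val_mul]
    ring
  rwa [← Int.cast_mul, ← Int.cast_neg, heq]

theorem exists_ternaryClass_del_eq (x : WittGroup ℚ) (e₁ e₂ e₃ : ℤˣ) :
    ∃ l E P, del (ternaryClass e₁ e₂ e₃ l E P) = del x := by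
  classical
  let S : Finset Nat.Primes := insert primeTwo (finite_delPrime_ne_zero x).toFinset
  have hS (p : Nat.Primes) : p ∈ S ↔ p = primeTwo ∨ delPrime p x ≠ 0 :=
    Finset.mem_insert.trans (or_congr_right (Set.Finite.mem_toFinset _))
  let P := S.filter fun p : Nat.Primes => rankParity (delPrime p x) = 1
  let E := S.filter fun p : Nat.Primes => ¬ rankParity (delPrime p x) = 1
  have hz (p : Nat.Primes) (hp : p ∈ S) := exists_residue_multiplier x e₁ e₂ e₃ E P ((hS p).1 hp)
  choose! z hz0 hzP hzE using hz
  obtain ⟨l, hl4, hlz, hsq⟩ := exists_prime_isSquare_primeProd ((hS _).2 (Or.inl rfl)) z hz0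
  have hlS : l ∉ S := fun h => hz0 l h (by rw [← hlz l h, ZMod.natCast_self])
  refine ⟨l, E, P, del_eq_iff.2 fun q => ?_⟩
  by_cases hqS : q ∈ S
  · have hql : q ≠ l := fun h => hlS (h ▸ hqS)
    by_cases hq : rankParity (delPrime q x) = 1
    · have hqE : q ∉ E := fun h => (Finset.mem_filter.1 h).2 hq
      have hqP : q ∈ P := Finset.mem_filter.2 ⟨hqS, hq⟩
      rw [delPrime_ternaryClass_of_mem_right hql hqE hqP, ← hzP q hqS hq, ← hlz q hqS]
      push_cast
      rw [mul_right_comm]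
    · have hqE : q ∈ E := Finset.mem_filter.2 ⟨hqS, hq⟩
      have hqP : q ∉ P := fun h => hq (Finset.mem_filter.1 h).2
      rw [delPrime_ternaryClass_of_mem_left hql hqE hqP, ← hzE q hqS hq, ← hlz q hqS]
      push_cast
      rw [mul_right_comm]
  · have hqE : q ∉ E := fun h => hqS (Finset.mem_filter.1 h).1
    have hqP : q ∉ P := fun h => hqS (Finset.mem_filter.1 h).1
    have hx0 : delPrime q x = 0 := not_not.1 fun h => hqS ((hS q).2 (Or.inr h))
    rw [hx0]
    by_cases hql : q = l
    · subst hql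
      refine delPrime_ternaryClass_self hl4 hqE hqP ?_
      have hEP : primeProd E * primeProd P = primeProd S :=
        (mul_comm _ _).trans (Finset.prod_filter_mul_prod_filter_not S _ _)
      rwa [hEP]
    · exact delPrime_ternaryClass_of_notMem hql hqE hqP

theorem exists_unary₀_eq_unary_of_pos (e : ℤˣ) {n : ℤ} (hn : 0 < n) :
    ∃ a : ℚˣ, unary₀ ((e * n : ℤ) : ℚ) = mk (SymForm.unary a) ∧
      (SymForm.unary a).signature = e := by
  have hne : ((e * n : ℤ) : ℚ) ≠ 0 := by exact_mod_cast mul_ne_zero e.ne_zero hn.ne'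
  refine ⟨Units.mk0 _ hne, unary₀_of_ne hne, ?_⟩
  rw [SymForm.signature_unary, Units.val_mk0, sign_intCast, sign_mul, sign_pos hn, mul_one]
  rcases Int.units_eq_one_or e with rfl | rfl <;> rfl

theorem exists_rank_three (x : WittGroup ℚ) (e₁ e₂ e₃ : ℤˣ) :
    ∃ A : SymForm ℚ, del (mk A) = del x ∧ A.rank = 3 ∧ A.signature = e₁ + e₂ + e₃ := by
  obtain ⟨l, E, P, h⟩ := exists_ternaryClass_del_eq x e₁ e₂ e₃
  have hl : (0 : ℤ) < (l : ℕ) := by exact_mod_cast l.2.pos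
  obtain ⟨a, ha, hsa⟩ := exists_unary₀_eq_unary_of_pos e₁ (primeProd_pos E)
  obtain ⟨b, hb, hsb⟩ := exists_unary₀_eq_unary_of_pos e₂ (mul_pos hl (primeProd_pos E))
  obtain ⟨c, hc, hsc⟩ := exists_unary₀_eq_unary_of_pos e₃ (mul_pos hl (primeProd_pos P))
  rw [ternaryClass, mul_assoc (e₂ : ℤ), mul_assoc (e₃ : ℤ), ha, hb, hc] at h
  refine ⟨((SymForm.unary a).sum (SymForm.unary b)).sum (SymForm.unary c), h, ?_, ?_⟩
  · simp only [SymForm.rank_sum, SymForm.rank_unary]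
  · simp only [SymForm.signature_sum, hsa, hsb, hsc]

end Ternary

namespace SymForm

/-- `A` is definite with the sign of `e`: positive definite for `e = 1` and negative definite for
`e = -1`. -/
def IsDefinite (A : SymForm ℚ) (e : ℚˣ) : Prop := ∀ x, x ≠ 0 → 0 < e * A.form x x

/-- `A` stays anisotropic when either of the forms `⟨1⟩` and `⟨-1⟩`, the unimodular forms of rank
one over `ℤ`, is added to it. -/
def IsStable (A : SymForm ℚ) : Prop :=
  (A.sum (unary 1)).Anisotropic ∧ (A.sum (unary (-1))).Anisotropic

theorem IsDefinite.anisotropic {A : SymForm ℚ} {e : ℚˣ} (h : A.IsDefinite e) :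
    A.Anisotropic := fun x hx => by
  by_contra hx0
  have := h x hx0
  rw [hx, mul_zero] at this
  exact this.false

theorem IsDefinite.sum_unary {A : SymForm ℚ} {e : ℚˣ} (h : A.IsDefinite e) :
    (A.sum (unary e)).IsDefinite e := by
  rintro ⟨x, (t : ℚ)⟩ hxt
  change 0 < (e : ℚ) * (A.form x x + e * (t * t))
  rw [mul_add, show (e : ℚ) * (e * (t * t)) = (e * t) * (e * t) by ring]
  by_cases hx : x = 0
  · subst hx
    have ht : t ≠ 0 := by rintro rfl; exact hxt rfl
    rw [map_zero, mul_zero, zero_add]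
    exact mul_self_pos.2 (mul_ne_zero e.ne_zero ht)
  · exact add_pos_of_pos_of_nonneg (h x hx) (mul_self_nonneg _)

theorem isDefinite_or_isDefinite_of_rank_le_one {A : SymForm ℚ} (h : A.rank ≤ 1) :
    A.IsDefinite 1 ∨ A.IsDefinite (-1) := by
  obtain ⟨v, hv⟩ := finrank_le_one_iff.1 h
  have hform (c : ℚ) : A.form (c • v) (c • v) = c * c * A.form v v := by
    rw [LinearMap.map_smul₂, map_smul, smul_eq_mul, smul_eq_mul, mul_assoc]
  have hc {c : ℚ} (h : c • v ≠ 0) : 0 < c * c := mul_self_pos.2 (left_ne_zero_of_smul h)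
  rcases lt_trichotomy (A.form v v) 0 with hlt | h0 | hgt
  · refine Or.inr fun w hw => ?_
    obtain ⟨c, rfl⟩ := hv w
    rw [hform, Units.val_neg, Units.val_one]
    nlinarith [hc hw]
  · have hv0 : v = 0 := A.nondeg.1 v fun w => by
      obtain ⟨c, rfl⟩ := hv w
      rw [map_smul, h0, smul_zero]
    refine Or.inl fun w hw => absurd ?_ hw
    obtain ⟨c, rfl⟩ := hv w
    rw [hv0, smul_zero]
  · refine Or.inl fun w hw => ?_
    obtain ⟨c, rfl⟩ := hv w
    rw [hform, Units.val_one, one_mul]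
    exact mul_pos (hc hw) hgt

theorem not_anisotropic_sum_unary_sum_unary_neg {F : Type} [Field F] (A : SymForm F) (a : Fˣ) :
    ¬ ((A.sum (unary a)).sum (unary (-a))).Anisotropic := fun h => by
  have h0 : (((0 : A.V), (1 : F)), (1 : F)) = 0 := h _ (by
    change (A.form 0 0 + (a : F) * (1 * 1)) + ((-a : Fˣ) : F) * (1 * 1) = 0
    rw [map_zero, Units.val_neg]
    ring)
  exact one_ne_zero (congrArg Prod.snd h0)

theorem not_isStable_sum_unary (A : SymForm ℚ) {e : ℚˣ} (he : e = 1 ∨ e = -1) :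
    ¬ (A.sum (unary e)).IsStable := fun h => by
  have := not_anisotropic_sum_unary_sum_unary_neg A e
  rcases he with rfl | rfl
  · exact this h.2
  · exact this ((neg_neg (1 : ℚˣ)).symm ▸ h.1)

end SymForm

section WittSpan

open WittGroup

theorem del_sum_unary (A : SymForm ℚ) {e : ℚˣ} (he : e = 1 ∨ e = -1) :
    del (mk (A.sum (SymForm.unary e))) = del (mk A) := by
  obtain ⟨ε, hε⟩ : ∃ ε : ℤˣ, (e : ℚ) = ((ε : ℤ) : ℚ) := by
    rcases he with rfl | rfl
    · exact ⟨1, by simp⟩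
    · exact ⟨-1, by simp⟩
  have hunit : del (WittGroup.unary e) = 0 := del_eq_zero_iff.2 fun p => by
    rw [← unary₀_units, hε]
    exact delPrime_unary₀_of_not_dvd (prime_not_dvd_unit p ε)
  rw [mk_sum, map_add]
  exact (congrArg _ hunit).trans (add_zero _)

theorem exists_rank_eq_wittSpan (x : WittGroup ℚ) :
    ∃ A : SymForm ℚ, del (mk A) = del x ∧ A.rank = wittSpan x :=
  Nat.sInf_mem (s := {n | ∃ A : SymForm ℚ, del (mk A) = del x ∧ A.rank = n}) <| by
    induction x using WittGroup.ind with
    | _ B => exact ⟨B.rank, B, rfl, rfl⟩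

theorem wittSpan_le {x : WittGroup ℚ} {A : SymForm ℚ} (h : del (mk A) = del x) :
    wittSpan x ≤ A.rank := Nat.sInf_le ⟨A, h, rfl⟩

theorem wittSpan_eq_zero_iff (x : WittGroup ℚ) : wittSpan x = 0 ↔ del x = 0 := by
  constructor <;> intro h
  · obtain ⟨A, hA, hr⟩ := exists_rank_eq_wittSpan x
    rw [← hA, SymForm.mk_eq_zero_of_rank_eq_zero (hr.trans h), map_zero]
  · have := wittSpan_le (x := x) (A := SymForm.zero) (by rw [h, mk_zero, map_zero])
    rwa [SymForm.rank_zero, Nat.le_zero] at this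

theorem anisotropic_of_rank_le_wittSpan_add_one {x : WittGroup ℚ} {A : SymForm ℚ}
    (h : del (mk A) = del x) (hr : A.rank ≤ wittSpan x + 1) : A.Anisotropic := by
  by_contra hA
  obtain ⟨C, hC, hmk⟩ := SymForm.exists_mk_eq_of_not_anisotropic two_ne_zero A hA
  have := wittSpan_le (hmk ▸ h)
  omega

variable {B A : SymForm ℚ} {r : ℕ} {i : ℤ}

theorem signature_mem_signatureSet (h : del (mk A) = del (mk B))
    (hr : A.rank ≤ wittSpan (mk B) + 1) : A.signature ∈ signatureSet B A.rank :=
  ⟨A, rfl, anisotropic_of_rank_le_wittSpan_add_one h hr, h, rfl⟩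

theorem signatureSet_wittSpan_nonempty (B : SymForm ℚ) :
    (signatureSet B (wittSpan (mk B))).Nonempty := by
  obtain ⟨A, hA, hr⟩ := exists_rank_eq_wittSpan (mk B)
  exact ⟨A.signature, hr ▸ signature_mem_signatureSet hA (by omega)⟩

theorem wittSpan_le_of_signatureSet_nonempty (h : (signatureSet B r).Nonempty) :
    wittSpan (mk B) ≤ r := by
  obtain ⟨i, A, rfl, -, hA, -⟩ := h
  exact wittSpan_le hA

theorem IsPreimageForm.isStable (h : IsPreimageForm B r i A) (hr : r = wittSpan (mk B)) :
    A.IsStable := by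
  obtain ⟨rfl, -, hA, -⟩ := h
  constructor
  · exact anisotropic_of_rank_le_wittSpan_add_one ((del_sum_unary A (Or.inl rfl)).trans hA)
      (by rw [SymForm.rank_sum, SymForm.rank_unary, hr])
  · exact anisotropic_of_rank_le_wittSpan_add_one ((del_sum_unary A (Or.inr rfl)).trans hA)
      (by rw [SymForm.rank_sum, SymForm.rank_unary, hr])

theorem exists_isDefinite_rank_add {e : ℚˣ} (hA : A.IsDefinite e)
    (he : e = 1 ∨ e = -1) (n : ℕ) :
    ∃ C : SymForm ℚ, C.rank = A.rank + n ∧ C.IsDefinite e ∧ del (mk C) = del (mk A) := by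
  induction n with
  | zero => exact ⟨A, rfl, hA, rfl⟩
  | succ n ih =>
    obtain ⟨C, hr, hC, hdel⟩ := ih
    refine ⟨C.sum (SymForm.unary e), ?_, hC.sum_unary, (del_sum_unary C he).trans hdel⟩
    rw [SymForm.rank_sum, SymForm.rank_unary, hr, add_assoc]

theorem exists_not_isStable_of_wittSpan_le_one (h1 : wittSpan (mk B) ≤ 1)
    (hr : wittSpan (mk B) < r) : ∃ i A, IsPreimageForm B r i A ∧ ¬ A.IsStable := by
  obtain ⟨A, hA, hAr⟩ := exists_rank_eq_wittSpan (mk B)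
  obtain ⟨e, he, hAe⟩ : ∃ e : ℚˣ, (e = 1 ∨ e = -1) ∧ A.IsDefinite e := by
    rcases SymForm.isDefinite_or_isDefinite_of_rank_le_one (hAr.le.trans h1) with h | h
    · exact ⟨1, Or.inl rfl, h⟩
    · exact ⟨-1, Or.inr rfl, h⟩
  obtain ⟨C, hCr, hCe, hC⟩ :=
    exists_isDefinite_rank_add hAe he (r - 1 - wittSpan (mk B))
  refine ⟨_, C.sum (SymForm.unary e), ⟨?_, hCe.sum_unary.anisotropic,
    (del_sum_unary C he).trans (hC.trans hA), rfl⟩, SymForm.not_isStable_sum_unary C he⟩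
  rw [SymForm.rank_sum, SymForm.rank_unary]
  omega

theorem exists_not_isStable_wittSpan_add_one (B : SymForm ℚ) :
    ∃ i A, IsPreimageForm B (wittSpan (mk B) + 1) i A ∧ ¬ A.IsStable := by
  obtain ⟨A, hA, hr⟩ := exists_rank_eq_wittSpan (mk B)
  have hdel := (del_sum_unary A (Or.inl rfl)).trans hA
  have hrank : (A.sum (SymForm.unary 1)).rank = wittSpan (mk B) + 1 := by
    rw [SymForm.rank_sum, SymForm.rank_unary, hr]
  exact ⟨_, _, ⟨hrank, anisotropic_of_rank_le_wittSpan_add_one hdel hrank.le, hdel, rfl⟩,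
    SymForm.not_isStable_sum_unary A (Or.inl rfl)⟩

theorem wittSpan_eq_one_iff : wittSpan (mk B) = 1 ↔
    (signatureSet B 1).Nonempty ∧ del (mk B) ≠ 0 := by
  rw [Ne, ← wittSpan_eq_zero_iff]
  constructor
  · intro h
    exact ⟨h ▸ signatureSet_wittSpan_nonempty B, by omega⟩
  · rintro ⟨hne, h0⟩
    have := wittSpan_le_of_signatureSet_nonempty hne
    omega

theorem wittSpan_eq_two_iff : wittSpan (mk B) = 2 ↔
    (signatureSet B 2).Nonempty ∧
      ∀ i ∈ signatureSet B 2, ∀ A : SymForm ℚ, IsPreimageForm B 2 i A → A.IsStable := by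
  constructor
  · intro h
    exact ⟨h ▸ signatureSet_wittSpan_nonempty B, fun i _ A hA => hA.isStable h.symm⟩
  · rintro ⟨hne, hst⟩
    have hle := wittSpan_le_of_signatureSet_nonempty hne
    by_contra h2
    obtain ⟨i, A, hA, hAst⟩ := exists_not_isStable_of_wittSpan_le_one (B := B) (r := 2)
      (by omega) (by omega)
    exact hAst (hst i ⟨A, hA⟩ A hA)

theorem abs_le_and_even_of_mem_signatureSet (h : i ∈ signatureSet B r) :
    |i| ≤ r ∧ Even ((r : ℤ) + i) := by
  obtain ⟨A, rfl, -, -, rfl⟩ := h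
  exact ⟨A.abs_signature_le_rank, A.even_rank_add_signature⟩

theorem signatureSet_two_subset : signatureSet B 2 ⊆ {0, 2, -2} := fun i hi => by
  obtain ⟨hle, k, hk⟩ := abs_le_and_even_of_mem_signatureSet hi
  rw [abs_le] at hle
  simp only [Set.mem_insert_iff, Set.mem_singleton_iff]
  omega

theorem signatureSet_three_subset : signatureSet B 3 ⊆ {1, -1, 3, -3} := fun i hi => by
  obtain ⟨hle, k, hk⟩ := abs_le_and_even_of_mem_signatureSet hi
  rw [abs_le] at hle
  simp only [Set.mem_insert_iff, Set.mem_singleton_iff]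
  omega

theorem signatureSet_three_eq (h : 2 ≤ wittSpan (mk B)) :
    signatureSet B 3 = {1, -1, 3, -3} := by
  refine signatureSet_three_subset.antisymm ?_
  have hmem (e₁ e₂ e₃ : ℤˣ) : (e₁ + e₂ + e₃ : ℤ) ∈ signatureSet B 3 := by
    obtain ⟨A, hA, hr, hs⟩ := exists_rank_three (mk B) e₁ e₂ e₃
    rw [← hs, ← hr]
    exact signature_mem_signatureSet hA (by omega)
  rintro i (rfl | rfl | rfl | rfl)
  · exact hmem 1 1 (-1)
  · exact hmem 1 (-1) (-1)
  · exact hmem 1 1 1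
  · exact hmem (-1) (-1) (-1)

theorem wittSpan_eq_three_iff : wittSpan (mk B) = 3 ↔
    signatureSet B 3 = {1, -1, 3, -3} ∧
      ∀ i ∈ signatureSet B 3, ∀ A : SymForm ℚ, IsPreimageForm B 3 i A → A.IsStable := by
  constructor
  · intro h
    exact ⟨signatureSet_three_eq (by omega), fun i _ A hA => hA.isStable h.symm⟩
  · rintro ⟨hset, hst⟩
    have hle := wittSpan_le_of_signatureSet_nonempty (B := B) (r := 3) ⟨1, by rw [hset]; simp⟩
    by_contra h3
    obtain ⟨i, A, hA, hAst⟩ : ∃ i A, IsPreimageForm B 3 i A ∧ ¬ A.IsStable := by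
      rcases Nat.lt_or_ge 1 (wittSpan (mk B)) with h | h
      · rw [show 3 = wittSpan (mk B) + 1 by omega]
        exact exists_not_isStable_wittSpan_add_one B
      · exact exists_not_isStable_of_wittSpan_le_one h (by omega)
    exact hAst (hst i ⟨A, hA⟩ A hA)

end WittSpan

section ScaledNorm

open WittGroup

/-- The Witt class of the binary form `n⟨1, d⟩`, that is, of `n` times the norm form of
`ℚ(√-d)`. -/
def scaledNormClass (d n : ℤ) : WittGroup ℚ := unary₀ (n : ℚ) + unary₀ ((d * n : ℤ) : ℚ)

/-- For squarefree `n` and a prime `q` not dividing `d`: the residue of `n⟨1, d⟩` at `q` is the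
nonzero class of even rank with the determinant of `⟨1, d⟩`. -/
def HasEvenResidue (d n : ℤ) (q : ℕ) : Prop := (q : ℤ) ∣ n ∧ ¬ IsSquare ((-d : ℤ) : ZMod q)

section

variable {p : ℕ} [hp : Fact p.Prime] {d d' n n' : ℤ}

theorem not_dvd_mul_of_not_dvd (hd : ¬ (p : ℤ) ∣ d) (hn : ¬ (p : ℤ) ∣ n) : ¬ (p : ℤ) ∣ d * n :=
  fun h => ((Nat.prime_iff_prime_int.1 hp.1).dvd_or_dvd h).elim hd hn

theorem intCast_ne_zero_of_not_dvd (h : ¬ (p : ℤ) ∣ n) : (n : ZMod p) ≠ 0 :=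
  mt (ZMod.intCast_zmod_eq_zero_iff_dvd n p).1 h

theorem delPrime_scaledNormClass_of_not_dvd (hd : ¬ (p : ℤ) ∣ d) (hn : ¬ (p : ℤ) ∣ n) :
    delPrime p (scaledNormClass d n) = 0 := by
  rw [scaledNormClass, map_add, delPrime_unary₀_of_not_dvd hn,
    delPrime_unary₀_of_not_dvd (not_dvd_mul_of_not_dvd hd hn), add_zero]

theorem delPrime_scaledNormClass_mul (hd : ¬ (p : ℤ) ∣ d) (hn : ¬ (p : ℤ) ∣ n) :
    delPrime p (scaledNormClass d (p * n)) =
      unary₀ (n : ZMod p) + unary₀ ((d * n : ℤ) : ZMod p) := by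
  rw [scaledNormClass, map_add, delPrime_unary₀_mul hn, mul_left_comm,
    delPrime_unary₀_mul (not_dvd_mul_of_not_dvd hd hn)]

theorem delPrime_unit_mul_scaledNormClass (e : ℤˣ) (hn : ¬ (p : ℤ) ∣ n) :
    delPrime p (scaledNormClass (e * p) n) = unary₀ ((e * n : ℤ) : ZMod p) := by
  have he : ¬ (p : ℤ) ∣ e :=
    (Nat.prime_iff_prime_int.1 hp.1).irreducible.not_dvd_isUnit e.isUnit
  rw [scaledNormClass, map_add, delPrime_unary₀_of_not_dvd hn, zero_add, mul_comm (e : ℤ),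
    mul_assoc, delPrime_unary₀_mul (not_dvd_mul_of_not_dvd he hn)]

theorem isSquare_neg_mul_iff (hn : ¬ (p : ℤ) ∣ n) :
    IsSquare (-((n : ZMod p) * ((d * n : ℤ) : ZMod p))) ↔ IsSquare ((-d : ℤ) : ZMod p) := by
  have hn0 := intCast_ne_zero_of_not_dvd hn
  have h : -((n : ZMod p) * ((d * n : ℤ) : ZMod p)) = ((-d : ℤ) : ZMod p) * (n * n) := by
    push_cast
    ring
  refine ⟨fun hs => ?_, fun hs => h ▸ hs.mul (IsSquare.mul_self _)⟩
  rw [← mul_div_cancel_right₀ ((-d : ℤ) : ZMod p) (mul_ne_zero hn0 hn0), ← h]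
  exact hs.div (IsSquare.mul_self _)

theorem delPrime_scaledNormClass_eq_zero_iff (hd : ¬ (p : ℤ) ∣ d) (hn : Squarefree n) :
    delPrime p (scaledNormClass d n) = 0 ↔ ¬ HasEvenResidue d n p := by
  by_cases h : (p : ℤ) ∣ n
  · obtain ⟨m, rfl⟩ := h
    have hm := not_dvd_of_squarefree_mul hn
    rw [delPrime_scaledNormClass_mul hd hm,
      unary₀_add_eq_zero_iff (intCast_ne_zero_of_not_dvd hm)
        (intCast_ne_zero_of_not_dvd (not_dvd_mul_of_not_dvd hd hm)), isSquare_neg_mul_iff hm,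
      HasEvenResidue, and_iff_right (dvd_mul_right _ _), not_not]
  · exact iff_of_true (delPrime_scaledNormClass_of_not_dvd hd h) fun hr => h hr.1

theorem HasEvenResidue.ne_two (h : HasEvenResidue d n p) : p ≠ 2 := by
  rintro rfl
  exact h.2 (FiniteField.isSquare_of_char_two (ZMod.ringChar_zmod_n 2) _)

theorem HasEvenResidue.exists_eq (h : HasEvenResidue d n p) (hd : ¬ (p : ℤ) ∣ d)
    (hn : Squarefree n) : ∃ a b : ZMod p,
      delPrime p (scaledNormClass d n) = unary₀ a + unary₀ b ∧ ¬ IsSquare (-(a * b)) := by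
  obtain ⟨⟨m, rfl⟩, hsq⟩ := h
  have hm := not_dvd_of_squarefree_mul hn
  exact ⟨_, _, delPrime_scaledNormClass_mul hd hm, mt (isSquare_neg_mul_iff hm).1 hsq⟩

theorem delPrime_scaledNormClass_eq_iff (hd : ¬ (p : ℤ) ∣ d) (hd' : ¬ (p : ℤ) ∣ d')
    (hn : Squarefree n) (hn' : Squarefree n') :
    delPrime p (scaledNormClass d n) = delPrime p (scaledNormClass d' n') ↔
      (HasEvenResidue d n p ↔ HasEvenResidue d' n' p) := by
  constructor
  · intro h
    rw [← not_iff_not, ← delPrime_scaledNormClass_eq_zero_iff hd hn,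
      ← delPrime_scaledNormClass_eq_zero_iff hd' hn', h]
  · intro h
    by_cases hr : HasEvenResidue d n p
    · obtain ⟨a, b, hab, hsq⟩ := hr.exists_eq hd hn
      obtain ⟨a', b', hab', hsq'⟩ := (h.1 hr).exists_eq hd' hn'
      have hchar : ringChar (ZMod p) ≠ 2 := by
        rw [ZMod.ringChar_zmod_n]
        exact hr.ne_two
      rw [hab, hab', unary₀_add_unary₀_eq_of_not_isSquare hchar hsq hsq']
    · rw [(delPrime_scaledNormClass_eq_zero_iff hd hn).2 hr,
        (delPrime_scaledNormClass_eq_zero_iff hd' hn').2 (mt h.2 hr)]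

end

theorem del_scaledNormClass_eq_iff {N : Nat.Primes} {n m : ℤ} {ε e : ℤˣ}
    (hn : Squarefree ((N : ℕ) * n : ℤ)) (hm : Squarefree ((N : ℕ) * m : ℤ)) :
    del (scaledNormClass (ε * (N : ℕ)) n) = del (scaledNormClass (e * (N : ℕ)) m) ↔
      IsSquare (((ε * n) * (e * m) : ℤ) : ZMod N) ∧ ∀ q : Nat.Primes, q ≠ N →
        (HasEvenResidue (ε * (N : ℕ)) n q ↔ HasEvenResidue (e * (N : ℕ)) m q) := by
  have hself : delPrime N (scaledNormClass (ε * (N : ℕ)) n) =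
      delPrime N (scaledNormClass (e * (N : ℕ)) m) ↔
        IsSquare (((ε * n) * (e * m) : ℤ) : ZMod N) := by
    have hNn := not_dvd_of_squarefree_mul hn
    have hNm := not_dvd_of_squarefree_mul hm
    rw [delPrime_unit_mul_scaledNormClass ε hNn, delPrime_unit_mul_scaledNormClass e hNm,
      unary₀_eq_iff
        (intCast_ne_zero_of_not_dvd (not_dvd_mul_of_not_dvd (prime_not_dvd_unit N ε) hNn))
        (intCast_ne_zero_of_not_dvd (not_dvd_mul_of_not_dvd (prime_not_dvd_unit N e) hNm)),
      Int.cast_mul (ε * n)]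
  have hne {q : Nat.Primes} (hq : q ≠ N) :
      delPrime q (scaledNormClass (ε * (N : ℕ)) n) =
        delPrime q (scaledNormClass (e * (N : ℕ)) m) ↔
          (HasEvenResidue (ε * (N : ℕ)) n q ↔ HasEvenResidue (e * (N : ℕ)) m q) :=
    delPrime_scaledNormClass_eq_iff (prime_not_dvd_unit_mul_prime hq ε)
      (prime_not_dvd_unit_mul_prime hq e) hn.of_mul_right hm.of_mul_right
  rw [del_eq_iff]
  constructor
  · exact fun h => ⟨hself.1 (h N), fun q hq => (hne hq).1 (h q)⟩
  · rintro ⟨hN, h⟩ q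
    by_cases hq : q = N
    · exact hq ▸ hself.2 hN
    · exact (hne hq).2 (h q hq)

end ScaledNorm

section Binary

open WittGroup

theorem exists_squarefree_of_rank_eq_two {A : SymForm ℚ} (hA : A.rank = 2) :
    ∃ a b : ℤ, Squarefree a ∧ Squarefree b ∧ mk A = unary₀ (a : ℚ) + unary₀ (b : ℚ) ∧
      A.signature = a.sign + b.sign := by
  obtain ⟨u, A', hAA', hA'⟩ := SymForm.exists_iso_unary_sum two_ne_zero hA
  obtain ⟨v, A'', hAA'', hA''⟩ := SymForm.exists_iso_unary_sum two_ne_zero hA'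
  obtain ⟨a, ha, hua, hsa⟩ := exists_squarefree_unary_eq u
  obtain ⟨b, hb, hvb, hsb⟩ := exists_squarefree_unary_eq v
  have hs0 : A''.signature = 0 := by
    simpa [hA''] using A''.abs_signature_le_rank
  refine ⟨a, b, ha, hb, ?_, ?_⟩
  · rw [mk_eq hAA'.wittEquiv, mk_sum, mk_eq hAA''.wittEquiv, mk_sum,
      SymForm.mk_eq_zero_of_rank_eq_zero hA'', add_zero, ← hua, ← hvb]
    rfl
  · rw [hAA'.signature_eq, SymForm.signature_sum, hAA''.signature_eq, SymForm.signature_sum, hs0,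
      add_zero, SymForm.signature_unary, SymForm.signature_unary, hsa, hsb, Int.sign_eq_sign,
      Int.sign_eq_sign]

theorem sign_unit_mul_natCast_mul (ε : ℤˣ) {N : ℕ} (hN : 0 < N) (n : ℤ) :
    (ε * N * n : ℤ).sign = ε * n.sign := by
  rw [Int.sign_mul, Int.sign_mul, Int.sign_natCast_of_ne_zero hN.ne', mul_one]
  rcases Int.units_eq_one_or ε with rfl | rfl <;> rfl

theorem exists_mk_eq_scaledNormClass {n : ℤ} (hn : n ≠ 0) (N : Nat.Primes) (ε : ℤˣ) :
    ∃ A : SymForm ℚ, A.rank = 2 ∧ mk A = scaledNormClass (ε * (N : ℕ)) n ∧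
      A.signature = n.sign * (1 + ε) := by
  have ha : (n : ℚ) ≠ 0 := by exact_mod_cast hn
  have hb : ((ε * (N : ℕ) * n : ℤ) : ℚ) ≠ 0 := by
    exact_mod_cast mul_ne_zero (mul_ne_zero ε.ne_zero (by exact_mod_cast N.2.ne_zero)) hn
  refine ⟨(SymForm.unary (Units.mk0 _ ha)).sum (SymForm.unary (Units.mk0 _ hb)), ?_, ?_, ?_⟩
  · simp only [SymForm.rank_sum, SymForm.rank_unary]
  · rw [scaledNormClass, unary₀_of_ne ha, unary₀_of_ne hb]
    rfl
  · rw [SymForm.signature_sum, SymForm.signature_unary, SymForm.signature_unary, Units.val_mk0,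
      Units.val_mk0, sign_intCast, sign_intCast, ← Int.sign_eq_sign, ← Int.sign_eq_sign,
      sign_unit_mul_natCast_mul ε N.2.pos]
    ring

theorem exists_unit_mul_eq {a b : ℤ} (ha : Squarefree a) (hb : Squarefree b)
    (h : ∀ q : Nat.Primes, ((q : ℕ) : ℤ) ∣ a ↔ ((q : ℕ) : ℤ) ∣ b) : ∃ ε : ℤˣ, b = ε * a := by
  have habs : a.natAbs = b.natAbs := by
    refine (Nat.Squarefree.ext_iff (Int.squarefree_natAbs.2 ha) (Int.squarefree_natAbs.2 hb)).2
      fun q hq => ?_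
    rw [← Int.natCast_dvd, ← Int.natCast_dvd]
    exact h ⟨q, hq⟩
  obtain ⟨ε, hε⟩ := Int.associated_iff_natAbs.2 habs
  exact ⟨ε, by rw [← hε, mul_comm]⟩

theorem exists_unit_mul_prime_mul_eq {N : Nat.Primes} {a b : ℤ} (ha : Squarefree a)
    (hb : Squarefree b) (hNb : ((N : ℕ) : ℤ) ∣ b)
    (h : ∀ q : Nat.Primes, (((q : ℕ) : ℤ) ∣ a ↔ ((q : ℕ) : ℤ) ∣ b) ↔ q ≠ N) :
    ∃ ε : ℤˣ, Squarefree ((N : ℕ) * a : ℤ) ∧ b = ε * (N : ℕ) * a := by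
  have hNa : ¬ ((N : ℕ) : ℤ) ∣ a := fun hNa => (h N).1 (iff_of_true hNa hNb) rfl
  obtain ⟨k, rfl⟩ := hNb
  have hk : ∀ q : Nat.Primes, ((q : ℕ) : ℤ) ∣ a ↔ ((q : ℕ) : ℤ) ∣ k := fun q => by
    by_cases hq : q = N
    · subst hq
      exact iff_of_false hNa (not_dvd_of_squarefree_mul hb)
    · rw [(h q).2 hq, (Nat.prime_iff_prime_int.1 q.2).dvd_mul, prime_intCast_dvd_iff,
        or_iff_right hq]
  obtain ⟨ε, rfl⟩ := exists_unit_mul_eq ha hb.of_mul_right hk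
  refine ⟨ε, ?_, by ring⟩
  rw [mul_left_comm] at hb
  exact hb.of_mul_right

theorem dvd_iff_dvd_iff_of_delPrime_eq {p : ℕ} [Fact p.Prime] {a b a' b' : ℤ}
    (ha : Squarefree a) (hb : Squarefree b) (ha' : Squarefree a') (hb' : Squarefree b')
    (h : delPrime p (unary₀ (a : ℚ) + unary₀ (b : ℚ)) =
      delPrime p (unary₀ (a' : ℚ) + unary₀ (b' : ℚ))) :
    ((p : ℤ) ∣ a ↔ (p : ℤ) ∣ b) ↔ ((p : ℤ) ∣ a' ↔ (p : ℤ) ∣ b') := by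
  have hpar := congrArg rankParity h
  simp only [map_add, rankParity_delPrime_unary₀, ha, hb, ha', hb'] at hpar
  split_ifs at hpar <;> simp_all

theorem prime_dvd_iff_dvd_iff_ne {N : Nat.Primes} {m : ℤ} (e : ℤˣ)
    (hm : Squarefree ((N : ℕ) * m : ℤ)) (q : Nat.Primes) :
    (((q : ℕ) : ℤ) ∣ m ↔ ((q : ℕ) : ℤ) ∣ e * (N : ℕ) * m) ↔ q ≠ N := by
  rw [mul_assoc, (Nat.prime_iff_prime_int.1 q.2).dvd_mul, or_iff_right (prime_not_dvd_unit q e),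
    (Nat.prime_iff_prime_int.1 q.2).dvd_mul, prime_intCast_dvd_iff]
  by_cases hq : q = N
  · subst hq
    simp [not_dvd_of_squarefree_mul hm]
  · simp [hq]

theorem exists_scaledNormClass_eq {A : SymForm ℚ} (hA : A.rank = 2) {N : Nat.Primes} {m : ℤ}
    {e : ℤˣ} (hm : Squarefree ((N : ℕ) * m : ℤ))
    (h : del (mk A) = del (scaledNormClass (e * (N : ℕ)) m)) :
    ∃ (n : ℤ) (ε : ℤˣ), Squarefree ((N : ℕ) * n : ℤ) ∧
      mk A = scaledNormClass (ε * (N : ℕ)) n ∧ A.signature = n.sign * (1 + ε) := by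
  obtain ⟨a, b, ha, hb, hAab, hsig⟩ := exists_squarefree_of_rank_eq_two hA
  have hem : Squarefree (e * (N : ℕ) * m : ℤ) := by
    rw [mul_assoc]
    exact (associated_unit_mul_right _ _ e.isUnit).squarefree_iff.1 hm
  have hab (q : Nat.Primes) : (((q : ℕ) : ℤ) ∣ a ↔ ((q : ℕ) : ℤ) ∣ b) ↔ q ≠ N :=
    (dvd_iff_dvd_iff_of_delPrime_eq ha hb hm.of_mul_right hem
      (hAab ▸ del_eq_iff.1 h q)).trans (prime_dvd_iff_dvd_iff_ne e hm q)
  wlog hNb : ((N : ℕ) : ℤ) ∣ b generalizing a b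
  · have hNa : ((N : ℕ) : ℤ) ∣ a := by
      by_contra hNa
      exact (hab N).1 (iff_of_false hNa hNb) rfl
    exact this b a hb ha (hAab.trans (add_comm _ _)) (hsig.trans (add_comm _ _))
      (fun q => iff_comm.trans (hab q)) hNa
  obtain ⟨ε, hNa, rfl⟩ := exists_unit_mul_prime_mul_eq ha hb hNb hab
  exact ⟨a, ε, hNa, hAab, by rw [hsig, sign_unit_mul_natCast_mul ε N.2.pos]; ring⟩

end Binary

section QuadraticReciprocity

variable {N p : ℕ} [hN : Fact N.Prime] [hp : Fact p.Prime]

theorem isSquare_natCast_of_isSquare_neg (hN8 : N % 8 = 7) (hpN : p ≠ N)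
    (h : IsSquare (-(N : ZMod p))) : IsSquare (p : ZMod N) := by
  have hN2 : N ≠ 2 := by omega
  obtain rfl | hp2 := eq_or_ne p 2
  · exact (ZMod.exists_sq_eq_two_iff hN2).2 (Or.inr hN8)
  rcases Nat.odd_mod_four_iff.1 (hp.1.eq_two_or_odd.resolve_left hp2) with hp4 | hp4
  · have hneg : IsSquare (-1 : ZMod p) := ZMod.exists_sq_eq_neg_one_iff.2 (by omega)
    rw [← ZMod.exists_sq_eq_prime_iff_of_mod_four_eq_one hp4 hN2]
    simpa using hneg.mul h
  · have hN0 : (N : ZMod p) ≠ 0 := by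
      rw [Ne, ZMod.natCast_eq_zero_iff, Nat.prime_dvd_prime_iff_eq hp.1 hN.1]
      exact hpN
    by_contra hsq
    rw [← ZMod.exists_sq_eq_prime_iff_of_mod_four_eq_three hp4 (by omega) hpN] at hsq
    have hneg : IsSquare (-1 : ZMod p) := by
      have := h.div hsq
      rwa [neg_div, div_self hN0] at this
    exact ZMod.exists_sq_eq_neg_one_iff.1 hneg hp4

end QuadraticReciprocity

theorem isSquare_natCast_of_forall_prime_dvd {N m : ℕ}
    (h : ∀ p : ℕ, p.Prime → p ∣ m → IsSquare (p : ZMod N)) : IsSquare (m : ZMod N) := by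
  induction m using induction_on_primes with
  | zero => simp
  | one => simp
  | prime_mul p a hp ih =>
    rw [Nat.cast_mul]
    exact (h p hp (dvd_mul_right _ _)).mul (ih fun q hq hqa => h q hq (hqa.mul_left _))

section Realization

open WittGroup

/-- The signatures of the forms `n⟨1, εN⟩` having the residues of `q₀⟨1, eN⟩`, where `q₀ ≠ N` is a
prime modulo which `-eN` is not a square. -/
def scaledNormSignatures (N q₀ : Nat.Primes) (e : ℤˣ) : Set ℤ :=
  {i | ∃ (n : ℤ) (ε : ℤˣ), Squarefree ((N : ℕ) * n : ℤ) ∧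
    IsSquare (((ε * n) * (e * (q₀ : ℕ)) : ℤ) : ZMod N) ∧
    (∀ q : Nat.Primes, q ≠ N → (HasEvenResidue (ε * (N : ℕ)) n q ↔ q = q₀)) ∧
    n.sign * (1 + ε) = i}

variable {N q₀ : Nat.Primes} {e : ℤˣ}

theorem squarefree_prime_mul_prime (h : q₀ ≠ N) : Squarefree ((N : ℕ) * (q₀ : ℕ) : ℤ) := by
  rw [← Nat.cast_mul, Int.squarefree_natCast, Nat.squarefree_mul_iff]
  exact ⟨(Nat.coprime_primes N.2 q₀.2).2 fun h' => h (Nat.Primes.coe_nat_injective h'.symm),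
    N.2.prime.squarefree, q₀.2.prime.squarefree⟩

theorem hasEvenResidue_unit_mul_prime_iff {d : ℤ} (s : ℤˣ)
    (hd : ¬ IsSquare ((-d : ℤ) : ZMod q₀)) (q : Nat.Primes) :
    HasEvenResidue d (s * (q₀ : ℕ)) q ↔ q = q₀ := by
  rw [HasEvenResidue, (Nat.prime_iff_prime_int.1 q.2).dvd_mul,
    or_iff_right (prime_not_dvd_unit q s), prime_intCast_dvd_iff, and_iff_left_iff_imp]
  rintro rfl
  exact hd

theorem two_le_wittSpan {p : ℕ} [hp : Fact p.Prime] {x : WittGroup ℚ} (h0 : delPrime p x ≠ 0)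
    (hpar : rankParity (delPrime p x) = 0) : 2 ≤ wittSpan x := by
  obtain ⟨A, hA, hr⟩ := exists_rank_eq_wittSpan x
  rw [← del_eq_iff.1 hA ⟨p, hp.1⟩] at h0 hpar
  by_contra! hlt
  interval_cases wittSpan x
  · exact h0 (by rw [SymForm.mk_eq_zero_of_rank_eq_zero hr, map_zero])
  · obtain ⟨u, A', hAA', hA'⟩ := SymForm.exists_iso_unary_sum two_ne_zero hr
    obtain ⟨n, hn, hu, -⟩ := exists_squarefree_unary_eq u
    have hmk : mk A = unary₀ (n : ℚ) := by
      rw [← hu, mk_eq hAA'.wittEquiv, mk_sum, SymForm.mk_eq_zero_of_rank_eq_zero hA', add_zero]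
      rfl
    rw [hmk] at h0 hpar
    rw [rankParity_delPrime_unary₀ hn] at hpar
    split_ifs at hpar with hpn
    · exact one_ne_zero hpar
    · exact h0 (delPrime_unary₀_of_not_dvd hpn)

theorem wittSpan_eq_two_of_hasEvenResidue {B : SymForm ℚ} {d n : ℤ} {p : ℕ} [Fact p.Prime]
    (hrank : B.rank = 2) (hB : mk B = scaledNormClass d n) (hd : ¬ (p : ℤ) ∣ d)
    (hn : Squarefree n) (h : HasEvenResidue d n p) : wittSpan (mk B) = 2 := by
  obtain ⟨a, b, hab, hsq⟩ := h.exists_eq hd hn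
  have ha : a ≠ 0 := by rintro rfl; simp at hsq
  have hb : b ≠ 0 := by rintro rfl; simp at hsq
  refine ((wittSpan_le rfl).trans_eq hrank).antisymm (two_le_wittSpan (p := p) ?_ ?_)
  · rwa [hB, hab, Ne, unary₀_add_eq_zero_iff ha hb]
  · rw [hB, hab, map_add, rankParity_unary₀ ha, rankParity_unary₀ hb]
    rfl

theorem exists_signatureSet_eq_scaledNormSignatures (hq₀ : q₀ ≠ N)
    (h : ¬ IsSquare ((-(e * (N : ℕ)) : ℤ) : ZMod q₀)) :
    ∃ B : SymForm ℚ, wittSpan (mk B) = 2 ∧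
      signatureSet B 2 = scaledNormSignatures N q₀ e := by
  have hsf := squarefree_prime_mul_prime hq₀
  have hres (q : Nat.Primes) : HasEvenResidue (e * (N : ℕ)) (q₀ : ℕ) q ↔ q = q₀ := by
    simpa using hasEvenResidue_unit_mul_prime_iff 1 h q
  obtain ⟨B, hrank, hB, -⟩ := exists_mk_eq_scaledNormClass hsf.of_mul_right.ne_zero N e
  have hspan : wittSpan (mk B) = 2 :=
    wittSpan_eq_two_of_hasEvenResidue hrank hB (prime_not_dvd_unit_mul_prime hq₀ e)
      hsf.of_mul_right ((hres q₀).2 rfl)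
  refine ⟨B, hspan, Set.ext fun i => ⟨?_, ?_⟩⟩
  · rintro ⟨A, hA, -, hdel, rfl⟩
    rw [hB] at hdel
    obtain ⟨n, ε, hn, hmk, hsig⟩ := exists_scaledNormClass_eq hA hsf hdel
    obtain ⟨hN, hq⟩ := (del_scaledNormClass_eq_iff hn hsf).1 (hmk ▸ hdel)
    exact ⟨n, ε, hn, hN, fun q hqN => (hq q hqN).trans (hres q), hsig.symm⟩
  · rintro ⟨n, ε, hn, hN, hq, rfl⟩
    obtain ⟨A, hA, hmk, hsig⟩ := exists_mk_eq_scaledNormClass hn.of_mul_right.ne_zero N ε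
    have hdel : del (mk A) = del (mk B) := by
      rw [hmk, hB, del_scaledNormClass_eq_iff hn hsf]
      exact ⟨hN, fun q hqN => (hq q hqN).trans (hres q).symm⟩
    rw [← hsig, ← hA]
    exact signature_mem_signatureSet hdel (by omega)

theorem mem_scaledNormSignatures (hq₀ : q₀ ≠ N) (s ε : ℤˣ)
    (hN : IsSquare ((ε * s * e : ℤ) : ZMod N))
    (h : ¬ IsSquare ((-(ε * (N : ℕ)) : ℤ) : ZMod q₀)) :
    (s * (1 + ε) : ℤ) ∈ scaledNormSignatures N q₀ e := by
  refine ⟨s * (q₀ : ℕ), ε, ?_, ?_, fun q _ => hasEvenResidue_unit_mul_prime_iff s h q, ?_⟩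
  · rw [mul_left_comm]
    exact (associated_unit_mul_right _ _ s.isUnit).squarefree_iff.1
      (squarefree_prime_mul_prime hq₀)
  · rw [show (ε * (s * (q₀ : ℕ)) * (e * (q₀ : ℕ)) : ℤ) = ε * s * e * ((q₀ : ℕ) * (q₀ : ℕ)) by ring,
      Int.cast_mul]
    exact hN.mul ⟨((q₀ : ℕ) : ℤ), by push_cast; rfl⟩
  · rw [Int.sign_mul, Int.sign_natCast_of_ne_zero q₀.2.ne_zero, mul_one]
    rcases Int.units_eq_one_or s with rfl | rfl <;> rfl

theorem zero_mem_scaledNormSignatures_iff (hq₀ : q₀ ≠ N) :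
    0 ∈ scaledNormSignatures N q₀ e ↔ ¬ IsSquare (((N : ℕ) : ℤ) : ZMod q₀) := by
  constructor
  · rintro ⟨n, ε, hn, -, hq, hi⟩
    obtain rfl : ε = -1 := by
      rcases Int.units_eq_one_or ε with rfl | rfl
      · simp [hn.of_mul_right.ne_zero] at hi
      · rfl
    simpa using ((hq q₀ hq₀).2 rfl).2
  · intro h
    have hone : ((-1 : ℤˣ) * (-e : ℤˣ) * e : ℤ) = 1 := by
      rcases Int.units_eq_one_or e with rfl | rfl <;> rfl
    simpa using mem_scaledNormSignatures hq₀ (-e) (-1) (e := e)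
      (by rw [hone, Int.cast_one]; exact IsSquare.one) (by simpa using h)

theorem eq_zero_of_mem_scaledNormSignatures (hq₀ : q₀ ≠ N)
    (h : IsSquare ((-(N : ℕ) : ℤ) : ZMod q₀)) {i : ℤ} (hi : i ∈ scaledNormSignatures N q₀ e) :
    i = 0 := by
  obtain ⟨n, ε, -, -, hq, rfl⟩ := hi
  rcases Int.units_eq_one_or ε with rfl | rfl
  · exact absurd (by simpa using h) ((hq q₀ hq₀).2 rfl).2
  · simp

theorem isSquare_natCast_of_hasEvenResidue_iff (hN8 : (N : ℕ) % 8 = 7) {m : ℕ}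
    (hn : Squarefree ((N : ℕ) * ((q₀ : ℕ) * -m) : ℤ))
    (hq : ∀ q : Nat.Primes, q ≠ N → (HasEvenResidue (N : ℕ) ((q₀ : ℕ) * -m) q ↔ q = q₀)) :
    IsSquare (m : ZMod N) := by
  refine isSquare_natCast_of_forall_prime_dvd fun p hp hpm => ?_
  have hpk : (p : ℤ) ∣ -m := (dvd_neg (α := ℤ)).2 (by exact_mod_cast hpm)
  have hpN : p ≠ N := by
    rintro rfl
    exact not_dvd_of_squarefree_mul hn (hpk.mul_left _)
  have hpq₀ : p ≠ q₀ := by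
    rintro rfl
    exact not_dvd_of_squarefree_mul hn.of_mul_right hpk
  have hpF : Fact p.Prime := ⟨hp⟩
  refine isSquare_natCast_of_isSquare_neg hN8 hpN ?_
  by_contra hns
  exact hpq₀ (congrArg Subtype.val ((hq ⟨p, hp⟩ fun h => hpN (congrArg Subtype.val h)).1
    ⟨hpk.mul_left _, by simpa using hns⟩))

/- If `n⟨1, N⟩` is negative definite, then `n = -q₀m` with `m > 0` a product of primes modulo which
`-N` is a square; by reciprocity `m`, and hence `-1`, would be a square modulo `N`. -/
theorem neg_two_notMem_scaledNormSignatures (hq₀ : q₀ ≠ N) (hN8 : (N : ℕ) % 8 = 7) :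
    -2 ∉ scaledNormSignatures N q₀ 1 := by
  rintro ⟨n, ε, hn, hsq, hq, hi⟩
  obtain rfl : ε = 1 := by
    rcases Int.units_eq_one_or ε with rfl | rfl
    · rfl
    · simp at hi
  obtain ⟨⟨k, rfl⟩, -⟩ := (hq q₀ hq₀).2 rfl
  obtain ⟨m, rfl⟩ : ∃ m : ℕ, k = -m := by
    rw [Int.sign_mul, Int.sign_natCast_of_ne_zero q₀.2.ne_zero, one_mul] at hi
    have hk : k < 0 := Int.sign_eq_neg_one_iff_neg.1 (by norm_num at hi; omega)
    exact ⟨k.natAbs, by omega⟩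
  have hNn := not_dvd_of_squarefree_mul hn
  have hm : IsSquare (m : ZMod N) :=
    isSquare_natCast_of_hasEvenResidue_iff hN8 hn fun q hqN => by simpa using hq q hqN
  have hn0 := intCast_ne_zero_of_not_dvd hNn
  have hquot : ((((1 : ℤˣ) * ((q₀ : ℕ) * -m)) * ((1 : ℤˣ) * (q₀ : ℕ)) : ℤ) : ZMod N) /
      (m * ((q₀ : ℕ) * (q₀ : ℕ))) = -1 := by
    rw [Int.cast_mul, Int.cast_neg, Int.cast_natCast, Int.cast_natCast, mul_ne_zero_iff,
      neg_ne_zero] at hn0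
    rw [div_eq_iff (mul_ne_zero hn0.2 (mul_ne_zero hn0.1 hn0.1))]
    push_cast
    ring
  have hneg : IsSquare (-1 : ZMod N) := hquot ▸ hsq.div (hm.mul (IsSquare.mul_self _))
  exact ZMod.exists_sq_eq_neg_one_iff.1 hneg (by omega)

end Realization

section Table

open WittGroup

theorem del_mk_neg (A : SymForm ℚ) : del (mk A.neg) = -del (mk A) := by
  rw [mk_neg, map_neg]

theorem wittSpan_mk_neg_le (B : SymForm ℚ) : wittSpan (mk B.neg) ≤ wittSpan (mk B) := by
  obtain ⟨A, hA, hr⟩ := exists_rank_eq_wittSpan (mk B)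
  exact (wittSpan_le (A := A.neg) (by rw [del_mk_neg, del_mk_neg, hA])).trans_eq hr

theorem wittSpan_mk_neg (B : SymForm ℚ) : wittSpan (mk B.neg) = wittSpan (mk B) := by
  refine (wittSpan_mk_neg_le B).antisymm ?_
  have h := wittSpan_mk_neg_le B.neg
  rwa [mk_neg B.neg, mk_neg B, neg_neg, ← mk_neg B] at h

theorem mem_signatureSet_neg_iff {B : SymForm ℚ} {r : ℕ} {i : ℤ} :
    i ∈ signatureSet B.neg r ↔ -i ∈ signatureSet B r := by
  constructor
  · rintro ⟨A, hr, hA, hdel, rfl⟩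
    exact ⟨A.neg, hr, SymForm.anisotropic_neg_iff.2 hA,
      by rw [del_mk_neg, hdel, del_mk_neg, neg_neg], A.signature_neg⟩
  · rintro ⟨A, hr, hA, hdel, hs⟩
    exact ⟨A.neg, hr, SymForm.anisotropic_neg_iff.2 hA, by rw [del_mk_neg, hdel, del_mk_neg],
      by rw [SymForm.signature_neg, hs, neg_neg]⟩

variable {S : Set ℤ}

theorem eq_of_mem_iff_of_subset {T : Set ℤ} (hS : S ⊆ {0, 2, -2}) (hT : T ⊆ {0, 2, -2})
    (h0 : 0 ∈ T ↔ 0 ∈ S) (h2 : 2 ∈ T ↔ 2 ∈ S) (hneg : -2 ∈ T ↔ -2 ∈ S) : T = S := by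
  refine Set.ext fun i => ⟨fun hi => ?_, fun hi => ?_⟩
  · rcases hT hi with rfl | rfl | rfl
    exacts [h0.1 hi, h2.1 hi, hneg.1 hi]
  · rcases hS hi with rfl | rfl | rfl
    exacts [h0.2 hi, h2.2 hi, hneg.2 hi]

theorem exists_signatureSet_eq_of_mem_iff (hS : S ⊆ {0, 2, -2}) (h2 : 2 ∈ S) {N q₀ : Nat.Primes}
    (hq₀ : (q₀ : ℕ) ≠ N) (hsq : ¬ IsSquare ((-(N : ℕ) : ℤ) : ZMod q₀))
    (h0 : ¬ IsSquare (((N : ℕ) : ℤ) : ZMod q₀) ↔ 0 ∈ S)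
    (hneg : -2 ∈ scaledNormSignatures N q₀ 1 ↔ -2 ∈ S) :
    ∃ B : SymForm ℚ, wittSpan (mk B) = 2 ∧ signatureSet B 2 = S := by
  have hne : q₀ ≠ N := ne_of_apply_ne _ hq₀
  replace hsq : ¬ IsSquare ((-((1 : ℤˣ) * (N : ℕ)) : ℤ) : ZMod q₀) := by simpa using hsq
  obtain ⟨B, hspan, hB⟩ := exists_signatureSet_eq_scaledNormSignatures hne hsq
  have hmem : 2 ∈ scaledNormSignatures N q₀ 1 :=
    mem_scaledNormSignatures hne 1 1 (by simp) hsq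
  exact ⟨B, hspan, eq_of_mem_iff_of_subset hS signatureSet_two_subset
    (hB ▸ (zero_mem_scaledNormSignatures_iff hne).trans h0) (hB ▸ iff_of_true hmem h2)
    (hB ▸ hneg)⟩

/-- The prime `7`. -/
def primeSeven : Nat.Primes := ⟨7, by norm_num⟩

theorem exists_signatureSet_eq_of_two_mem (hS : S ⊆ {0, 2, -2}) (h2 : 2 ∈ S) :
    ∃ B : SymForm ℚ, wittSpan (mk B) = 2 ∧ signatureSet B 2 = S := by
  have hneg_two {q₀ : Nat.Primes} (hq₀ : (q₀ : ℕ) ≠ 2)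
      (hsq : ¬ IsSquare ((-2 : ℤ) : ZMod q₀)) : -2 ∈ scaledNormSignatures primeTwo q₀ 1 :=
    mem_scaledNormSignatures (ne_of_apply_ne _ hq₀) (-1) 1
      (FiniteField.isSquare_of_char_two (ZMod.ringChar_zmod_n 2) _) hsq
  have hneg_seven {q₀ : Nat.Primes} (hq₀ : (q₀ : ℕ) ≠ 7) :
      -2 ∉ scaledNormSignatures primeSeven q₀ 1 :=
    neg_two_notMem_scaledNormSignatures (ne_of_apply_ne _ hq₀) rfl
  have h25 : ¬ IsSquare ((-2 : ℤ) : ZMod 5) ∧ ¬ IsSquare ((2 : ℤ) : ZMod 5) := by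
    unfold IsSquare; decide
  have h27 : ¬ IsSquare ((-2 : ℤ) : ZMod 7) ∧ IsSquare ((2 : ℤ) : ZMod 7) := by
    unfold IsSquare; decide
  have h75 : ¬ IsSquare ((-7 : ℤ) : ZMod 5) ∧ ¬ IsSquare ((7 : ℤ) : ZMod 5) := by
    unfold IsSquare; decide
  have h73 : ¬ IsSquare ((-7 : ℤ) : ZMod 3) ∧ IsSquare ((7 : ℤ) : ZMod 3) := by
    unfold IsSquare; decide
  by_cases hneg : -2 ∈ S <;> by_cases h0 : 0 ∈ S
  · exact exists_signatureSet_eq_of_mem_iff hS h2 (N := primeTwo) (q₀ := ⟨5, Nat.prime_five⟩)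
      (by decide) h25.1 (iff_of_true h25.2 h0) (iff_of_true (hneg_two (by decide) h25.1) hneg)
  · exact exists_signatureSet_eq_of_mem_iff hS h2 (N := primeTwo) (q₀ := primeSeven)
      (by decide) h27.1 (iff_of_false (not_not.2 h27.2) h0)
      (iff_of_true (hneg_two (by decide) h27.1) hneg)
  · exact exists_signatureSet_eq_of_mem_iff hS h2 (N := primeSeven) (q₀ := ⟨5, Nat.prime_five⟩)
      (by decide) h75.1 (iff_of_true h75.2 h0) (iff_of_false (hneg_seven (by decide)) hneg)
  · exact exists_signatureSet_eq_of_mem_iff hS h2 (N := primeSeven) (q₀ := ⟨3, Nat.prime_three⟩)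
      (by decide) h73.1 (iff_of_false (not_not.2 h73.2) h0)
      (iff_of_false (hneg_seven (by decide)) hneg)

theorem exists_signatureSet_eq_zero :
    ∃ B : SymForm ℚ, wittSpan (mk B) = 2 ∧ signatureSet B 2 = {0} := by
  have hne : (⟨3, Nat.prime_three⟩ : Nat.Primes) ≠ primeTwo :=
    ne_of_apply_ne (fun q : Nat.Primes => (q : ℕ)) (by decide)
  have hsq : ¬ IsSquare ((2 : ℤ) : ZMod 3) := by unfold IsSquare; decide
  have hsq' : ¬ IsSquare ((-((-1 : ℤˣ) * (primeTwo : ℕ)) : ℤ) : ZMod 3) := by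
    simpa [primeTwo] using hsq
  have hsq_neg : IsSquare ((-2 : ℤ) : ZMod 3) := ⟨1, by decide⟩
  obtain ⟨B, hspan, hB⟩ := exists_signatureSet_eq_scaledNormSignatures (e := -1) hne hsq'
  refine ⟨B, hspan, hB ▸ Set.Subset.antisymm
    (fun i hi => eq_zero_of_mem_scaledNormSignatures hne hsq_neg hi) ?_⟩
  exact Set.singleton_subset_iff.2 ((zero_mem_scaledNormSignatures_iff hne).2 hsq)

theorem exists_signatureSet_eq (hS : S ⊆ {0, 2, -2}) (hne : S.Nonempty) :
    ∃ B : SymForm ℚ, wittSpan (mk B) = 2 ∧ signatureSet B 2 = S := by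
  by_cases h2 : 2 ∈ S
  · exact exists_signatureSet_eq_of_two_mem hS h2
  by_cases hneg : -2 ∈ S
  · have hS' : Neg.neg ⁻¹' S ⊆ {0, 2, -2} := fun i hi => by
      rcases hS hi with h | h | h <;> simp at h ⊢ <;> omega
    obtain ⟨B, hspan, hB⟩ := exists_signatureSet_eq_of_two_mem hS' hneg
    refine ⟨B.neg, (wittSpan_mk_neg B).trans hspan, Set.ext fun i => ?_⟩
    rw [mem_signatureSet_neg_iff, hB, Set.mem_preimage, neg_neg]
  · have hS0 : S ⊆ {0} := fun i hi => by
      rcases hS hi with rfl | rfl | rfl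
      exacts [rfl, absurd hi h2, absurd hi hneg]
    rw [hne.subset_singleton_iff.1 hS0]
    exact exists_signatureSet_eq_zero

end Table

end

theorem theorem3p3 :
    (∀ B : SymForm ℚ,
      -- (i)
      (wittSpan (WittGroup.mk B) = 0 ↔ del (WittGroup.mk B) = 0) ∧
      -- (ii)
      (wittSpan (WittGroup.mk B) = 1 ↔
        (signatureSet B 1).Nonempty ∧ del (WittGroup.mk B) ≠ 0) ∧
      -- (iii)
      (wittSpan (WittGroup.mk B) = 2 ↔
        (signatureSet B 2).Nonempty ∧
          ∀ i ∈ signatureSet B 2, ∀ A : SymForm ℚ, IsPreimageForm B 2 i A →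
            (A.sum (SymForm.unary 1)).Anisotropic ∧ (A.sum (SymForm.unary (-1))).Anisotropic) ∧
      signatureSet B 2 ⊆ {0, 2, -2} ∧
      -- (iv)
      (wittSpan (WittGroup.mk B) = 3 ↔
        signatureSet B 3 = {1, -1, 3, -3} ∧
          ∀ i ∈ signatureSet B 3, ∀ A : SymForm ℚ, IsPreimageForm B 3 i A →
            (A.sum (SymForm.unary 1)).Anisotropic ∧ (A.sum (SymForm.unary (-1))).Anisotropic)) ∧
    -- every non-empty subset of `{0, 2, -2}` occurs as `I_2` in case (iii)
    (∀ S : Set ℤ, S ⊆ {0, 2, -2} → S.Nonempty →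
      ∃ B : SymForm ℚ, wittSpan (WittGroup.mk B) = 2 ∧ signatureSet B 2 = S) :=
  ⟨fun _ => ⟨wittSpan_eq_zero_iff _, wittSpan_eq_one_iff, wittSpan_eq_two_iff,
    signatureSet_two_subset, wittSpan_eq_three_iff⟩,
    fun _ hS hne => exists_signatureSet_eq hS hne⟩
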